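/- Let $N\in\mathbb N$, $a,b,x_0\in\mathbb R$, $h>0$, let $a_{1d},\dots,a_{Nd}\in\mathbb R$ be not all zero, let $\phi:[-Nh,0]\to\mathbb R$ be continuous (with $\phi(0)\neq x_0$ allowed) and let $u$ be integrable on $[0,T]$ for every $T>0$. Consider $$\dot x(t)=a x(t)+\sum_{j=1}^N a_{jd}\,x(t-jh)+b\,u(t)\quad(t>0),\qquad x(0)=x_0,\qquad x(\tau)=\phi(\tau)\quad(-Nh\le\tau<0),$$ where a solution is locally absolutely continuous on $[0,\infty)$ and satisfies the equation for almost every $t>0$. In the same sense let $\Psi$ be the fundamental solution: $\dot\Psi(t)=a\Psi(t)+\sum_{j=1}^N a_{jd}\Psi(t-jh)$ for $t>0$, $\Psi(0)=1$, $\Psi(t)=0$ for $t<0$. Put $$\Delta(s)=s-a-\sum_{j=1}^N a_{jd}e^{-jsh},\qquad \Phi_j(s)=\int_{-jh}^0\phi(\tau)e^{-s\tau}\,d\tau ,$$ and assume that all zeros of $\Delta$ in $\mathbb C$ are simple. Then: 1. Let $Z(s)=\sum_{j=1}^N a_{jd}\,h\,e^{-jah}e^{-(j-1)(s-a)h}$.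 A complex number $s$ is a zero of $\Delta$ if and only if $s=\frac1h W_k(Z(s))+a$ for some $k\in\mathbb Z$ (with $k=0$ if $Z(s)=0$), where $W_k$ is the $k$-th branch of the Lambert W function. 2. The zeros of $\Delta$ can be listed, each exactly once, as $(S_k)_{k\in\mathbb Z}$ in such a way that, for some constant $B$, $|\operatorname{Im}S_k|\le|\operatorname{Im}S_l|+B$ whenever $|k|\le|l|$. 3. For every such listing, put $$C_k=\frac1{1+\sum_{j=1}^N j\,a_{jd}\,h\,e^{-jS_kh}},\qquad C^I_k=C_k\sum_{j=1}^N a_{jd}\,e^{-jS_kh}\,\Phi_j(S_k).$$ Then for every $t>0$ $$\Psi(t)=\sum_{k=-\infty}^{\infty}C_k e^{S_kt},$$ $$x(t)=\sum_{k=-\infty}^{\infty}C_k e^{S_kt}x_0+\sum_{k=-\infty}^{\infty}C^I_k e^{S_kt}+\int_0^t\sum_{k=-\infty}^{\infty}C_k e^{S_k(t-\tau)}\,b\,u(\tau)\,d\tau .$$ Here the series with coefficients $C_k$ converge absolutely (the one under the integral for every $\tau<t$), the series with coefficients $C^I_k$ converges as the limit of its symmetric partial sums $\sum_{k=-M}^{M}$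 as $M\to\infty$, and the integrand of the last term is integrable on $[0,t]$. -/

import Mathlib

open Complex MeasureTheory Set Filter Topology
open scoped Real Interval

noncomputable section

namespace DelaySystem

/-- The characteristic function `Δ(s) = s - a - ∑_{j=1}^N a_{jd} e^{-jsh}`. -/
def charFun (N : ℕ) (a : ℝ) (ad : ℕ → ℝ) (h : ℝ) (s : ℂ) : ℂ :=
  s - (a : ℂ) - ∑ j ∈ Finset.Icc 1 N, (ad j : ℂ) * cexp (-((j : ℂ) * s * (h : ℂ)))

/-- `Φ_j(s) = ∫_{-jh}^0 φ(τ) e^{-sτ} dτ`. -/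
def preshapeTransform (φ : ℝ → ℝ) (h : ℝ) (j : ℕ) (s : ℂ) : ℂ :=
  ∫ τ in (-((j : ℝ) * h))..0, (φ τ : ℂ) * cexp (-(s * (τ : ℂ)))

/-- The coefficient `1 / (1 + ∑_{j=1}^N j a_{jd} h e^{-jsh})`; its value at `s = S_k` is `C_k`. -/
def modeCoeff (N : ℕ) (ad : ℕ → ℝ) (h : ℝ) (s : ℂ) : ℂ :=
  1 / (1 + ∑ j ∈ Finset.Icc 1 N,
    (j : ℂ) * (ad j : ℂ) * (h : ℂ) * cexp (-((j : ℂ) * s * (h : ℂ))))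

/-- The coefficient `C(s) ∑_{j=1}^N a_{jd} e^{-jsh} Φ_j(s)`; its value at `s = S_k` is `C^I_k`. -/
def modeCoeffInit (N : ℕ) (ad : ℕ → ℝ) (h : ℝ) (φ : ℝ → ℝ) (s : ℂ) : ℂ :=
  modeCoeff N ad h s * ∑ j ∈ Finset.Icc 1 N,
    (ad j : ℂ) * cexp (-((j : ℂ) * s * (h : ℂ))) * preshapeTransform φ h j s

/-- `x` solves `x'(t) = a x(t) + ∑_{j=1}^N a_{jd} x(t - jh) + b u(t)` for `t > 0`, with
`x(0) = x₀` and `x = φ` on `[-Nh, 0)`. As `x` may jump at `0` and `u` may be discontinuous, `x` is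
locally absolutely continuous on `[0, ∞)` and the equation holds for almost every `t > 0`. -/
structure IsSolution (N : ℕ) (a : ℝ) (ad : ℕ → ℝ) (b h x₀ : ℝ) (φ u x : ℝ → ℝ) : Prop where
  absCont : ∀ T : ℝ, 0 < T → AbsolutelyContinuousOnInterval x 0 T
  hasDeriv : ∀ᵐ t : ℝ, 0 < t →
    HasDerivAt x (a * x t + ∑ j ∈ Finset.Icc 1 N, ad j * x (t - (j : ℝ) * h) + b * u t) t
  init : x 0 = x₀
  preshape : ∀ τ : ℝ, -((N : ℝ) * h) ≤ τ → τ < 0 → x τ = φ τ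

/-- `Ψ` is the fundamental solution (state transition function):
`Ψ'(t) = a Ψ(t) + ∑_{j=1}^N a_{jd} Ψ(t - jh)` for `t > 0`, `Ψ(0) = 1`, `Ψ(t) = 0` for `t < 0`.
(The two one-sided derivatives of `Ψ` may differ at the points `jh`, so that the equation is
required almost everywhere, for a locally absolutely continuous `Ψ` on `[0, ∞)`.) -/
structure IsFundamentalSolution (N : ℕ) (a : ℝ) (ad : ℕ → ℝ) (h : ℝ) (Ψ : ℝ → ℝ) : Prop where
  absCont : ∀ T : ℝ, 0 < T → AbsolutelyContinuousOnInterval Ψ 0 T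
  hasDeriv : ∀ᵐ t : ℝ, 0 < t →
    HasDerivAt Ψ (a * Ψ t + ∑ j ∈ Finset.Icc 1 N, ad j * Ψ (t - (j : ℝ) * h)) t
  init : Ψ 0 = 1
  zero_of_neg : ∀ t : ℝ, t < 0 → Ψ t = 0

/-- `S : ℤ → ℂ` lists every root of the characteristic function exactly once, by increasing size of
the imaginary part up to a bounded error. -/
structure IsRootNumbering (N : ℕ) (a : ℝ) (ad : ℕ → ℝ) (h : ℝ) (S : ℤ → ℂ) : Prop where
  injective : Function.Injective S
  range_eq : Set.range S = {s : ℂ | charFun N a ad h s = 0}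
  ordered : ∃ B : ℝ, ∀ k l : ℤ, |k| ≤ |l| → |(S k).im| ≤ |(S l).im| + B

/-- The range of the `k`-th branch of the Lambert W function, with the usual branch cuts (`(-∞, -1/e]`
for `k = 0`, `(-∞, 0]` otherwise, closed from above). The value `w` of branch `k` at `z ≠ 0` is
determined by `w + Log w = Log z + 2πik`, i.e. `Im (w + Log w)` lies in `((2k-1)π, (2k+1)π]`, except
that the real values `w < -1` belong to branch `-1` instead of branch `0`. The branches `0` and `-1`
share the value `w = -1`, taken at the branch point `z = -1/e`. -/
def lambertWRange (k : ℤ) : Set ℂ :=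
  {w : ℂ | (k = 0 ∧ w = 0) ∨
    (k = -1 ∧ w.im = 0 ∧ w.re ≤ -1) ∨
    (w ≠ 0 ∧ ¬ (k = 0 ∧ w.im = 0 ∧ w.re < -1) ∧
      (2 * (k : ℝ) - 1) * π < (w + Complex.log w).im ∧
      (w + Complex.log w).im ≤ (2 * (k : ℝ) + 1) * π)}

/-- The `k`-th branch `W_k` of the Lambert W function: `W_k(z)` is the point `w` of the range of the
`k`-th branch with `w e^w = z`. (There is exactly one, except that there is none if `z = 0` and
`k ≠ 0`.) -/
def lambertW (k : ℤ) (z : ℂ) : ℂ :=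
  Classical.epsilon fun w : ℂ => w ∈ lambertWRange k ∧ w * cexp w = z

/-- The argument `∑_{j=1}^N a_{jd} h e^{-jah} e^{-(j-1)(s-a)h}` of the Lambert W function in the
fixed point form of the characteristic equation. -/
def lambertArg (N : ℕ) (a : ℝ) (ad : ℕ → ℝ) (h : ℝ) (s : ℂ) : ℂ :=
  ∑ j ∈ Finset.Icc 1 N, (ad j : ℂ) * (h : ℂ) * cexp (-((j : ℂ) * (a : ℂ) * (h : ℂ))) *
    cexp (-(((j : ℂ) - 1) * (s - (a : ℂ)) * (h : ℂ)))

end DelaySystem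

end

/-! Multiplying `Δ(s)` by `h e^{(s-a)h}` turns the characteristic equation into `w e^w = Z(s)` with
`w = (s-a)h`. The first claim therefore needs only that each branch of `W` takes its value exactly
once and that the ranges of the branches cover the plane. Both are read off from `w + Log w = Log z
+ 2πik` (`exists_mem_lambertWRange`, `lambertWRange_injOn`, `exists_lambertWRange`).

For the rest let `m` be the largest index with `a_{md} ≠ 0`, `p = mh` and `E(s) = a_{md} e^{-ps}`
(`lead`). Up to an error `C + δ|E(s)|` with `δ` as small as desired, `Δ(s)` is `s - E(s)`
(`charFun_sub_le`). At large roots `|E(s)|` is thus close to `|s|`. Hence `Re s = O(log |s|)`, the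
roots are separated by their imaginary parts, and there is one near each of a sequence of heights
`2π/p` apart. Moreover `C_k = O(1/|S_k|)` and `e^{S_k t} = O(|S_k|^{-t/p})`. This gives the
numbering and the absolute convergence of the series with `C_k`; the terms with `C^I_k` are only
seen to be `O(|S_k|^{-t/p})`.

The expansion itself is a residue computation. For a homogeneous mild solution `y`, the Laplace
transform `L` truncated at `t` satisfies `Δ L = x₀ + G - e^{-st}(y(t) + H)`, with `G` from the
initial function and `H` from the history before `t` (`IsMildSolution.charFun_mul_truncLaplace`).
The residues of `e^{st}(x₀ + G)/Δ` are the modal terms. Subtracting the entire function `e^{st}L`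
and the pole `y(t)/s` leaves a remainder whose integrals tend to zero along circles on which `|Δ| ≥
(|s| + |E|)/8` (`charFun_ge_on_goodRadius`, `IsMildSolution.norm_mul_contourRemainder_le`). The sums
over discs therefore tend to `y(t)`. They differ from symmetric partial sums by boundedly many
terms, each tending to zero (`IsRootNumbering.hasSum_symmetricIcc`).

The input is handled by variation of constants: a fundamental solution is built by the method of
steps, and subtracting its convolution with `bu` from `x` leaves a homogeneous mild solution. The
expansion holds for every mild solution, so no uniqueness theorem is needed. -/

namespace DelaySystem

/-! ### Branches of the Lambert W function -/

/-- `w + Log w` in polar form along the horizontal line of height `v + θ`. -/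
theorem add_log_of_polar {v θ : ℝ} (hv : 0 < v) (hθ : θ ∈ Ioo 0 π) :
    ((v * Real.cos θ / Real.sin θ : ℝ) + (v : ℂ) * I) +
      Complex.log ((v * Real.cos θ / Real.sin θ : ℝ) + (v : ℂ) * I) =
      ((v * Real.cos θ / Real.sin θ + Real.log (v / Real.sin θ) : ℝ) : ℂ) +
        ((v + θ : ℝ) : ℂ) * I := by
  have hs : 0 < Real.sin θ := Real.sin_pos_of_mem_Ioo hθ
  have hr : 0 < v / Real.sin θ := div_pos hv hs
  have hw : ((v * Real.cos θ / Real.sin θ : ℝ) + (v : ℂ) * I) =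
      ((v / Real.sin θ : ℝ) : ℂ) * (Complex.cos θ + Complex.sin θ * I) := by
    have : (Complex.sin (θ : ℂ)) ≠ 0 := by exact_mod_cast hs.ne'
    push_cast
    field_simp
  have hmem : θ ∈ Ioc (-π) π := ⟨by linarith [hθ.1, Real.pi_pos], hθ.2.le⟩
  have harg := Complex.arg_mul_cos_add_sin_mul_I hr hmem
  have hnorm : ‖((v / Real.sin θ : ℝ) : ℂ) * (Complex.cos θ + Complex.sin θ * I)‖ =
      v / Real.sin θ := by
    rw [← Complex.exp_mul_I, norm_mul, Complex.norm_exp_ofReal_mul_I, mul_one,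
      Complex.norm_of_nonneg hr.le]
  have hlog : Complex.log ((v * Real.cos θ / Real.sin θ : ℝ) + (v : ℂ) * I) =
      (Real.log (v / Real.sin θ) : ℂ) + (θ : ℂ) * I := by
    rw [hw, Complex.log, harg, hnorm]
  rw [hlog]
  push_cast
  ring

/-- Before `π/2` this is `v < tan v`; from `π/2` on the left side is nonpositive. It is the
inequality behind the bound `-1` in the next lemma. -/
theorem mul_cos_lt_sin {v : ℝ} (h0 : 0 < v) (hπ : v < π) : v * Real.cos v < Real.sin v := by
  rcases lt_or_ge v (π / 2) with h | h
  · have hc := Real.cos_pos_of_mem_Ioo ⟨by linarith, h⟩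
    have := Real.lt_tan h0 h
    rwa [Real.tan_eq_sin_div_cos, lt_div_iff₀ hc] at this
  · have hc : Real.cos v ≤ 0 := Real.cos_nonpos_of_pi_div_two_le_of_le h (by linarith)
    nlinarith [Real.sin_pos_of_pos_of_lt_pi h0 hπ]

/-- In the upper half plane the points with `Im (w + Log w) = π` have `Re (w + Log w) > -1`. -/
theorem neg_one_lt_re_add_log {w : ℂ} (hw : 0 < w.im) (hπ : (w + Complex.log w).im = π) :
    -1 < (w + Complex.log w).re := by
  have hw0 : w ≠ 0 := by rintro rfl; simp at hw
  have hnorm : 0 < ‖w‖ := norm_pos_iff.2 hw0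
  have harg : w.arg = π - w.im := by
    simp only [add_im, Complex.log_im] at hπ; linarith
  have hargpos : 0 < w.arg := by
    rcases (Complex.arg_nonneg_iff.2 hw.le).lt_or_eq with h | h
    · exact h
    · exact absurd (Complex.arg_eq_zero_iff.1 h.symm).2 hw.ne'
  have hv : w.im < π := by linarith
  have hsin := Real.sin_pos_of_pos_of_lt_pi hw hv
  have h1 : ‖w‖ * Real.sin w.im = w.im := by
    have := Complex.norm_mul_sin_arg w
    rwa [harg, Real.sin_pi_sub] at this
  have h2 : w.re = -(‖w‖ * Real.cos w.im) := by
    have := Complex.norm_mul_cos_arg w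
    rw [harg, Real.cos_pi_sub] at this
    linarith
  -- From `‖w‖ sin(Im w) = Im w` and `sin v ≤ v`.
  have h3 : 1 ≤ ‖w‖ := by
    have := Real.sin_le hw.le
    by_contra hlt
    push Not at hlt
    nlinarith
  have h4 : ‖w‖ * Real.cos w.im < 1 := by
    have := mul_cos_lt_sin hw hv
    have h5 : (‖w‖ * Real.cos w.im) * Real.sin w.im < 1 * Real.sin w.im := by
      calc _ = (‖w‖ * Real.sin w.im) * Real.cos w.im := by ring
        _ = w.im * Real.cos w.im := by rw [h1]
        _ < _ := by linarith
    exact lt_of_mul_lt_mul_right h5 hsin.le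
  rw [add_re, Complex.log_re, h2]
  have := Real.log_nonneg h3
  linarith

/-- `w + Log w` is injective on the upper half plane, since `Im (1 + 1 / w) < 0` there. -/
theorem add_log_injOn_upper : InjOn (fun w : ℂ => w + Complex.log w) {w | 0 < w.im} := by
  intro w₁ h₁ w₂ h₂ heq
  by_contra hne
  have hd : w₂ - w₁ ≠ 0 := sub_ne_zero.2 (Ne.symm hne)
  set γ : ℝ → ℂ := fun τ => w₁ + (τ : ℂ) * (w₂ - w₁) with hγ
  have him : ∀ τ ∈ Icc (0 : ℝ) 1, 0 < (γ τ).im := by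
    intro τ hτ
    have : (γ τ).im = (1 - τ) * w₁.im + τ * w₂.im := by
      simp [hγ]; ring
    rw [this]
    rcases hτ.1.eq_or_lt with h | h
    · rw [← h]; simpa using h₁
    · have := mul_pos h (show 0 < w₂.im from h₂)
      have := mul_nonneg (sub_nonneg.2 hτ.2) (show 0 < w₁.im from h₁).le
      linarith
  -- Dividing by the chord `w₂ - w₁` makes the derivative along the segment equal to `1 + 1/γ`,
  -- whatever the direction. Rolle's theorem for the imaginary part then contradicts its negative
  -- sign.
  have hder : ∀ τ ∈ Icc (0 : ℝ) 1, HasDerivAt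
      (fun τ : ℝ => ((γ τ + Complex.log (γ τ)) / (w₂ - w₁)).im) ((1 + (γ τ)⁻¹).im) τ := by
    intro τ hτ
    have hsl : γ τ ∈ slitPlane := Or.inr (him τ hτ).ne'
    have h1 : HasDerivAt γ (w₂ - w₁) τ := by
      have := ((Complex.ofRealCLM.hasDerivAt (x := τ)).mul_const (w₂ - w₁)).const_add w₁
      simpa [hγ] using this
    have h2 := ((h1.add (h1.clog_real hsl)).div_const (w₂ - w₁))
    have h3 : (w₂ - w₁ + (w₂ - w₁) / γ τ) / (w₂ - w₁) = 1 + (γ τ)⁻¹ := by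
      have : γ τ ≠ 0 := slitPlane_ne_zero hsl
      field_simp
    rw [h3] at h2
    exact (Complex.imCLM.hasFDerivAt.comp_hasDerivAt τ h2)
  obtain ⟨c, hc, hc0⟩ := exists_hasDerivAt_eq_zero (f := fun τ : ℝ =>
      ((γ τ + Complex.log (γ τ)) / (w₂ - w₁)).im) zero_lt_one
    (fun τ hτ => (hder τ hτ).continuousAt.continuousWithinAt)
    (by
      have e0 : γ 0 = w₁ := by simp [hγ]
      have e1 : γ 1 = w₂ := by simp [hγ]
      simp only [e0, e1]
      rw [show w₁ + Complex.log w₁ = w₂ + Complex.log w₂ from heq])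
    (fun τ hτ => hder τ (Ioo_subset_Icc_self hτ))
  have hpos := him c (Ioo_subset_Icc_self hc)
  have : (1 + (γ c)⁻¹).im < 0 := by
    rw [add_im, one_im, zero_add, Complex.inv_im]
    have : 0 < normSq (γ c) := normSq_pos.2 (by intro h; rw [h] at hpos; simp at hpos)
    exact div_neg_of_neg_of_pos (by linarith) this
  exact this.ne hc0

/-- Solvability of `w + Log w = ξ + iη` in the upper half plane. -/
theorem exists_add_log_eq_upper {ξ η : ℝ} (hη : 0 < η) (hξ : η = π → -1 < ξ) :
    ∃ w : ℂ, 0 < w.im ∧ w + Complex.log w = (ξ : ℂ) + (η : ℂ) * I := by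
  set b := min η π with hb
  have hb0 : 0 < b := lt_min hη Real.pi_pos
  -- `θ` is the argument of the point sought and `η - θ` its height, so the imaginary part of `w +
  -- Log w` is right by construction. `F` is the real part, and the value `ξ` is found by the
  -- intermediate value theorem.
  set F : ℝ → ℝ := fun θ => (η - θ) * Real.cos θ / Real.sin θ +
    (Real.log (η - θ) - Real.log (Real.sin θ)) with hF
  have hsin : ∀ θ ∈ Ioo 0 b, 0 < Real.sin θ := fun θ hθ =>
    Real.sin_pos_of_pos_of_lt_pi hθ.1 (hθ.2.trans_le (min_le_right _ _))
  have hv : ∀ θ ∈ Ioo 0 b, 0 < η - θ := fun θ hθ =>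
    sub_pos.2 (hθ.2.trans_le (min_le_left _ _))
  have hcont : ContinuousOn F (Ioo 0 b) := by
    apply ContinuousOn.add
    · exact ContinuousOn.div (by fun_prop) (by fun_prop) fun θ hθ => (hsin θ hθ).ne'
    · exact (ContinuousOn.log (by fun_prop) fun θ hθ => (hv θ hθ).ne').sub
        (ContinuousOn.log (by fun_prop) fun θ hθ => (hsin θ hθ).ne')
  have hmem0 : Ioo 0 b ∈ 𝓝[>] (0 : ℝ) := Ioo_mem_nhdsGT hb0
  have hmemb : Ioo 0 b ∈ 𝓝[<] b := Ioo_mem_nhdsLT hb0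
  have hs0 : Tendsto Real.sin (𝓝[>] 0) (𝓝[>] 0) := by
    refine tendsto_nhdsWithin_iff.2 ⟨?_, ?_⟩
    · have := (Real.continuous_sin.tendsto 0).mono_left (nhdsWithin_le_nhds (s := Ioi 0))
      simpa using this
    · filter_upwards [hmem0] with θ hθ using hsin θ hθ
  have htop : Tendsto F (𝓝[>] 0) atTop := by
    have h1 : Tendsto (fun θ : ℝ => (η - θ) * Real.cos θ) (𝓝[>] 0) (𝓝 η) := by
      have : Continuous (fun θ : ℝ => (η - θ) * Real.cos θ) := by fun_prop
      have := (this.tendsto 0).mono_left (nhdsWithin_le_nhds (s := Ioi 0))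
      simpa using this
    have h2 : Tendsto (fun θ : ℝ => Real.log (η - θ)) (𝓝[>] 0) (𝓝 (Real.log η)) := by
      have : ContinuousAt (fun θ : ℝ => Real.log (η - θ)) 0 :=
        ContinuousAt.log (by fun_prop) (by simpa using hη.ne')
      have := this.tendsto.mono_left (nhdsWithin_le_nhds (s := Ioi 0))
      simpa using this
    have h3 : Tendsto (fun θ : ℝ => -Real.log (Real.sin θ)) (𝓝[>] 0) atTop :=
      tendsto_neg_atBot_atTop.comp (Real.tendsto_log_nhdsGT_zero.comp hs0)
    have h4 : Tendsto (fun θ : ℝ => (Real.sin θ)⁻¹) (𝓝[>] 0) atTop :=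
      tendsto_inv_nhdsGT_zero.comp hs0
    have h5 := (h1.pos_mul_atTop hη h4).atTop_add_atTop (h2.add_atTop h3)
    exact h5.congr fun θ => by simp only [hF]; ring
  -- At the right end `F` tends to `-∞` through `log (η - θ)` if `η < π`, and through the cotangent
  -- if `η > π`. For `η = π` the limit is `-1`, which is why `-1 < ξ` is required there.
  have hlow : ∃ θ ∈ Ioo 0 b, F θ ≤ ξ := by
    rcases lt_trichotomy η π with h | h | h
    · have hbη : b = η := min_eq_left h.le
      have hsη : 0 < Real.sin η := Real.sin_pos_of_pos_of_lt_pi hη h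
      have h1 : Tendsto (fun θ : ℝ => (η - θ) * Real.cos θ / Real.sin θ) (𝓝[<] b) (𝓝 0) := by
        have : ContinuousAt (fun θ : ℝ => (η - θ) * Real.cos θ / Real.sin θ) b :=
          ContinuousAt.div (by fun_prop) (by fun_prop) (by rw [hbη]; exact hsη.ne')
        have := this.tendsto.mono_left (nhdsWithin_le_nhds (s := Iio b))
        simpa [hbη] using this
      have h2 : Tendsto (fun θ : ℝ => Real.log (Real.sin θ)) (𝓝[<] b)
          (𝓝 (Real.log (Real.sin b))) := by
        have : ContinuousAt (fun θ : ℝ => Real.log (Real.sin θ)) b :=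
          ContinuousAt.log (by fun_prop) (by rw [hbη]; exact hsη.ne')
        exact this.tendsto.mono_left nhdsWithin_le_nhds
      have h3 : Tendsto (fun θ : ℝ => Real.log (η - θ)) (𝓝[<] b) atBot := by
        refine Real.tendsto_log_nhdsGT_zero.comp (tendsto_nhdsWithin_iff.2 ⟨?_, ?_⟩)
        · have : Continuous (fun θ : ℝ => η - θ) := by fun_prop
          have := (this.tendsto b).mono_left (nhdsWithin_le_nhds (s := Iio b))
          simpa [hbη] using this
        · filter_upwards [hmemb] with θ hθ using hv θ hθ
      have h4 : Tendsto F (𝓝[<] b) atBot := by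
        have := h1.add_atBot (h3.atBot_add h2.neg)
        exact this.congr fun θ => by simp only [hF]; ring
      obtain ⟨θ, h5, h6⟩ := ((h4.eventually_le_atBot ξ).and hmemb).exists
      exact ⟨θ, h6, h5⟩
    · have hbη : b = π := by rw [hb, h, min_self]
      have hslope : Tendsto (fun θ : ℝ => Real.sin θ / (η - θ)) (𝓝[<] b) (𝓝 1) := by
        have h1 := (Real.hasDerivAt_sin π).tendsto_slope
        have h2 : Tendsto (fun θ => -slope Real.sin π θ) (𝓝[≠] π) (𝓝 1) := by
          simpa using h1.neg
        rw [hbη, h]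
        refine (h2.mono_left (nhdsWithin_mono _ fun x hx => (ne_of_lt hx))).congr fun θ => ?_
        rw [slope_def_field, Real.sin_pi, sub_zero, ← div_neg, neg_sub]
      have h1 : Tendsto (fun θ : ℝ => (Real.sin θ / (η - θ))⁻¹ * Real.cos θ -
          Real.log (Real.sin θ / (η - θ))) (𝓝[<] b) (𝓝 (-1)) := by
        have hc := (Real.continuous_cos.tendsto b).mono_left (nhdsWithin_le_nhds (s := Iio b))
        have := ((hslope.inv₀ one_ne_zero).mul hc).sub (hslope.log one_ne_zero)
        simpa [hbη] using this
      obtain ⟨θ, h5, h6⟩ := ((h1.eventually (gt_mem_nhds (hξ h))).and hmemb).exists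
      refine ⟨θ, h6, le_of_eq_of_le ?_ h5.le⟩
      have e1 := (hsin θ h6).ne'
      have e2 := (hv θ h6).ne'
      simp only [hF]
      rw [Real.log_div e1 e2]
      field_simp
      ring
    · have hbη : b = π := min_eq_right h.le
      have hs1 : Tendsto Real.sin (𝓝[<] b) (𝓝[>] 0) := by
        refine tendsto_nhdsWithin_iff.2 ⟨?_, ?_⟩
        · have := (Real.continuous_sin.tendsto b).mono_left (nhdsWithin_le_nhds (s := Iio b))
          simpa [hbη] using this
        · filter_upwards [hmemb] with θ hθ using hsin θ hθ
      have h4 : Tendsto (fun θ : ℝ => (Real.sin θ)⁻¹) (𝓝[<] b) atTop :=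
        tendsto_inv_nhdsGT_zero.comp hs1
      have h1 : Tendsto (fun θ : ℝ => (η - θ) * Real.cos θ) (𝓝[<] b) (𝓝 (-(η - π))) := by
        have : Continuous (fun θ : ℝ => (η - θ) * Real.cos θ) := by fun_prop
        have := (this.tendsto b).mono_left (nhdsWithin_le_nhds (s := Iio b))
        simpa [hbη] using this
      have h2 : Tendsto (fun θ : ℝ => Real.log (η - θ)) (𝓝[<] b) (𝓝 (Real.log (η - π))) := by
        have : ContinuousAt (fun θ : ℝ => Real.log (η - θ)) b :=
          ContinuousAt.log (by fun_prop) (by rw [hbη]; linarith)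
        have := this.tendsto.mono_left (nhdsWithin_le_nhds (s := Iio b))
        simpa [hbη] using this
      have hlogx : Tendsto (fun x : ℝ => Real.log x / x) atTop (𝓝 0) :=
        Real.isLittleO_log_id_atTop.tendsto_div_nhds_zero
      have h3 : Tendsto (fun θ : ℝ => (η - θ) * Real.cos θ +
          Real.log (Real.sin θ)⁻¹ / (Real.sin θ)⁻¹) (𝓝[<] b) (𝓝 (-(η - π))) := by
        simpa using h1.add (hlogx.comp h4)
      have h5 := (h3.neg_mul_atTop (by linarith) h4).atBot_add h2
      obtain ⟨θ, h6, h7⟩ := ((h5.eventually_le_atBot ξ).and hmemb).exists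
      refine ⟨θ, h7, le_of_eq_of_le ?_ h6⟩
      have e1 := (hsin θ h7).ne'
      simp only [hF]
      rw [Real.log_inv]
      field_simp
      ring
  obtain ⟨θ₂, hθ₂, hle⟩ := hlow
  obtain ⟨θ₁, hge, hθ₁⟩ := ((htop.eventually_ge_atTop ξ).and hmem0).exists
  obtain ⟨θ, hθ, hFθ⟩ := isPreconnected_Ioo.intermediate_value hθ₂ hθ₁ hcont ⟨hle, hge⟩
  have hvθ := hv θ hθ
  refine ⟨(((η - θ) * Real.cos θ / Real.sin θ : ℝ) : ℂ) + ((η - θ : ℝ) : ℂ) * I, ?_, ?_⟩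
  · simpa only [add_im, ofReal_im, mul_im, I_im, I_re, ofReal_re, mul_one, mul_zero, zero_add,
      add_zero] using hvθ
  · rw [add_log_of_polar hvθ ⟨hθ.1, hθ.2.trans_le (min_le_right _ _)⟩,
      Real.log_div hvθ.ne' (hsin θ hθ).ne']
    simp only [hF] at hFθ
    rw [hFθ]
    push_cast
    ring

/-- Carries statements from the upper to the lower half plane. Off the real axis `w` avoids the cut,
so `Log` commutes with conjugation. -/
theorem conj_add_log {w : ℂ} (hw : w.im ≠ 0) :
    (starRingEnd ℂ) w + Complex.log ((starRingEnd ℂ) w) =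
      (starRingEnd ℂ) (w + Complex.log w) := by
  rw [map_add, Complex.log_conj _ fun h => hw (Complex.arg_eq_pi_iff.1 h).2]

theorem mul_exp_eq_exp_add_log {w : ℂ} (hw : w ≠ 0) : w * cexp w = cexp (w + Complex.log w) := by
  rw [Complex.exp_add, Complex.exp_log hw, mul_comm]

/-- `w + Log w` for negative real `w = -u`. -/
theorem add_log_neg {u : ℝ} (hu : 0 < u) :
    (-(u : ℂ)) + Complex.log (-(u : ℂ)) = ((-u + Real.log u : ℝ) : ℂ) + (π : ℂ) * I := by
  have : Complex.log (-(u : ℂ)) = (Real.log u : ℂ) + (π : ℂ) * I := by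
    have h := Complex.arg_ofReal_of_neg (neg_lt_zero.2 hu)
    rw [ofReal_neg] at h
    rw [Complex.log, h, norm_neg, Complex.norm_of_nonneg hu.le]
  rw [this]
  push_cast
  ring

theorem exists_add_log_eq_pos (ξ : ℝ) : ∃ u : ℝ, 0 < u ∧ u + Real.log u = ξ := by
  -- At `p` the function is `p + ξ - e^ξ ≤ ξ`, at `e^ξ` it is `e^ξ + ξ ≥ ξ`.
  set p := Real.exp (ξ - Real.exp ξ)
  have hle : p ≤ Real.exp ξ := Real.exp_le_exp.2 (by linarith [Real.exp_pos ξ])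
  have hp : 0 < p := Real.exp_pos _
  have hc : ContinuousOn (fun u : ℝ => u + Real.log u) (Icc p (Real.exp ξ)) :=
    continuousOn_id.add (Real.continuousOn_log.mono fun u hu => (hp.trans_le hu.1).ne')
  obtain ⟨u, hu, h⟩ := intermediate_value_Icc hle hc (show ξ ∈ Icc _ _ from
    ⟨by simp only [p, Real.log_exp]; linarith, by simp only [Real.log_exp]
                                                  linarith [Real.exp_pos ξ]⟩)
  exact ⟨u, hp.trans_le hu.1, h⟩

/-- The function `-u + log u` increases up to its maximum `-1` at `u = 1` and then decreases. A
value `ξ ≤ -1` is thus attained in `(0, 1]`, where `-u` belongs to branch `0`, and in `[1, ∞)`,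
where `-u` belongs to branch `-1`. -/
theorem exists_neg_add_log_eq_small {ξ : ℝ} (hξ : ξ ≤ -1) :
    ∃ u : ℝ, 0 < u ∧ u ≤ 1 ∧ -u + Real.log u = ξ := by
  have hp := Real.exp_pos ξ
  have hle : Real.exp ξ ≤ 1 := Real.exp_le_one_iff.2 (by linarith)
  have hc : ContinuousOn (fun u : ℝ => -u + Real.log u) (Icc (Real.exp ξ) 1) :=
    continuousOn_id.neg.add (Real.continuousOn_log.mono fun u hu => (hp.trans_le hu.1).ne')
  obtain ⟨u, hu, h⟩ := intermediate_value_Icc hle hc (show ξ ∈ Icc _ _ from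
    ⟨by simp only [Real.log_exp]; linarith, by simpa using hξ⟩)
  exact ⟨u, hp.trans_le hu.1, hu.2, h⟩

theorem exists_neg_add_log_eq_large {ξ : ℝ} (hξ : ξ ≤ -1) :
    ∃ u : ℝ, 1 ≤ u ∧ -u + Real.log u = ξ := by
  -- The right endpoint works since `log (1 - ξ) ≤ -ξ` bounds the function there by `-1 - ξ²`, which
  -- is at most `ξ`.
  have hle : (1 : ℝ) ≤ (1 - ξ) ^ 2 := by nlinarith
  have hc : ContinuousOn (fun u : ℝ => -u + Real.log u) (Icc 1 ((1 - ξ) ^ 2)) :=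
    continuousOn_id.neg.add (Real.continuousOn_log.mono fun u hu => by
      have := hu.1; exact (zero_lt_one.trans_le this).ne')
  obtain ⟨u, hu, h⟩ := intermediate_value_Icc' hle hc (show ξ ∈ Icc _ _ from
    ⟨by
      have := Real.log_le_sub_one_of_pos (show 0 < 1 - ξ by linarith)
      simp only [Real.log_pow]
      push_cast
      nlinarith, by simpa using hξ⟩)
  exact ⟨u, hu.1, h⟩

/-- Both bounds are `log x < x - 1`, at `u/v` and at `v/u`. They give the strict monotonicity of `-u
+ log u` on either side of `1`. -/
theorem log_sub_log_lt {u v : ℝ} (hu : 0 < u) (huv : u < v) :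
    (v - u) / v < Real.log v - Real.log u ∧ Real.log v - Real.log u < (v - u) / u := by
  have hv := hu.trans huv
  constructor
  · have := Real.log_lt_sub_one_of_pos (div_pos hu hv)
      (by rw [Ne, div_eq_one_iff_eq hv.ne']; exact huv.ne)
    rw [Real.log_div hu.ne' hv.ne'] at this
    rw [sub_div, div_self hv.ne']; linarith
  · have := Real.log_lt_sub_one_of_pos (div_pos hv hu)
      (by rw [Ne, div_eq_one_iff_eq hu.ne']; exact huv.ne')
    rw [Real.log_div hv.ne' hu.ne'] at this
    rw [sub_div, div_self hu.ne']; linarith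

theorem neg_add_log_inj_small {u v : ℝ} (hu : 0 < u) (hv : 0 < v) (hu1 : u ≤ 1) (hv1 : v ≤ 1)
    (h : -u + Real.log u = -v + Real.log v) : u = v := by
  by_contra hne
  wlog huv : u < v generalizing u v
  · exact this hv hu hv1 hu1 h.symm (Ne.symm hne) (lt_of_le_of_ne (not_lt.1 huv) (Ne.symm hne))
  have h1 := (log_sub_log_lt hu huv).1
  have h2 : v - u ≤ (v - u) / v := by
    rw [le_div_iff₀ hv]; nlinarith
  linarith

theorem neg_add_log_inj_large {u v : ℝ} (hu1 : 1 ≤ u) (hv1 : 1 ≤ v)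
    (h : -u + Real.log u = -v + Real.log v) : u = v := by
  by_contra hne
  wlog huv : u < v generalizing u v
  · exact this hv1 hu1 h.symm (Ne.symm hne) (lt_of_le_of_ne (not_lt.1 huv) (Ne.symm hne))
  have h1 := (log_sub_log_lt (zero_lt_one.trans_le hu1) huv).2
  have h2 : (v - u) / u ≤ v - u := by
    rw [div_le_iff₀ (by linarith)]; nlinarith
  linarith

/-- Existence for each branch of the Lambert W function. -/
theorem exists_mem_lambertWRange {z : ℂ} (hz : z ≠ 0) (k : ℤ) :
    ∃ w ∈ lambertWRange k, w * cexp w = z := by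
  set ξ := Real.log ‖z‖ with hξdef
  set η := z.arg + 2 * π * k with hηdef
  have hπ := Real.pi_pos
  have hlo : (2 * (k : ℝ) - 1) * π < η := by
    have := Complex.neg_pi_lt_arg z; simp only [hηdef]; linarith
  have hhi : η ≤ (2 * (k : ℝ) + 1) * π := by
    have := Complex.arg_le_pi z; simp only [hηdef]; linarith
  have hexp : cexp ((ξ : ℂ) + (η : ℂ) * I) = z := by
    have : (ξ : ℂ) + (η : ℂ) * I = Complex.log z + k * (2 * π * I) := by
      simp only [hηdef, hξdef, Complex.log]; push_cast; ring
    rw [this, Complex.exp_add, Complex.exp_int_mul_two_pi_mul_I, mul_one, Complex.exp_log hz]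
  -- a solution of `w + Log w = ξ + iη`
  have key : ∀ w : ℂ, w ≠ 0 → w + Complex.log w = (ξ : ℂ) + (η : ℂ) * I →
      ¬ (k = 0 ∧ w.im = 0 ∧ w.re < -1) → ∃ w ∈ lambertWRange k, w * cexp w = z := by
    intro w hw heq hk
    refine ⟨w, Or.inr (Or.inr ⟨hw, hk, ?_⟩), by rw [mul_exp_eq_exp_add_log hw, heq, hexp]⟩
    rw [heq]
    simpa using ⟨hlo, hhi⟩
  have hk_of : ∀ n : ℤ, η = (2 * n + 1) * π → k = n := by
    intro n h
    have h1 : (k : ℝ) - 1 < n := by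
      have : (2 * (k : ℝ) - 1) * π < (2 * n + 1) * π := by rw [← h]; exact hlo
      have := lt_of_mul_lt_mul_right this hπ.le
      linarith
    have h2 : (n : ℝ) ≤ k := by
      have : (2 * (n : ℝ) + 1) * π ≤ (2 * k + 1) * π := by rw [← h]; exact hhi
      have := le_of_mul_le_mul_right this hπ
      linarith
    have h3 : k - 1 < n := by exact_mod_cast h1
    have h4 : n ≤ k := by exact_mod_cast h2
    omega
  rcases lt_trichotomy η 0 with h | h | h
  -- The one case with `η < 0` that conjugates of points of the upper half plane do not reach; the
  -- real values `w ≤ -1` fill it. For `η = π` below, the gap is filled by `-1 ≤ w < 0`.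
  · by_cases hc : η = -π ∧ ξ ≤ -1
    · obtain ⟨u, hu, hue⟩ := exists_neg_add_log_eq_large hc.2
      have hk : k = -1 := hk_of (-1) (by rw [hc.1]; push_cast; ring)
      have hu0 : 0 < u := by linarith
      refine ⟨-(u : ℂ), Or.inr (Or.inl ⟨hk, by simp, by simpa using hu⟩), ?_⟩
      rw [mul_exp_eq_exp_add_log (neg_ne_zero.2 (ofReal_ne_zero.2 hu0.ne')), add_log_neg hu0, hue,
        ← hexp, hc.1, Complex.exp_add, Complex.exp_add]
      push_cast
      rw [neg_mul, Complex.exp_neg, Complex.exp_pi_mul_I]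
      norm_num
    · obtain ⟨w, hw, heq⟩ := exists_add_log_eq_upper (ξ := ξ) (η := -η) (by linarith)
        (fun h' => not_le.1 fun h'' => hc ⟨by linarith, h''⟩)
      refine key ((starRingEnd ℂ) w) ?_ ?_ ?_
      · rw [Ne, map_eq_zero]; rintro rfl; simp at hw
      · rw [conj_add_log hw.ne', heq]; simp
      · rintro ⟨-, h', -⟩; rw [conj_im] at h'; linarith
  · obtain ⟨u, hu, hue⟩ := exists_add_log_eq_pos ξ
    refine key u (ofReal_ne_zero.2 hu.ne') ?_ ?_
    · rw [h, ← hue, ← Complex.ofReal_log hu.le]; simp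
    · rintro ⟨-, -, h'⟩; rw [ofReal_re] at h'; linarith
  · by_cases hc : η = π ∧ ξ ≤ -1
    · obtain ⟨u, hu, hu1, hue⟩ := exists_neg_add_log_eq_small hc.2
      refine key (-(u : ℂ)) (neg_ne_zero.2 (ofReal_ne_zero.2 hu.ne')) ?_ ?_
      · rw [add_log_neg hu, hue, hc.1]
      · rintro ⟨-, -, h'⟩; simp at h'; linarith
    · obtain ⟨w, hw, heq⟩ := exists_add_log_eq_upper (ξ := ξ) h
        (fun h' => not_le.1 fun h'' => hc ⟨h', h''⟩)
      refine key w (by rintro rfl; simp at hw) heq ?_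
      rintro ⟨-, h', -⟩; linarith

/-- The sign of `Im w` and of a real `w` can be read off from `Im (w + Log w)`. -/
theorem add_log_cases {w : ℂ} (hw : w ≠ 0) :
    (0 < w.im ∧ 0 < (w + Complex.log w).im) ∨
    (w.im < 0 ∧ (w + Complex.log w).im < 0) ∨
    (∃ u : ℝ, 0 < u ∧ w = u ∧ w + Complex.log w = ((u + Real.log u : ℝ) : ℂ)) ∨
    (∃ u : ℝ, 0 < u ∧ w = -(u : ℂ) ∧
      w + Complex.log w = ((-u + Real.log u : ℝ) : ℂ) + (π : ℂ) * I) := by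
  rcases lt_trichotomy w.im 0 with h | h | h
  · right; left
    have := Complex.arg_neg_iff.2 h
    exact ⟨h, by rw [add_im, Complex.log_im]; linarith⟩
  · have hwr : w = (w.re : ℂ) := Complex.ext (by simp) (by simp [h])
    have hre : w.re ≠ 0 := fun h0 => hw (by rw [hwr, h0]; simp)
    right; right
    rcases lt_or_gt_of_ne hre with h' | h'
    · right
      have e : w = -((-w.re : ℝ) : ℂ) := by rw [hwr]; simp
      refine ⟨-w.re, by linarith, e, ?_⟩
      have := add_log_neg (u := -w.re) (by linarith)
      rwa [← e] at this
    · left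
      refine ⟨w.re, h', hwr, ?_⟩
      rw [hwr, ← Complex.ofReal_log h'.le]; simp
  · left
    have := Complex.arg_nonneg_iff.2 h.le
    exact ⟨h, by rw [add_im, Complex.log_im]; linarith⟩

/-- Uniqueness for each branch of the Lambert W function. -/
theorem lambertWRange_injOn (k : ℤ) : InjOn (fun w => w * cexp w) (lambertWRange k) := by
  intro w₁ h₁ w₂ h₂ heq
  have hπ := Real.pi_pos
  -- reduce to nonzero values
  have hzero : ∀ w : ℂ, w * cexp w = 0 → w = 0 := fun w h =>
    (mul_eq_zero.1 h).resolve_right (Complex.exp_ne_zero w)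
  by_cases hz : w₁ * cexp w₁ = 0
  · rw [hzero w₁ hz, hzero w₂ (by rw [← hz]; exact heq.symm)]
  have hw₁ : w₁ ≠ 0 := by rintro rfl; simp at hz
  have hw₂ : w₂ ≠ 0 := by
    rintro rfl; apply hz; rw [show w₁ * cexp w₁ = _ from heq]; simp
  have hexp : cexp (w₁ + Complex.log w₁) = cexp (w₂ + Complex.log w₂) := by
    rw [← mul_exp_eq_exp_add_log hw₁, ← mul_exp_eq_exp_add_log hw₂]; exact heq
  obtain ⟨n, hn⟩ := Complex.exp_eq_exp_iff_exists_int.1 hexp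
  have hnim : (w₁ + Complex.log w₁).im = (w₂ + Complex.log w₂).im + n * (2 * π) := by
    rw [hn, add_im]; congr 1; simp
  have hnre : (w₁ + Complex.log w₁).re = (w₂ + Complex.log w₂).re := by
    rw [hn, add_re]; simp
  have hreal : ∀ w : ℂ, w.im = 0 → w.re ≤ -1 → ∃ u : ℝ, 1 ≤ u ∧ w = -(u : ℂ) := fun w h h' =>
    ⟨-w.re, by linarith, Complex.ext (by simp) (by simp [h])⟩
  -- A real `w = -u ≤ -1` has `Im (w + Log w) = π`. A generic value of branch `-1` has it in `(-3π,
  -- -π]`, so congruence modulo `2π` forces `-π`. There `w'` lies in the lower half plane with real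
  -- part of `w' + Log w'` above `-1`, while `-u + log u ≤ -1`.
  have hmixed : ∀ (w w' : ℂ) (u : ℝ), 1 ≤ u → w = -(u : ℂ) → w' ≠ 0 →
      (2 * (-1 : ℝ) - 1) * π < (w' + Complex.log w').im →
      (w' + Complex.log w').im ≤ (2 * (-1 : ℝ) + 1) * π →
      (w + Complex.log w).re = (w' + Complex.log w').re →
      (∃ n : ℤ, (w + Complex.log w).im = (w' + Complex.log w').im + n * (2 * π)) → False := by
    rintro w w' u hu rfl hw' hlo hhi hre ⟨n, him⟩
    have hu0 : 0 < u := by linarith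
    rw [add_log_neg hu0] at hre him
    simp only [add_re, ofReal_re, mul_re, ofReal_im, I_re, I_im, mul_zero, sub_zero,
      add_zero, add_im, mul_im, mul_one, zero_add] at hre him
    simp only [add_im] at hlo hhi
    have hnn : n = 1 := by
      have h1 : (n : ℝ) * (2 * π) < 2 * (2 * π) := by linarith
      have h2 : 1 * (2 * π) ≤ (n : ℝ) * (2 * π) := by linarith
      have h3 := lt_of_mul_lt_mul_right h1 (by linarith)
      have h4 := le_of_mul_le_mul_right h2 (by linarith)
      have h5 : n < 2 := by exact_mod_cast h3
      have h6 : 1 ≤ n := by exact_mod_cast h4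
      omega
    rw [hnn] at him
    push_cast at him
    have him' : (w' + Complex.log w').im = -π := by rw [add_im]; linarith
    rcases add_log_cases hw' with ⟨-, h⟩ | ⟨h, -⟩ | ⟨v, -, -, h⟩ | ⟨v, -, -, h⟩
    · linarith
    · have h1 := neg_one_lt_re_add_log (w := (starRingEnd ℂ) w') (by simpa using h)
        (by rw [conj_add_log h.ne, conj_im, him', neg_neg])
      rw [conj_add_log h.ne, conj_re, add_re, ← hre] at h1
      have := Real.log_le_sub_one_of_pos hu0
      linarith
    · rw [h] at him'; simp at him'
    · rw [h] at him'; simp at him'; linarith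
  rcases h₁ with ⟨-, h⟩ | ⟨hk1, hi1, hr1⟩ | ⟨-, hx1, hl1, hu1⟩
  · exact absurd h hw₁
  · obtain ⟨u, hu, hwu⟩ := hreal w₁ hi1 hr1
    rcases h₂ with ⟨-, h⟩ | ⟨-, hi2, hr2⟩ | ⟨-, -, hl2, hu2⟩
    · exact absurd h hw₂
    · obtain ⟨v, hv, hwv⟩ := hreal w₂ hi2 hr2
      rw [hwu, hwv, add_log_neg (by linarith), add_log_neg (by linarith)] at hnre
      simp only [add_re, ofReal_re, mul_re, ofReal_im, I_re, I_im, mul_zero, zero_mul, sub_zero,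
        add_zero] at hnre
      rw [hwu, hwv, neg_add_log_inj_large hu hv hnre]
    · subst hk1
      push_cast at hl2 hu2
      exact (hmixed w₁ w₂ u hu hwu hw₂ hl2 hu2 hnre ⟨n, hnim⟩).elim
  · rcases h₂ with ⟨-, h⟩ | ⟨hk2, hi2, hr2⟩ | ⟨-, hx2, hl2, hu2⟩
    · exact absurd h hw₂
    · obtain ⟨v, hv, hwv⟩ := hreal w₂ hi2 hr2
      subst hk2
      push_cast at hl1 hu1
      exact (hmixed w₂ w₁ v hv hwv hw₁ hl1 hu1 hnre.symm
        ⟨-n, by rw [hnim]; push_cast; ring⟩).elim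
    · have hn0 : n = 0 := by
        have h1 : (n : ℝ) * (2 * π) < 1 * (2 * π) := by linarith
        have h2 : (-1) * (2 * π) < (n : ℝ) * (2 * π) := by linarith
        have h3 := lt_of_mul_lt_mul_right h1 (by linarith)
        have h4 := lt_of_mul_lt_mul_right h2 (by linarith)
        have h5 : n < 1 := by exact_mod_cast h3
        have h6 : -1 < n := by exact_mod_cast h4
        omega
      have heq' : w₁ + Complex.log w₁ = w₂ + Complex.log w₂ := by rw [hn, hn0]; simp
      -- A negative real has imaginary part `π`, so `k = 0`, and there the range excludes `w < -1`.
      have hneg : ∀ (w : ℂ) (u : ℝ), ¬ (k = 0 ∧ w.im = 0 ∧ w.re < -1) →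
          (2 * (k : ℝ) - 1) * π < (w + Complex.log w).im →
          (w + Complex.log w).im ≤ (2 * (k : ℝ) + 1) * π → 0 < u → w = -(u : ℂ) → u ≤ 1 := by
        rintro w u hx hl hh hu rfl
        rw [add_log_neg hu] at hl hh
        simp only [add_im, ofReal_im, mul_im, ofReal_re, I_im, mul_one, I_re, mul_zero, add_zero,
          zero_add] at hl hh
        have h3 : (2 * (k : ℝ) - 1) < 1 := lt_of_mul_lt_mul_right (by linarith) hπ.le
        have h4 : (1 : ℝ) ≤ 2 * (k : ℝ) + 1 := le_of_mul_le_mul_right (by linarith) hπ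
        have h5 : k < 1 := by have : (k : ℝ) < 1 := by linarith
                              exact_mod_cast this
        have h6 : 0 ≤ k := by have : (0 : ℝ) ≤ k := by linarith
                              exact_mod_cast this
        by_contra hlt
        exact hx ⟨by omega, by simp, by simp; linarith⟩
      have hupneg : ∀ (w w' : ℂ) (v : ℝ), 0 < w.im → 0 < v → w' = -(v : ℂ) →
          w + Complex.log w = w' + Complex.log w' → False := by
        rintro w w' v hw hv rfl h
        rw [add_log_neg hv] at h
        have h1 := neg_one_lt_re_add_log hw (by rw [h]; simp)
        rw [h] at h1
        simp only [add_re, ofReal_re, mul_re, ofReal_im, I_re, I_im, mul_zero, zero_mul, sub_zero,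
          add_zero] at h1
        have := Real.log_le_sub_one_of_pos hv
        linarith
      have him := congrArg Complex.im heq'
      rcases add_log_cases hw₁ with ⟨a1, b1⟩ | ⟨a1, b1⟩ | ⟨u, a1, c1, b1⟩ | ⟨u, a1, c1, b1⟩ <;>
      rcases add_log_cases hw₂ with ⟨a2, b2⟩ | ⟨a2, b2⟩ | ⟨v, a2, c2, b2⟩ | ⟨v, a2, c2, b2⟩
      · exact add_log_injOn_upper a1 a2 heq'
      · linarith
      · rw [b2] at him; simp only [ofReal_im] at him; linarith
      · exact (hupneg w₁ w₂ v a1 a2 c2 heq').elim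
      · linarith
      · have := add_log_injOn_upper (x₁ := (starRingEnd ℂ) w₁) (x₂ := (starRingEnd ℂ) w₂)
          (by simpa using a1) (by simpa using a2)
          (by simp only [conj_add_log a1.ne, conj_add_log a2.ne, heq'])
        exact (starRingEnd ℂ).injective this
      · rw [b2] at him; simp only [ofReal_im] at him; linarith
      · rw [b2] at him; simp at him b1; linarith
      · rw [b1] at him; simp only [ofReal_im] at him; linarith
      · rw [b1] at him; simp only [ofReal_im] at him; linarith
      · rw [b1, b2] at heq'
        have h := ofReal_injective heq'
        rw [c1, c2]
        congr 1
        rcases lt_trichotomy u v with h' | h' | h'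
        · have := Real.log_lt_log a1 h'; linarith
        · exact h'
        · have := Real.log_lt_log a2 h'; linarith
      · rw [b1, b2] at him; simp at him; linarith
      · exact (hupneg w₂ w₁ u a2 a1 c1 heq'.symm).elim
      · rw [b1] at him; simp at him b2; linarith
      · rw [b1, b2] at him; simp at him
      · rw [b1, b2] at hnre
        simp only [add_re, ofReal_re, mul_re, ofReal_im, I_re, I_im, mul_zero, zero_mul, sub_zero,
          add_zero] at hnre
        rw [c1, c2, neg_add_log_inj_small a1 a2 (hneg w₁ u hx1 hl1 hu1 a1 c1)
          (hneg w₂ v hx2 hl2 hu2 a2 c2) hnre]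

/-! ### Values of the branches and the characteristic equation as a fixed point equation -/

theorem lambertW_mul_exp (k : ℤ) {z : ℂ} (hz : k = 0 ∨ z ≠ 0) :
    lambertW k z * cexp (lambertW k z) = z := by
  have hex : ∃ w : ℂ, w ∈ lambertWRange k ∧ w * cexp w = z := by
    by_cases h : z = 0
    · exact ⟨0, Or.inl ⟨hz.resolve_right (not_not.2 h), rfl⟩, by simp [h]⟩
    · exact exists_mem_lambertWRange h k
  exact (Classical.epsilon_spec hex).2

theorem exists_lambertWRange {w : ℂ} (hw : w ≠ 0) : ∃ k : ℤ, w ∈ lambertWRange k := by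
  have hπ := Real.pi_pos
  by_cases hc : w.im = 0 ∧ w.re < -1
  · exact ⟨-1, Or.inr (Or.inl ⟨rfl, hc.1, hc.2.le⟩)⟩
  · set y := (w + Complex.log w).im
    -- The ceiling matches strips that are open below and closed above.
    refine ⟨⌈(y / π - 1) / 2⌉, Or.inr (Or.inr ⟨hw, fun h => hc h.2, ?_, ?_⟩)⟩
    · have := Int.ceil_lt_add_one ((y / π - 1) / 2)
      have h2 : 2 * ((⌈(y / π - 1) / 2⌉ : ℤ) : ℝ) - 1 < y / π := by linarith
      exact (lt_div_iff₀ hπ).1 h2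
    · have := Int.le_ceil ((y / π - 1) / 2)
      have h2 : y / π ≤ 2 * ((⌈(y / π - 1) / 2⌉ : ℤ) : ℝ) + 1 := by linarith
      exact (div_le_iff₀ hπ).1 h2

theorem exists_eq_lambertW (w : ℂ) :
    ∃ k : ℤ, (k = 0 ∨ w * cexp w ≠ 0) ∧ w = lambertW k (w * cexp w) := by
  have hmem : ∃ k : ℤ, (k = 0 ∨ w * cexp w ≠ 0) ∧ w ∈ lambertWRange k := by
    by_cases hw : w = 0
    · exact ⟨0, Or.inl rfl, Or.inl ⟨rfl, hw⟩⟩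
    · obtain ⟨k, hk⟩ := exists_lambertWRange hw
      exact ⟨k, Or.inr (mul_ne_zero hw (Complex.exp_ne_zero w)), hk⟩
  obtain ⟨k, hk, hw⟩ := hmem
  have hspec := Classical.epsilon_spec
    (p := fun w' : ℂ => w' ∈ lambertWRange k ∧ w' * cexp w' = w * cexp w) ⟨w, hw, rfl⟩
  exact ⟨k, hk, lambertWRange_injOn k hw hspec.1 hspec.2.symm⟩

/-- Multiplication by the nowhere vanishing factor `h e^{(s-a)h}`. -/
theorem charFun_eq_zero_iff_mul_exp (N : ℕ) (a : ℝ) (ad : ℕ → ℝ) {h : ℝ} (hh : 0 < h) (s : ℂ) :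
    charFun N a ad h s = 0 ↔
      ((s - a) * h) * cexp ((s - a) * h) = lambertArg N a ad h s := by
  have hsum : lambertArg N a ad h s = h * cexp ((s - a) * h) *
      ∑ j ∈ Finset.Icc 1 N, (ad j : ℂ) * cexp (-((j : ℂ) * s * (h : ℂ))) := by
    rw [lambertArg, Finset.mul_sum]
    refine Finset.sum_congr rfl fun j _ => ?_
    have : cexp (-((j : ℂ) * s * (h : ℂ))) * cexp ((s - a) * h) =
        cexp (-((j : ℂ) * (a : ℂ) * (h : ℂ))) *
          cexp (-(((j : ℂ) - 1) * (s - (a : ℂ)) * (h : ℂ))) := by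
      rw [← Complex.exp_add, ← Complex.exp_add]; congr 1; ring
    linear_combination -((ad j : ℂ) * h) * this
  have hne : (h : ℂ) * cexp ((s - a) * h) ≠ 0 :=
    mul_ne_zero (ofReal_ne_zero.2 hh.ne') (Complex.exp_ne_zero _)
  rw [hsum, charFun, show ((s - a) * h) * cexp ((s - a) * h) =
    (h * cexp ((s - a) * h)) * (s - a) by ring, mul_right_inj' hne, sub_eq_zero]

/-- The characteristic roots in terms of the branches of the Lambert W function. -/
theorem charFun_eq_zero_iff_lambertW (N : ℕ) (a : ℝ) (ad : ℕ → ℝ) {h : ℝ} (hh : 0 < h) (s : ℂ) :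
    charFun N a ad h s = 0 ↔ ∃ k : ℤ, (k = 0 ∨ lambertArg N a ad h s ≠ 0) ∧
      s = 1 / (h : ℂ) * lambertW k (lambertArg N a ad h s) + (a : ℂ) := by
  have hne : (h : ℂ) ≠ 0 := ofReal_ne_zero.2 hh.ne'
  rw [charFun_eq_zero_iff_mul_exp N a ad hh]
  constructor
  · intro heq
    obtain ⟨k, hk, hw⟩ := exists_eq_lambertW ((s - a) * h)
    rw [heq] at hk hw
    refine ⟨k, hk, ?_⟩
    rw [← hw]
    field_simp
    ring
  · rintro ⟨k, hk, hs⟩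
    have hw : (s - a) * h = lambertW k (lambertArg N a ad h s) := by
      rw [sub_eq_of_eq_add hs]
      field_simp
    rw [hw, lambertW_mul_exp k hk]

/-! ### Size of the characteristic function -/

/-- `m` is the index of the largest delay that is really present. -/
structure IsLeading (N : ℕ) (ad : ℕ → ℝ) (m : ℕ) : Prop where
  mem : m ∈ Finset.Icc 1 N
  ne : ad m ≠ 0
  eq_zero : ∀ j ∈ Finset.Icc 1 N, m < j → ad j = 0

theorem exists_isLeading {N : ℕ} {ad : ℕ → ℝ} (had : ∃ j ∈ Finset.Icc 1 N, ad j ≠ 0) :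
    ∃ m, IsLeading N ad m := by
  classical
  obtain ⟨j, hj, hne⟩ := had
  have hs : ((Finset.Icc 1 N).filter fun j => ad j ≠ 0).Nonempty :=
    ⟨j, Finset.mem_filter.2 ⟨hj, hne⟩⟩
  have hmem := Finset.mem_filter.1 (Finset.max'_mem _ hs)
  refine ⟨Finset.max' _ hs, hmem.1, hmem.2, fun i hi hlt => ?_⟩
  by_contra h
  exact absurd (Finset.le_max' _ i (Finset.mem_filter.2 ⟨hi, h⟩)) (not_le.2 hlt)

theorem IsLeading.one_le {N : ℕ} {ad : ℕ → ℝ} {m : ℕ} (hm : IsLeading N ad m) : 1 ≤ m :=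
  (Finset.mem_Icc.1 hm.mem).1

theorem IsLeading.delay_pos {N : ℕ} {ad : ℕ → ℝ} {m : ℕ} (hm : IsLeading N ad m) {h : ℝ}
    (hh : 0 < h) : 0 < (m : ℝ) * h :=
  mul_pos (by exact_mod_cast hm.one_le) hh

/-- The term of the characteristic function with the largest delay. -/
noncomputable def lead (ad : ℕ → ℝ) (h : ℝ) (m : ℕ) (s : ℂ) : ℂ :=
  (ad m : ℂ) * cexp (-((m : ℂ) * s * (h : ℂ)))

/-- The derivative `1 + ∑_j j a_{jd} h e^{-jsh}` of the characteristic function. -/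
noncomputable def charDeriv (N : ℕ) (ad : ℕ → ℝ) (h : ℝ) (s : ℂ) : ℂ :=
  1 + ∑ j ∈ Finset.Icc 1 N, (j : ℂ) * (ad j : ℂ) * (h : ℂ) * cexp (-((j : ℂ) * s * (h : ℂ)))

theorem hasDerivAt_charFun (N : ℕ) (a : ℝ) (ad : ℕ → ℝ) (h : ℝ) (s : ℂ) :
    HasDerivAt (charFun N a ad h) (charDeriv N ad h s) s := by
  have h1 : ∀ j ∈ Finset.Icc 1 N, HasDerivAt
      (fun s : ℂ => (ad j : ℂ) * cexp (-((j : ℂ) * s * (h : ℂ))))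
      ((ad j : ℂ) * (cexp (-((j : ℂ) * s * (h : ℂ))) * -((j : ℂ) * 1 * (h : ℂ)))) s := fun j _ =>
    ((((hasDerivAt_id s).const_mul (j : ℂ)).mul_const (h : ℂ)).neg.cexp).const_mul _
  have h2 := ((hasDerivAt_id s).sub_const (a : ℂ)).sub (HasDerivAt.fun_sum h1)
  refine h2.congr_deriv ?_
  rw [charDeriv, sub_eq_add_neg, ← Finset.sum_neg_distrib]
  congr 1
  exact Finset.sum_congr rfl fun j _ => by ring

theorem differentiable_charFun (N : ℕ) (a : ℝ) (ad : ℕ → ℝ) (h : ℝ) :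
    Differentiable ℂ (charFun N a ad h) :=
  fun s => (hasDerivAt_charFun N a ad h s).differentiableAt

theorem modeCoeff_eq_inv_charDeriv (N : ℕ) (ad : ℕ → ℝ) (h : ℝ) (s : ℂ) :
    modeCoeff N ad h s = (charDeriv N ad h s)⁻¹ := by
  rw [modeCoeff, charDeriv, one_div]

theorem norm_cexp_delay (j : ℕ) (h : ℝ) (s : ℂ) :
    ‖cexp (-((j : ℂ) * s * (h : ℂ)))‖ = Real.exp (-(s.re * h)) ^ j := by
  rw [Complex.norm_exp, ← Real.exp_nat_mul]
  congr 1
  simp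
  ring

theorem norm_lead (ad : ℕ → ℝ) (h : ℝ) (m : ℕ) (s : ℂ) :
    ‖lead ad h m s‖ = |ad m| * Real.exp (-(m * h * s.re)) := by
  rw [lead, norm_mul, norm_cexp_delay, Complex.norm_real, Real.norm_eq_abs, ← Real.exp_nat_mul]
  congr 2
  ring

/-- The three ranges are `x ≤ 1`, `1 ≤ x ≤ 1/δ`, and `x ≥ 1/δ`, where one extra factor `δx ≥ 1` is
available. -/
theorem pow_le_add_mul_pow {j m : ℕ} (hj : j < m) {δ : ℝ} (hδ : 0 < δ) {x : ℝ} (hx : 0 ≤ x) :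
    x ^ j ≤ (1 + (1 / δ) ^ (m - 1)) + δ * x ^ m := by
  have hδ' : 0 ≤ (1 / δ) ^ (m - 1) := by positivity
  have hxm : 0 ≤ δ * x ^ m := by positivity
  rcases le_total x 1 with h1 | h1
  · have := pow_le_one₀ (n := j) hx h1
    linarith
  · have h2 : x ^ j ≤ x ^ (m - 1) := pow_le_pow_right₀ h1 (by omega)
    rcases le_total x (1 / δ) with h3 | h3
    · have := pow_le_pow_left₀ hx h3 (m - 1)
      linarith
    · have h4 : 1 ≤ δ * x := by rwa [div_le_iff₀ hδ, mul_comm] at h3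
      have h5 : x ^ m = x * x ^ (m - 1) := by
        rw [← pow_succ']; congr 1; omega
      have h6 : x ^ (m - 1) ≤ (δ * x) * x ^ (m - 1) :=
        le_mul_of_one_le_left (by positivity) h4
      rw [h5]
      linarith

/-- In an exponential sum the term with the largest delay dominates, up to a constant. -/
theorem expSum_sub_le {N m : ℕ} (hm : m ∈ Finset.Icc 1 N) (c : ℕ → ℂ)
    (hc : ∀ j ∈ Finset.Icc 1 N, m < j → c j = 0) (h : ℝ) {δ : ℝ} (hδ : 0 < δ) :
    ∃ C, 0 ≤ C ∧ ∀ s : ℂ, ‖(∑ j ∈ Finset.Icc 1 N, c j * cexp (-((j : ℂ) * s * (h : ℂ)))) -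
      c m * cexp (-((m : ℂ) * s * (h : ℂ)))‖ ≤ C + δ * Real.exp (-(m * h * s.re)) := by
  set K := ∑ j ∈ (Finset.Icc 1 N).erase m, ‖c j‖ with hK
  have hK0 : 0 ≤ K := Finset.sum_nonneg fun _ _ => norm_nonneg _
  set δ' := δ / (K + 1) with hδ'
  have hδ'0 : 0 < δ' := by positivity
  set C := 1 + (1 / δ') ^ (m - 1) with hC
  have hC0 : 0 ≤ C := by positivity
  refine ⟨K * C, by positivity, fun s => ?_⟩
  have hx0 : 0 ≤ Real.exp (-(s.re * h)) := (Real.exp_pos _).le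
  have hxm : Real.exp (-(m * h * s.re)) = Real.exp (-(s.re * h)) ^ m := by
    rw [← Real.exp_nat_mul]; congr 1; ring
  rw [← Finset.add_sum_erase _ _ hm, add_sub_cancel_left]
  calc _ ≤ ∑ j ∈ (Finset.Icc 1 N).erase m, ‖c j * cexp (-((j : ℂ) * s * (h : ℂ)))‖ :=
        norm_sum_le _ _
    _ ≤ ∑ j ∈ (Finset.Icc 1 N).erase m, ‖c j‖ * (C + δ' * Real.exp (-(s.re * h)) ^ m) := by
        refine Finset.sum_le_sum fun j hj => ?_
        obtain ⟨hne, hj⟩ := Finset.mem_erase.1 hj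
        rcases lt_or_gt_of_ne hne with hlt | hlt
        · rw [norm_mul, norm_cexp_delay]
          exact mul_le_mul_of_nonneg_left (pow_le_add_mul_pow hlt hδ'0 hx0) (norm_nonneg _)
        · simp [hc j hj hlt]
    _ = K * (C + δ' * Real.exp (-(s.re * h)) ^ m) := by rw [← Finset.sum_mul]
    _ ≤ K * C + δ * Real.exp (-(m * h * s.re)) := by
        rw [hxm, mul_add]
        have h1 : K * δ' ≤ δ := by
          rw [hδ', mul_div_assoc', div_le_iff₀ (by positivity)]
          nlinarith
        have := mul_le_mul_of_nonneg_right h1 (pow_nonneg hx0 m)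
        linarith

/-- The shorter delays and the constant `a` cost only a constant and a small fraction of the leading
term, so large roots are governed by `s = E(s)`. -/
theorem charFun_sub_le {N : ℕ} (a : ℝ) {ad : ℕ → ℝ} {m : ℕ} (hm : IsLeading N ad m) (h : ℝ) {δ : ℝ}
    (hδ : 0 < δ) : ∃ C, 0 ≤ C ∧ ∀ s : ℂ,
      ‖charFun N a ad h s - (s - lead ad h m s)‖ ≤ C + δ * ‖lead ad h m s‖ := by
  have hA : 0 < |ad m| := abs_pos.2 hm.ne
  obtain ⟨C, hC, hb⟩ := expSum_sub_le hm.mem (fun j => (ad j : ℂ))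
    (fun j hj hlt => by simp [hm.eq_zero j hj hlt]) h (mul_pos hδ hA)
  refine ⟨C + |a|, by positivity, fun s => ?_⟩
  have e : charFun N a ad h s - (s - lead ad h m s) = -(a : ℂ) -
      ((∑ j ∈ Finset.Icc 1 N, (ad j : ℂ) * cexp (-((j : ℂ) * s * (h : ℂ)))) -
        (ad m : ℂ) * cexp (-((m : ℂ) * s * (h : ℂ)))) := by
    rw [charFun, lead]; ring
  rw [e, norm_lead]
  have h1 := norm_sub_le (-(a : ℂ))
    ((∑ j ∈ Finset.Icc 1 N, (ad j : ℂ) * cexp (-((j : ℂ) * s * (h : ℂ)))) -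
        (ad m : ℂ) * cexp (-((m : ℂ) * s * (h : ℂ))))
  have h2 := hb s
  rw [norm_neg, Complex.norm_real, Real.norm_eq_abs] at h1
  linarith

theorem charDeriv_sub_le {N : ℕ} {ad : ℕ → ℝ} {m : ℕ} (hm : IsLeading N ad m) (h : ℝ) {δ : ℝ}
    (hδ : 0 < δ) : ∃ C, 0 ≤ C ∧ ∀ s : ℂ,
      ‖charDeriv N ad h s - (1 + (m * h : ℝ) * lead ad h m s)‖ ≤ C + δ * ‖lead ad h m s‖ := by
  have hA : 0 < |ad m| := abs_pos.2 hm.ne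
  obtain ⟨C, hC, hb⟩ := expSum_sub_le hm.mem (fun j => (j : ℂ) * (ad j : ℂ) * (h : ℂ))
    (fun j hj hlt => by simp [hm.eq_zero j hj hlt]) h (mul_pos hδ hA)
  refine ⟨C, hC, fun s => ?_⟩
  have e : charDeriv N ad h s - (1 + (m * h : ℝ) * lead ad h m s) =
      (∑ j ∈ Finset.Icc 1 N, (j : ℂ) * (ad j : ℂ) * (h : ℂ) * cexp (-((j : ℂ) * s * (h : ℂ)))) -
        (m : ℂ) * (ad m : ℂ) * (h : ℂ) * cexp (-((m : ℂ) * s * (h : ℂ))) := by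
    rw [charDeriv, lead]; push_cast; ring
  rw [e, norm_lead]
  have h2 := hb s
  linarith

/-- Where `|s|` and the leading term are comparable, the real part of `s` is small. -/
theorem re_sq_le_of_lead_comparable {N : ℕ} {ad : ℕ → ℝ} {m : ℕ} (hm : IsLeading N ad m) {h : ℝ}
    (hh : 0 < h) {ε : ℝ} (hε : 0 < ε) : ∃ R, 0 < R ∧ ∀ s : ℂ, R ≤ ‖s‖ →
      ‖s‖ ≤ 2 * ‖lead ad h m s‖ → ‖lead ad h m s‖ ≤ 2 * ‖s‖ → s.re ^ 2 ≤ ε * ‖s‖ := by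
  have hp := hm.delay_pos hh
  set p := (m : ℝ) * h with hpdef
  have hA : 0 < |ad m| := abs_pos.2 hm.ne
  -- Taking logarithms in the two comparisons gives `p |Re s| ≤ log |s| + L`; the squared logarithm
  -- is negligible against `|s|`.
  set L := |Real.log (|ad m|)| + Real.log 2 with hL
  have hL0 : 0 ≤ L := add_nonneg (abs_nonneg _) (Real.log_nonneg (by norm_num))
  have hlim : Tendsto (fun x : ℝ => ((Real.log x + L) / p) ^ 2 / x) atTop (𝓝 0) := by
    have h2 : Tendsto (fun x : ℝ => Real.log x ^ 2 / x) atTop (𝓝 0) :=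
      (Real.isLittleO_pow_log_id_atTop (n := 2)).tendsto_div_nhds_zero
    have h1 : Tendsto (fun x : ℝ => Real.log x / x) atTop (𝓝 0) :=
      Real.isLittleO_log_id_atTop.tendsto_div_nhds_zero
    have h0 : Tendsto (fun x : ℝ => x⁻¹) atTop (𝓝 0) := tendsto_inv_atTop_zero
    have := ((h2.add (h1.const_mul (2 * L))).add (h0.const_mul (L ^ 2))).div_const (p ^ 2)
    simp only [mul_zero, add_zero, zero_div] at this
    refine this.congr fun x => ?_
    field_simp
    ring
  obtain ⟨R, hR⟩ := eventually_atTop.1 ((hlim.eventually (gt_mem_nhds hε)).and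
    (eventually_ge_atTop (1 : ℝ)))
  refine ⟨max R 1, by positivity, fun s hs h1 h2 => ?_⟩
  obtain ⟨h3, h4⟩ := hR ‖s‖ ((le_max_left _ _).trans hs)
  have hs0 : 0 < ‖s‖ := by linarith
  rw [div_lt_iff₀ hs0] at h3
  refine le_trans ?_ h3.le
  have hlead : Real.log ‖lead ad h m s‖ = Real.log (|ad m|) - p * s.re := by
    rw [norm_lead, Real.log_mul hA.ne' (Real.exp_pos _).ne', Real.log_exp]; ring
  have hl0 : 0 < ‖lead ad h m s‖ := by linarith
  have h5 : Real.log ‖s‖ ≤ Real.log 2 + Real.log ‖lead ad h m s‖ := by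
    rw [← Real.log_mul (by norm_num) hl0.ne']
    exact Real.log_le_log hs0 h1
  have h6 : Real.log ‖lead ad h m s‖ ≤ Real.log 2 + Real.log ‖s‖ := by
    rw [← Real.log_mul (by norm_num) hs0.ne']
    exact Real.log_le_log hl0 h2
  rw [hlead] at h5 h6
  have hlog := Real.log_nonneg h4
  have h7 := abs_le.1 (le_refl |Real.log (|ad m|)|)
  have h8 : |s.re| ≤ (Real.log ‖s‖ + L) / p := by
    rw [le_div_iff₀ hp, ← abs_of_pos hp, ← abs_mul, abs_le]
    constructor <;> linarith
  calc s.re ^ 2 = |s.re| ^ 2 := (sq_abs _).symm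
    _ ≤ _ := pow_le_pow_left₀ (abs_nonneg _) h8 2

/-- Since `(|s| - |Im s|)(|s| + |Im s|) = (Re s)² ≤ ε|s|`. -/
theorem norm_le_abs_im_add {s : ℂ} {ε : ℝ} (hε : 0 ≤ ε) (h : s.re ^ 2 ≤ ε * ‖s‖) :
    ‖s‖ ≤ |s.im| + ε := by
  have h1 : ‖s‖ ^ 2 = s.re ^ 2 + |s.im| ^ 2 := by
    rw [← Complex.normSq_eq_norm_sq, Complex.normSq_apply, sq_abs]; ring
  have h2 := Complex.abs_im_le_norm s
  by_contra hlt
  push Not at hlt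
  have := norm_nonneg s
  have := abs_nonneg s.im
  nlinarith

/-- At large characteristic roots the leading term has almost the size of `s`. -/
theorem lead_comparable_of_root {N : ℕ} (a : ℝ) {ad : ℕ → ℝ} {m : ℕ} (hm : IsLeading N ad m)
    (h : ℝ) {ε : ℝ} (hε : 0 < ε) : ∃ R, 0 < R ∧ ∀ s : ℂ, charFun N a ad h s = 0 →
      R ≤ ‖s‖ → ‖s‖ ≤ (1 + ε) * ‖lead ad h m s‖ ∧ ‖lead ad h m s‖ ≤ (1 + ε) * ‖s‖ := by
  set δ := ε / (4 * (1 + ε)) with hδ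
  have hδ0 : 0 < δ := by positivity
  have hδ1 : δ * (4 * (1 + ε)) = ε := by rw [hδ]; field_simp
  obtain ⟨C, hC, hb⟩ := charFun_sub_le a hm h hδ0
  refine ⟨C / δ + 1, by positivity, fun s hs hR => ?_⟩
  have h1 := hb s
  rw [hs, zero_sub, norm_neg] at h1
  have h2 : C ≤ δ * ‖s‖ := by
    have : C / δ ≤ ‖s‖ := by linarith
    rwa [div_le_iff₀ hδ0, mul_comm] at this
  have h3 := norm_sub_norm_le s (lead ad h m s)
  have h4 := norm_sub_norm_le (lead ad h m s) s
  rw [norm_sub_rev] at h4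
  set x := ‖s‖
  set y := ‖lead ad h m s‖
  have hx : 0 ≤ x := norm_nonneg _
  have hy : 0 ≤ y := norm_nonneg _
  have hδ4 : δ ≤ 1 / 4 := by nlinarith
  -- `(1 - δ) (1 + ε) ≥ 1 + δ`
  have hk : 1 + δ ≤ (1 - δ) * (1 + ε) := by nlinarith
  constructor
  · have : (1 - δ) * x ≤ (1 - δ) * ((1 + ε) * y) := by nlinarith
    exact le_of_mul_le_mul_left this (by linarith)
  · have : (1 - δ) * y ≤ (1 - δ) * ((1 + ε) * x) := by nlinarith
    exact le_of_mul_le_mul_left this (by linarith)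

/-- Large characteristic roots are close to the imaginary axis relative to their size. -/
theorem norm_root_le_abs_im_add {N : ℕ} (a : ℝ) {ad : ℕ → ℝ} {m : ℕ} (hm : IsLeading N ad m)
    {h : ℝ} (hh : 0 < h) {ε : ℝ} (hε : 0 < ε) : ∃ R, 0 < R ∧ ∀ s : ℂ, charFun N a ad h s = 0 →
      R ≤ ‖s‖ → ‖s‖ ≤ |s.im| + ε := by
  obtain ⟨R₁, h1, hR₁⟩ := lead_comparable_of_root a hm h one_pos
  obtain ⟨R₂, h2, hR₂⟩ := re_sq_le_of_lead_comparable hm hh hε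
  refine ⟨max R₁ R₂, by positivity, fun s hs hR => ?_⟩
  obtain ⟨h3, h4⟩ := hR₁ s hs ((le_max_left _ _).trans hR)
  norm_num at h3 h4
  exact norm_le_abs_im_add hε.le (hR₂ s ((le_max_right _ _).trans hR) h3 h4)

/-- Infinitely many roots in a ball would accumulate at a root, but a simple root is isolated. -/
theorem finite_roots_norm_le {N : ℕ} {a : ℝ} {ad : ℕ → ℝ} {h : ℝ}
    (hsimple : ∀ s : ℂ, charFun N a ad h s = 0 → deriv (charFun N a ad h) s ≠ 0) (R : ℝ) :
    {s : ℂ | charFun N a ad h s = 0 ∧ ‖s‖ ≤ R}.Finite := by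
  by_contra hinf
  obtain ⟨z, -, hz⟩ := Set.Infinite.exists_accPt_of_subset_isCompact hinf
    (isCompact_closedBall (0 : ℂ) R) (fun s hs => by simpa using hs.2)
  have hcont := (differentiable_charFun N a ad h).continuous
  have hclosed : IsClosed {s : ℂ | charFun N a ad h s = 0} :=
    isClosed_eq hcont continuous_const
  have hfreq := accPt_iff_frequently.1 hz
  have hz0 : charFun N a ad h z = 0 := by
    have : ∃ᶠ y in 𝓝 z, y ∈ {s : ℂ | charFun N a ad h s = 0} := hfreq.mono fun y hy => hy.2.1
    exact hclosed.mem_of_frequently_of_tendsto this tendsto_id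
  have hne := ((differentiable_charFun N a ad h z).hasDerivAt).eventually_ne
    (hsimple z hz0) (c := 0)
  rw [eventually_nhdsWithin_iff] at hne
  obtain ⟨y, hy, hy'⟩ := (hfreq.and_eventually hne).exists
  exact hy' hy.1 hy.2.1

theorem finite_roots_abs_im_le {N : ℕ} {a : ℝ} {ad : ℕ → ℝ} {m : ℕ} (hm : IsLeading N ad m)
    {h : ℝ} (hh : 0 < h)
    (hsimple : ∀ s : ℂ, charFun N a ad h s = 0 → deriv (charFun N a ad h) s ≠ 0) (ρ : ℝ) :
    {s : ℂ | charFun N a ad h s = 0 ∧ |s.im| ≤ ρ}.Finite := by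
  obtain ⟨R, -, hR⟩ := norm_root_le_abs_im_add a hm hh one_pos
  refine (finite_roots_norm_le hsimple (max R (ρ + 1))).subset fun s hs => ⟨hs.1, ?_⟩
  rcases le_total R ‖s‖ with h1 | h1
  · exact (hR s hs.1 h1).trans ((by linarith [hs.2] : |s.im| + 1 ≤ ρ + 1).trans (le_max_right _ _))
  · exact h1.trans (le_max_left _ _)

theorem lead_add (ad : ℕ → ℝ) (h : ℝ) (m : ℕ) (s ζ : ℂ) :
    lead ad h m (s + ζ) = lead ad h m s * cexp (-((m * h : ℝ) * ζ)) := by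
  rw [lead, lead, mul_assoc (ad m : ℂ), ← Complex.exp_add]
  congr 2
  push_cast
  ring

/-- The Taylor remainder is at most `|z|² ≤ |z|/2`. -/
theorem norm_le_two_mul_norm_exp_sub_one {z : ℂ} (hz : ‖z‖ ≤ 1 / 2) :
    ‖z‖ ≤ 2 * ‖cexp z - 1‖ := by
  have h1 := Complex.norm_exp_sub_one_sub_id_le (hz.trans (by norm_num))
  have h2 := norm_sub_norm_le z (-(cexp z - 1 - z))
  rw [norm_neg, sub_neg_eq_add, show z + (cexp z - 1 - z) = cexp z - 1 by ring] at h2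
  nlinarith [norm_nonneg z]

/-- Near a large point the characteristic function behaves like `-E(s) (e^{-pζ} - 1)`. -/
theorem charFun_add_sub_le {N : ℕ} (a : ℝ) {ad : ℕ → ℝ} {m : ℕ} (hm : IsLeading N ad m) {h : ℝ}
    (hh : 0 < h) {δ : ℝ} (hδ : 0 < δ) : ∃ C, 0 ≤ C ∧ ∀ s ζ : ℂ, m * h * ‖ζ‖ ≤ 1 / 2 →
      ‖charFun N a ad h (s + ζ) - charFun N a ad h s +
        lead ad h m s * (cexp (-((m * h : ℝ) * ζ)) - 1)‖ ≤
        (C + δ * ‖lead ad h m s‖) * ‖ζ‖ := by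
  have hp := hm.delay_pos hh
  obtain ⟨C, hC, hb⟩ := charDeriv_sub_le hm h (half_pos hδ)
  refine ⟨1 + C, by positivity, fun s ζ hζ => ?_⟩
  -- Adding the leading exponential leaves a function whose derivative is only `O(1) + δ|E(s)|` on
  -- the ball. The mean value inequality then gives the claim.
  set f : ℂ → ℂ := fun z => charFun N a ad h (s + z) +
    lead ad h m s * cexp (-((m * h : ℝ) * z)) with hf
  have hder : ∀ z : ℂ, HasDerivAt f (charDeriv N ad h (s + z) -
      (m * h : ℝ) * lead ad h m (s + z)) z := by
    intro z
    have h1 := (hasDerivAt_charFun N a ad h (s + z)).comp_const_add s z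
    have h2 := ((((hasDerivAt_id z).const_mul ((m * h : ℝ) : ℂ)).neg.cexp).const_mul
      (lead ad h m s))
    refine (h1.add h2).congr_deriv ?_
    rw [lead_add]
    simp only [Pi.neg_apply, id, mul_one, sub_eq_add_neg]
    congr 1
    ring
  have hbound : ∀ z ∈ Metric.closedBall (0 : ℂ) ‖ζ‖, ‖charDeriv N ad h (s + z) -
      (m * h : ℝ) * lead ad h m (s + z)‖ ≤ 1 + C + δ * ‖lead ad h m s‖ := by
    intro z hz
    have hz' : ‖z‖ ≤ ‖ζ‖ := by simpa using hz
    have h1 := hb (s + z)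
    have h2 : ‖lead ad h m (s + z)‖ ≤ 2 * ‖lead ad h m s‖ := by
      rw [lead_add, norm_mul, mul_comm]
      refine mul_le_mul_of_nonneg_right ?_ (norm_nonneg _)
      have h3 := Complex.norm_exp_le_exp_norm (-((m * h : ℝ) * z))
      have h4 : ‖-(((m * h : ℝ) : ℂ) * z)‖ ≤ 1 / 2 := by
        rw [norm_neg, norm_mul, Complex.norm_of_nonneg hp.le]
        exact (mul_le_mul_of_nonneg_left hz' hp.le).trans hζ
      refine h3.trans ((Real.exp_le_exp.2 h4).trans ?_)
      have h5 := Real.exp_one_lt_d9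
      have h6 : Real.exp (1 / 2) ^ 2 = Real.exp 1 := by rw [← Real.exp_nat_mul]; norm_num
      nlinarith [Real.exp_pos (1 / 2)]
    have h3 : charDeriv N ad h (s + z) - (m * h : ℝ) * lead ad h m (s + z) =
        (charDeriv N ad h (s + z) - (1 + (m * h : ℝ) * lead ad h m (s + z))) + 1 := by ring
    rw [h3]
    refine (norm_add_le _ _).trans ?_
    rw [norm_one]
    nlinarith
  have h1 := (convex_closedBall (0 : ℂ) ‖ζ‖).norm_image_sub_le_of_norm_hasDerivWithin_le
    (fun z hz => (hder z).hasDerivWithinAt) hbound (x := 0) (y := ζ) (by simp) (by simp)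
  have h2 : f ζ - f 0 = charFun N a ad h (s + ζ) - charFun N a ad h s +
      lead ad h m s * (cexp (-((m * h : ℝ) * ζ)) - 1) := by
    simp [hf]; ring
  rwa [h2, sub_zero] at h1

/-! ### Location of the characteristic roots -/

/-- The quarter turn belonging to the sign of the leading coefficient. -/
noncomputable def quarterTurn (A : ℝ) : ℝ := if 0 < A then π / 2 else -(π / 2)

theorem mul_sin_quarterTurn {A : ℝ} : A * Real.sin (quarterTurn A) = |A| := by
  unfold quarterTurn
  split_ifs with h
  · rw [Real.sin_pi_div_two, mul_one, abs_of_pos h]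
  · rw [Real.sin_neg, Real.sin_pi_div_two, abs_of_nonpos (not_lt.1 h)]; ring

theorem cos_quarterTurn (A : ℝ) : Real.cos (quarterTurn A) = 0 := by
  unfold quarterTurn
  split_ifs <;> simp

theorem abs_quarterTurn_le (A : ℝ) : |quarterTurn A| ≤ π := by
  have := Real.pi_pos
  unfold quarterTurn
  split_ifs
  · rw [abs_of_pos (by positivity)]; linarith
  · rw [abs_neg, abs_of_pos (by positivity)]; linarith

/-- Radii of circles that stay away from the characteristic roots. -/
noncomputable def goodRadius (ad : ℕ → ℝ) (h : ℝ) (m n : ℕ) : ℝ :=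
  (2 * π * n + quarterTurn (ad m)) / (m * h)

/-- Approximate imaginary parts of the characteristic roots in the upper half plane. -/
noncomputable def rootHeight (ad : ℕ → ℝ) (h : ℝ) (m n : ℕ) : ℝ :=
  (2 * π * n - quarterTurn (ad m)) / (m * h)

theorem tendsto_goodRadius {N : ℕ} {ad : ℕ → ℝ} {m : ℕ} (hm : IsLeading N ad m) {h : ℝ}
    (hh : 0 < h) : Tendsto (goodRadius ad h m) atTop atTop := by
  have h1 : Tendsto (fun n : ℕ => 2 * π * (n : ℝ)) atTop atTop :=
    tendsto_natCast_atTop_atTop.const_mul_atTop (by positivity)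
  exact (tendsto_atTop_add_const_right _ _ h1).atTop_div_const (hm.delay_pos hh)

theorem tendsto_rootHeight {N : ℕ} {ad : ℕ → ℝ} {m : ℕ} (hm : IsLeading N ad m) {h : ℝ}
    (hh : 0 < h) : Tendsto (rootHeight ad h m) atTop atTop := by
  have h1 : Tendsto (fun n : ℕ => 2 * π * (n : ℝ)) atTop atTop :=
    tendsto_natCast_atTop_atTop.const_mul_atTop (by positivity)
  exact (tendsto_atTop_add_const_right _ (-quarterTurn (ad m)) h1).atTop_div_const
    (hm.delay_pos hh)

theorem lead_im (ad : ℕ → ℝ) (h : ℝ) (m : ℕ) (s : ℂ) :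
    (lead ad h m s).im =
      -(ad m * Real.exp (-(m * h * s.re)) * Real.sin (m * h * s.im)) := by
  rw [lead, Complex.im_ofReal_mul, Complex.exp_im]
  have e1 : (-((m : ℂ) * s * (h : ℂ))).re = -(m * h * s.re) := by simp; ring
  have e2 : (-((m : ℂ) * s * (h : ℂ))).im = -(m * h * s.im) := by simp; ring
  rw [e1, e2, Real.sin_neg]
  ring

/-- The characteristic function is large on the good circles. -/
theorem charFun_ge_on_goodRadius {N : ℕ} (a : ℝ) {ad : ℕ → ℝ} {m : ℕ} (hm : IsLeading N ad m)
    {h : ℝ} (hh : 0 < h) : ∀ᶠ n in atTop, ∀ s : ℂ, ‖s‖ = goodRadius ad h m n →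
      (‖s‖ + ‖lead ad h m s‖) / 8 ≤ ‖charFun N a ad h s‖ := by
  have hp := hm.delay_pos hh
  set p := (m : ℝ) * h with hpdef
  obtain ⟨R₁, hR₁, hre⟩ := re_sq_le_of_lead_comparable hm hh (ε := 1 / p) (by positivity)
  obtain ⟨C, hC, hb⟩ := charFun_sub_le a hm h (δ := 1 / 16) (by norm_num)
  filter_upwards [(tendsto_goodRadius hm hh).eventually_ge_atTop (max R₁ (max (2 / p) (16 * C)))]
    with n hn s hs
  have hn1 : R₁ ≤ ‖s‖ := hs ▸ (le_max_left _ _).trans hn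
  have hn2 : 2 / p ≤ ‖s‖ := hs ▸ ((le_max_left _ _).trans (le_max_right _ _)).trans hn
  have hn3 : 16 * C ≤ ‖s‖ := hs ▸ ((le_max_right _ _).trans (le_max_right _ _)).trans hn
  have hE := norm_nonneg (lead ad h m s)
  have hsn := norm_nonneg s
  have key : (‖s‖ + ‖lead ad h m s‖) / 4 ≤ ‖s - lead ad h m s‖ := by
    rcases lt_or_ge (2 * ‖lead ad h m s‖) ‖s‖ with h1 | h1
    · have := norm_sub_norm_le s (lead ad h m s)
      linarith
    rcases lt_or_ge (2 * ‖s‖) ‖lead ad h m s‖ with h2 | h2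
    · have := norm_sub_norm_le (lead ad h m s) s
      rw [norm_sub_rev] at this
      linarith
    have h3 := norm_le_abs_im_add (by positivity) (hre s hn1 h1 h2)
    have h4 := Complex.abs_im_le_norm s
    set x := p * (‖s‖ - |s.im|) with hx
    have hx0 : 0 ≤ x := mul_nonneg hp.le (by linarith)
    have hx1 : x ≤ 1 := by
      have h5 : ‖s‖ - |s.im| ≤ 1 / p := by linarith
      calc x ≤ p * (1 / p) := mul_le_mul_of_nonneg_left h5 hp.le
        _ = 1 := by field_simp
    have hcos : 1 / 2 ≤ Real.cos x := by
      have := Real.one_sub_sq_div_two_le_cos (x := x)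
      nlinarith
    -- The radius has `p‖s‖` equal to the quarter turn modulo `2π`, and `p|Im s|` is within `x ≤ 1`
    -- of it. Hence `Im E(s)` has the sign opposite to `Im s`, and in `s - E(s)` the two reinforce
    -- each other.
    have hsin : ad m * Real.sin (p * |s.im|) = |ad m| * Real.cos x := by
      have e : p * |s.im| = (quarterTurn (ad m) - x) + n * (2 * π) := by
        have : p * ‖s‖ = 2 * π * n + quarterTurn (ad m) := by
          rw [hs, goodRadius, ← hpdef]; field_simp
        rw [hx]; linarith
      rw [e, Real.sin_add_nat_mul_two_pi, Real.sin_sub, cos_quarterTurn, ← mul_sin_quarterTurn]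
      ring
    have him : |(s - lead ad h m s).im| = |s.im| + ‖lead ad h m s‖ * Real.cos x := by
      have h6 : |s.im| + ‖lead ad h m s‖ * Real.cos x =
          |s.im| + ad m * Real.exp (-(p * s.re)) * Real.sin (p * |s.im|) := by
        rw [norm_lead]
        linear_combination (-Real.exp (-(p * s.re))) * hsin
      have h7 : 0 ≤ |s.im| + ‖lead ad h m s‖ * Real.cos x := by positivity
      rw [sub_im, lead_im, sub_neg_eq_add]
      rcases abs_cases s.im with ⟨h8, -⟩ | ⟨h8, -⟩
      · rw [← abs_of_nonneg h7, h6, h8]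
      · rw [← abs_of_nonneg h7, h6, h8, mul_neg, Real.sin_neg, ← abs_neg]
        congr 1; ring
    have h8 := Complex.abs_im_le_norm (s - lead ad h m s)
    rw [him] at h8
    have h9 : 1 / p ≤ ‖s‖ / 2 := by
      have : 2 / p = 2 * (1 / p) := by ring
      linarith
    nlinarith
  have h1 := hb s
  have h2 := norm_sub_norm_le (s - lead ad h m s) (-(charFun N a ad h s - (s - lead ad h m s)))
  rw [norm_neg, sub_neg_eq_add, add_sub_cancel] at h2
  linarith

/-- Large characteristic roots are separated by their imaginary parts. -/
theorem root_eq_of_im_close {N : ℕ} (a : ℝ) {ad : ℕ → ℝ} {m : ℕ} (hm : IsLeading N ad m)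
    {h : ℝ} (hh : 0 < h) : ∃ R η : ℝ, 0 < R ∧ 0 < η ∧ ∀ s s' : ℂ, charFun N a ad h s = 0 →
      charFun N a ad h s' = 0 → R ≤ ‖s‖ → R ≤ ‖s'‖ → |s.im - s'.im| ≤ η → s = s' := by
  have hp := hm.delay_pos hh
  set p := (m : ℝ) * h with hpdef
  have hA : 0 < |ad m| := abs_pos.2 hm.ne
  obtain ⟨R₁, hR₁, h1⟩ := lead_comparable_of_root a hm h (ε := 1 / 12) (by norm_num)
  obtain ⟨R₂, hR₂, h2⟩ := norm_root_le_abs_im_add a hm hh one_pos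
  obtain ⟨C, hC, hb⟩ := charFun_add_sub_le a hm hh (δ := p / 4) (by positivity)
  refine ⟨max (max R₁ R₂) (max 24 (8 * C / p + 1)), min 1 (1 / (4 * p)), by positivity,
    by positivity, ?_⟩
  -- Roots of nearby height have nearby real parts, since `|E|` is comparable to `|s|` at both and
  -- determines `Re s`.
  have hre : ∀ s s' : ℂ, charFun N a ad h s = 0 → charFun N a ad h s' = 0 →
      max (max R₁ R₂) (max 24 (8 * C / p + 1)) ≤ ‖s‖ →
      max (max R₁ R₂) (max 24 (8 * C / p + 1)) ≤ ‖s'‖ → |s.im - s'.im| ≤ min 1 (1 / (4 * p)) →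
      p * (s'.re - s.re) ≤ 1 / 4 := by
    intro s s' hs hs' hR hR' him
    have hR1 : R₁ ≤ ‖s‖ := ((le_max_left _ _).trans (le_max_left _ _)).trans hR
    have hR1' : R₁ ≤ ‖s'‖ := ((le_max_left _ _).trans (le_max_left _ _)).trans hR'
    have hR2 : R₂ ≤ ‖s‖ := ((le_max_right _ _).trans (le_max_left _ _)).trans hR
    have h24 : 24 ≤ ‖s'‖ := ((le_max_left _ _).trans (le_max_right _ _)).trans hR'
    have e1 := (h1 s hs hR1).2
    have e2 := (h1 s' hs' hR1').1
    have e3 := h2 s hs hR2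
    have e4 := Complex.abs_im_le_norm s'
    have e5 := abs_sub_abs_le_abs_sub s.im s'.im
    have e6 := him.trans (min_le_left _ _)
    have e7 : ‖s‖ ≤ (1 + 1 / 12) * ‖s'‖ := by linarith
    -- One factor `13/12` for each comparison in the chain `|E(s)|, |s|, |s'|, |E(s')|`; the bound
    -- `24` on the norms absorbs the additive `2` in the middle one. The cube is at most `e^{1/4}`.
    have e8 : ‖lead ad h m s‖ ≤ (1 + 1 / 12) ^ 3 * ‖lead ad h m s'‖ := by nlinarith
    rw [norm_lead, norm_lead, mul_left_comm] at e8
    have e9 := le_of_mul_le_mul_left e8 hA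
    have e10 : (1 + 1 / 12 : ℝ) ≤ Real.exp (1 / 12) := by
      have := Real.add_one_le_exp (1 / 12 : ℝ); linarith
    have e11 : (1 + 1 / 12 : ℝ) ^ 3 ≤ Real.exp (1 / 4) := by
      refine (pow_le_pow_left₀ (by norm_num) e10 3).trans (le_of_eq ?_)
      rw [← Real.exp_nat_mul]; norm_num
    have e12 : Real.exp (-(p * s.re)) ≤ Real.exp (1 / 4 + -(p * s'.re)) := by
      rw [Real.exp_add]
      exact e9.trans (mul_le_mul_of_nonneg_right e11 (Real.exp_pos _).le)
    have := Real.exp_le_exp.1 e12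
    linarith
  intro s s' hs hs' hR hR' him
  have g1 := hre s s' hs hs' hR hR' him
  have g2 := hre s' s hs' hs hR' hR (by rwa [abs_sub_comm])
  by_contra hne
  set ζ := s' - s with hζ
  have hζ0 : 0 < ‖ζ‖ := norm_pos_iff.2 (sub_ne_zero.2 (Ne.symm hne))
  have g3 : p * ‖ζ‖ ≤ 1 / 2 := by
    have q1 := Complex.norm_le_abs_re_add_abs_im ζ
    have q2 : p * |ζ.re| ≤ 1 / 4 := by
      rw [← abs_of_pos hp, ← abs_mul, abs_le, hζ, sub_re]
      constructor <;> linarith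
    have q3 : p * |ζ.im| ≤ 1 / 4 := by
      rw [hζ, sub_im, abs_sub_comm]
      calc _ ≤ p * (1 / (4 * p)) :=
            mul_le_mul_of_nonneg_left (him.trans (min_le_right _ _)) hp.le
        _ = 1 / 4 := by field_simp
    nlinarith
  have g4 := hb s ζ g3
  -- As `Δ` vanishes at both roots, only `E(s)(e^{-pζ} - 1)` remains. It has size at least `|E(s)|
  -- p|ζ|/2`, too large for the error term when `s` is large.
  rw [show s + ζ = s' by rw [hζ]; ring, hs, hs', sub_zero, zero_add, norm_mul] at g4
  have g5 := norm_le_two_mul_norm_exp_sub_one (z := -(((m * h : ℝ) : ℂ) * ζ))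
    (by rw [norm_neg, norm_mul, Complex.norm_of_nonneg hp.le]; exact g3)
  rw [norm_neg, norm_mul, Complex.norm_of_nonneg hp.le] at g5
  have hR1 : R₁ ≤ ‖s‖ := ((le_max_left _ _).trans (le_max_left _ _)).trans hR
  have g6 := (h1 s hs hR1).1
  have g7 : 8 * C / p + 1 ≤ ‖s‖ := ((le_max_right _ _).trans (le_max_right _ _)).trans hR
  have g8 : ‖lead ad h m s‖ * (p * ‖ζ‖) ≤ 2 * ((C + p / 4 * ‖lead ad h m s‖) * ‖ζ‖) := by
    refine (mul_le_mul_of_nonneg_left g5 (norm_nonneg _)).trans ?_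
    linarith
  have g9 : ‖lead ad h m s‖ * p ≤ 2 * (C + p / 4 * ‖lead ad h m s‖) := by
    refine le_of_mul_le_mul_right ?_ hζ0
    linarith
  have g10 : 8 * C < p * ‖s‖ := by
    have : 8 * C / p < ‖s‖ := by linarith
    rw [div_lt_iff₀ hp] at this
    linarith
  nlinarith

/-- Existence of characteristic roots near the expected heights. -/
theorem exists_root_near {N : ℕ} (a : ℝ) {ad : ℕ → ℝ} {m : ℕ} (hm : IsLeading N ad m)
    {h : ℝ} (hh : 0 < h) : ∀ᶠ n in atTop, ∃ s : ℂ, charFun N a ad h s = 0 ∧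
      |s.im - rootHeight ad h m n| ≤ 1 / (m * h) := by
  have hp := hm.delay_pos hh
  set p := (m : ℝ) * h with hpdef
  have hA : 0 < |ad m| := abs_pos.2 hm.ne
  obtain ⟨C₁, hC₁, hb₁⟩ := charFun_sub_le a hm h (δ := 1 / 128) (by norm_num)
  obtain ⟨C₂, hC₂, hb₂⟩ := charFun_add_sub_le a hm hh (δ := p / 8) (by positivity)
  have hlog : ∀ᶠ ω : ℝ in atTop, |Real.log (ω / |ad m|) / p| ≤ ω / 128 := by
    have h1 : Tendsto (fun x : ℝ => Real.log x / x) atTop (𝓝 0) :=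
      Real.isLittleO_log_id_atTop.tendsto_div_nhds_zero
    have h2 := (h1.comp (tendsto_id.atTop_div_const hA)).abs
    rw [abs_zero] at h2
    filter_upwards [h2.eventually (gt_mem_nhds (show 0 < p * |ad m| / 128 by positivity)),
      eventually_gt_atTop 0] with ω hω hω0
    simp only [Function.comp, id] at hω
    rw [abs_div, abs_of_pos (div_pos hω0 hA), div_lt_iff₀ (div_pos hω0 hA)] at hω
    rw [abs_div, abs_of_pos hp, div_le_iff₀ hp]
    refine hω.le.trans (le_of_eq ?_)
    field_simp
  filter_upwards [(tendsto_rootHeight hm hh).eventually hlog,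
    (tendsto_rootHeight hm hh).eventually_ge_atTop (max 1 (max (128 * C₁) (8 * C₂ / p)))]
    with n hn1 hn2
  set ω := rootHeight ad h m n with hω
  have hω1 : 1 ≤ ω := (le_max_left _ _).trans hn2
  have hω2 : 128 * C₁ ≤ ω := ((le_max_left _ _).trans (le_max_right _ _)).trans hn2
  have hω3 : 8 * C₂ ≤ ω * p := by
    have : 8 * C₂ / p ≤ ω := ((le_max_right _ _).trans (le_max_right _ _)).trans hn2
    rwa [div_le_iff₀ hp] at this
  have hω0 : 0 < ω := by linarith
  -- `σ` and the height `ω` are chosen so that `E(z) = iω` exactly; then `z - E(z) = σ` is only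
  -- logarithmic in `ω`.
  set σ := -(Real.log (ω / |ad m|) / p) with hσ
  set z : ℂ := (σ : ℂ) + (ω : ℂ) * I with hz
  have hexpσ : Real.exp (-(p * σ)) = ω / |ad m| := by
    rw [hσ, show -(p * -(Real.log (ω / |ad m|) / p)) = Real.log (ω / |ad m|) by field_simp,
      Real.exp_log (div_pos hω0 hA)]
  have hlead : lead ad h m z = (ω : ℂ) * I := by
    have e1 : -((m : ℂ) * z * (h : ℂ)) = ((-(p * σ) : ℝ) : ℂ) + ((-(p * ω) : ℝ) : ℂ) * I := by
      rw [hz, hpdef]; push_cast; ring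
    have e2 : -(p * ω) = quarterTurn (ad m) - n * (2 * π) := by
      rw [hω, rootHeight, ← hpdef]; field_simp; ring
    rw [lead, e1, Complex.exp_add, Complex.exp_mul_I, ← Complex.ofReal_exp, ← Complex.ofReal_cos,
      ← Complex.ofReal_sin, hexpσ, e2, Real.cos_sub_nat_mul_two_pi, Real.sin_sub_nat_mul_two_pi,
      cos_quarterTurn]
    have e3 : (ad m : ℂ) * (Real.sin (quarterTurn (ad m)) : ℂ) = (|ad m| : ℝ) := by
      rw [← mul_sin_quarterTurn (A := ad m)]; push_cast; ring
    have e4 : ((|ad m| : ℝ) : ℂ) ≠ 0 := ofReal_ne_zero.2 hA.ne'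
    rw [ofReal_div, ofReal_zero, zero_add]
    calc _ = ((ad m : ℂ) * (Real.sin (quarterTurn (ad m)) : ℂ)) * ((ω : ℂ) / (|ad m| : ℝ)) * I := by
          ring
      _ = _ := by rw [e3]; field_simp
  have hnl : ‖lead ad h m z‖ = ω := by
    rw [hlead, norm_mul, Complex.norm_I, mul_one, Complex.norm_of_nonneg hω0.le]
  set r := 1 / (2 * p) with hr
  have hr0 : 0 < r := by positivity
  set f : ℂ → ℂ := fun ζ => charFun N a ad h (z + ζ) with hf
  have hfd : Differentiable ℂ f := (differentiable_charFun N a ad h).comp (by fun_prop)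
  -- Three contributions of at most `ω/128` each: `|σ|`, the constant `C₁`, and the multiple of
  -- `|E(z)| = ω`.
  have hf0 : ‖f 0‖ < ω / 8 / 2 := by
    have h1 := hb₁ z
    rw [hnl, hlead, show z - (ω : ℂ) * I = σ by rw [hz]; ring] at h1
    have h2 := norm_sub_norm_le (charFun N a ad h z) σ
    rw [Complex.norm_real, Real.norm_eq_abs, hσ, abs_neg] at h2
    simp only [hf, add_zero]
    rw [hσ] at h1
    linarith
  have hsph : ∀ ζ ∈ Metric.sphere (0 : ℂ) r, ω / 8 ≤ ‖f ζ - f 0‖ := by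
    intro ζ hζ
    have hζn : ‖ζ‖ = r := by simpa using hζ
    have hpr : p * ‖ζ‖ = 1 / 2 := by rw [hζn, hr]; field_simp
    have h1 := hb₂ z ζ hpr.le
    rw [hnl] at h1
    have h2 := norm_le_two_mul_norm_exp_sub_one (z := -(((m * h : ℝ) : ℂ) * ζ))
      (by rw [norm_neg, norm_mul, Complex.norm_of_nonneg hp.le]; exact hpr.le)
    rw [norm_neg, norm_mul, Complex.norm_of_nonneg hp.le] at h2
    have h2' : 1 / 2 ≤ 2 * ‖cexp (-(((m * h : ℝ) : ℂ) * ζ)) - 1‖ := by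
      rw [← hpr]; exact h2
    have h3 : ‖lead ad h m z * (cexp (-((m * h : ℝ) * ζ)) - 1)‖ =
        ω * ‖cexp (-(((m * h : ℝ) : ℂ) * ζ)) - 1‖ := by
      rw [norm_mul, hnl]
    have h4 := norm_sub_norm_le (lead ad h m z * (cexp (-((m * h : ℝ) * ζ)) - 1))
      (-(charFun N a ad h (z + ζ) - charFun N a ad h z))
    rw [norm_neg, sub_neg_eq_add, h3, add_comm (lead ad h m z * _)] at h4
    have h5 : (C₂ + p / 8 * ω) * ‖ζ‖ ≤ ω / 8 := by
      rw [hζn]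
      have : (C₂ + p / 8 * ω) * r = (C₂ + p / 8 * ω) / (2 * p) := by rw [hr]; ring
      rw [this, div_le_iff₀ (by positivity)]
      nlinarith
    simp only [hf, add_zero]
    nlinarith
  have hfreq : ∃ᶠ ζ in 𝓝 (0 : ℂ), f ζ ≠ f 0 := by
    intro hev
    simp only [not_not] at hev
    have h1 : f = fun _ => f 0 :=
      AnalyticOnNhd.eq_of_eventuallyEq (hfd.differentiableOn.analyticOnNhd isOpen_univ)
        (analyticOnNhd_const) hev
    have h2 := hsph (r : ℂ) (by simp [abs_of_pos hr0])
    rw [h1] at h2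
    simp at h2
    linarith
  -- The quantitative open mapping theorem: the image of the ball of radius `r` contains the ball of
  -- radius `ω/16` about `f 0`, hence `0`.
  have himg := (hfd.diffContOnCl (s := Metric.ball 0 r)).ball_subset_image_closedBall hr0 hsph hfreq
  obtain ⟨ζ, hζ, hζ0⟩ := himg (show (0 : ℂ) ∈ Metric.ball (f 0) (ω / 8 / 2) by
    rw [Metric.mem_ball, dist_eq_norm, zero_sub, norm_neg]; exact hf0)
  refine ⟨z + ζ, hζ0, ?_⟩
  have h1 : (z + ζ).im - ω = ζ.im := by simp [hz]
  rw [h1]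
  refine (Complex.abs_im_le_norm ζ).trans ((show ‖ζ‖ ≤ r by simpa using hζ).trans ?_)
  rw [hr]
  exact one_div_le_one_div_of_le hp (by linarith)

/-- The derivative of the characteristic function at large roots. -/
theorem charDeriv_ge_of_root {N : ℕ} (a : ℝ) {ad : ℕ → ℝ} {m : ℕ} (hm : IsLeading N ad m)
    {h : ℝ} (hh : 0 < h) : ∃ R, 0 < R ∧ ∀ s : ℂ, charFun N a ad h s = 0 → R ≤ ‖s‖ →
      m * h / 4 * ‖s‖ ≤ ‖charDeriv N ad h s‖ := by
  have hp := hm.delay_pos hh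
  set p := (m : ℝ) * h with hpdef
  obtain ⟨R₁, hR₁, h1⟩ := lead_comparable_of_root a hm h one_pos
  obtain ⟨C, hC, hb⟩ := charDeriv_sub_le hm h (δ := p / 4) (by positivity)
  refine ⟨max R₁ (8 * (C + 1) / p), by positivity, fun s hs hR => ?_⟩
  have h2 := (h1 s hs ((le_max_left _ _).trans hR)).1
  have h3 := (le_max_right _ _).trans hR
  rw [div_le_iff₀ hp] at h3
  have h4 := hb s
  have h5 := norm_sub_norm_le (((m * h : ℝ) : ℂ) * lead ad h m s)
    (-(1 + (charDeriv N ad h s - (1 + ((m * h : ℝ) : ℂ) * lead ad h m s))))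
  rw [norm_neg, norm_mul, Complex.norm_of_nonneg hp.le, sub_neg_eq_add] at h5
  rw [show ((m * h : ℝ) : ℂ) * lead ad h m s +
    (1 + (charDeriv N ad h s - (1 + ((m * h : ℝ) : ℂ) * lead ad h m s))) = charDeriv N ad h s by
      ring] at h5
  have h6 := norm_add_le (1 : ℂ) (charDeriv N ad h s - (1 + ((m * h : ℝ) : ℂ) * lead ad h m s))
  rw [norm_one] at h6
  nlinarith

/-- Exponential decay along the characteristic roots is polynomial decay in `|s|`. -/
theorem norm_exp_le_of_root {N : ℕ} (a : ℝ) {ad : ℕ → ℝ} {m : ℕ} (hm : IsLeading N ad m)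
    {h : ℝ} (hh : 0 < h) {t : ℝ} (ht : 0 < t) : ∃ R K, 0 < R ∧ 0 < K ∧ ∀ s : ℂ,
      charFun N a ad h s = 0 → R ≤ ‖s‖ → ‖cexp (s * t)‖ ≤ K * ‖s‖ ^ (-(t / (m * h))) := by
  have hp := hm.delay_pos hh
  set p := (m : ℝ) * h with hpdef
  have hA : 0 < |ad m| := abs_pos.2 hm.ne
  obtain ⟨R₁, hR₁, h1⟩ := lead_comparable_of_root a hm h one_pos
  refine ⟨R₁, (2 * |ad m|) ^ (t / p), hR₁, by positivity, fun s hs hR => ?_⟩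
  have hs0 : 0 < ‖s‖ := hR₁.trans_le hR
  have h2 := (h1 s hs hR).1
  rw [norm_lead] at h2
  -- This is `|s| ≤ 2|E(s)|` solved for `e^{p Re s}`; the power `t/p` of it is the estimate wanted.
  have h3 : ‖s‖ * Real.exp (p * s.re) ≤ 2 * |ad m| := by
    have := mul_le_mul_of_nonneg_right h2 (Real.exp_pos (p * s.re)).le
    refine this.trans (le_of_eq ?_)
    rw [Real.exp_neg, ← hpdef]
    field_simp
    norm_num
  have h4 := Real.rpow_le_rpow (by positivity) h3 (show 0 ≤ t / p by positivity)
  rw [Real.mul_rpow hs0.le (Real.exp_pos _).le, ← Real.exp_mul,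
    show p * s.re * (t / p) = s.re * t by field_simp] at h4
  rw [Complex.norm_exp, Real.rpow_neg hs0.le, ← div_eq_mul_inv, le_div_iff₀ (by positivity)]
  have e : (s * (t : ℂ)).re = s.re * t := by simp
  rw [e, mul_comm]
  exact h4

/-! ### Residues at simple zeros -/

theorem hasDerivAt_of_sub_mul {f g : ℂ → ℂ} {c : ℂ} (hg : Differentiable ℂ g)
    (h : ∀ s, f s = (s - c) * g s) (z : ℂ) : HasDerivAt f (g z + (z - c) * deriv g z) z := by
  have h1 := ((hasDerivAt_id z).sub_const c).mul (hg z).hasDerivAt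
  have h2 : f = (fun s => id s - c) * g := by funext s; simp [h s]
  rw [h2]
  simpa using h1

theorem sub_mul_dslope (f : ℂ → ℂ) {c : ℂ} (hc : f c = 0) (s : ℂ) :
    f s = (s - c) * dslope f c s := by
  have := sub_smul_dslope f c s
  rw [hc, sub_zero] at this
  exact this.symm

theorem differentiable_dslope {f : ℂ → ℂ} (hf : Differentiable ℂ f) (c : ℂ) :
    Differentiable ℂ (dslope f c) :=
  differentiableOn_univ.1 ((Complex.differentiableOn_dslope univ_mem).2 hf.differentiableOn)

/-- The residue theorem for a quotient of entire functions with simple poles. -/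
theorem circleIntegral_div_eq_sum {R : ℝ} (hR : 0 < R) (Z : Finset ℂ) : ∀ f D : ℂ → ℂ,
    Differentiable ℂ f → Differentiable ℂ D →
    (∀ z ∈ Z, ‖z‖ < R ∧ D z = 0 ∧ deriv D z ≠ 0) → (∀ s, ‖s‖ ≤ R → D s = 0 → s ∈ Z) →
    (∮ s in C(0, R), f s / D s) = 2 * π * I * ∑ z ∈ Z, f z / deriv D z := by
  induction Z using Finset.induction_on with
  | empty =>
    intro f D hf hD _ hzero
    have hne : ∀ s : ℂ, ‖s‖ ≤ R → D s ≠ 0 := fun s hs h => by simpa using hzero s hs h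
    rw [Finset.sum_empty, mul_zero]
    refine Complex.circleIntegral_eq_zero_of_differentiable_on_off_countable hR.le
      countable_empty (ContinuousOn.div hf.continuous.continuousOn hD.continuous.continuousOn
        fun s hs => hne s (by simpa using hs)) fun s hs => (hf s).div (hD s) (hne s ?_)
    have : ‖s‖ < R := by simpa using hs.1
    exact this.le
  | insert c Z hc ih =>
    intro f D hf hD hZ hzero
    obtain ⟨hcR, hc0, hcd⟩ := hZ c (Finset.mem_insert_self _ _)
    set D₁ := dslope D c with hD₁
    have hD₁d : Differentiable ℂ D₁ := differentiable_dslope hD c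
    have hfac : ∀ s, D s = (s - c) * D₁ s := sub_mul_dslope D hc0
    have hD₁c : D₁ c = deriv D c := dslope_same D c
    -- `μ` is the residue at `c`. As `f - μ D₁` vanishes at `c`, the quotient splits as `f/D = f₁/D₁
    -- + μ/(s - c)`, with one zero fewer in `D₁` and the same residues at the other zeros.
    set μ := f c / D₁ c with hμ
    set g : ℂ → ℂ := fun s => f s - μ * D₁ s with hg
    have hgd : Differentiable ℂ g := hf.sub (hD₁d.const_mul μ)
    have hgc : g c = 0 := by
      simp only [hg, hμ]
      rw [div_mul_cancel₀ _ (by rw [hD₁c]; exact hcd), sub_self]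
    set f₁ := dslope g c with hf₁
    have hf₁d : Differentiable ℂ f₁ := differentiable_dslope hgd c
    have hgfac : ∀ s, g s = (s - c) * f₁ s := sub_mul_dslope g hgc
    have hderiv : ∀ z ∈ Z, D₁ z = 0 ∧ deriv D z = (z - c) * deriv D₁ z ∧ z ≠ c := by
      intro z hz
      obtain ⟨-, hz0, -⟩ := hZ z (Finset.mem_insert_of_mem hz)
      have hzc : z ≠ c := by rintro rfl; exact hc hz
      have h1 : D₁ z = 0 := by
        have := hfac z
        rw [hz0] at this
        exact (mul_eq_zero.1 this.symm).resolve_left (sub_ne_zero.2 hzc)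
      refine ⟨h1, ?_, hzc⟩
      rw [(hasDerivAt_of_sub_mul hD₁d hfac z).deriv, h1, zero_add]
    have hsphere : ∀ s : ℂ, ‖s‖ = R → D s ≠ 0 ∧ s ≠ c := by
      intro s hs
      refine ⟨fun h => ?_, fun h => ?_⟩
      · have := (hZ s (hzero s hs.le h)).1
        linarith
      · rw [h] at hs; linarith
    have key := ih f₁ D₁ hf₁d hD₁d (fun z hz => ?_) (fun s hs h => ?_)
    · have hcongr : (∮ s in C(0, R), f s / D s) =
          ∮ s in C(0, R), (f₁ s / D₁ s + μ * (s - c)⁻¹) := by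
        refine circleIntegral.integral_congr hR.le fun s hs => ?_
        obtain ⟨h1, h2⟩ := hsphere s (by simpa using hs)
        have h3 : s - c ≠ 0 := sub_ne_zero.2 h2
        have h4 : D₁ s ≠ 0 := fun h => h1 (by rw [hfac, h, mul_zero])
        have h5 : f s = (s - c) * f₁ s + μ * D₁ s := by rw [← hgfac]; simp [hg]
        rw [h5, hfac]
        field_simp
      have hcircle : ContinuousOn (fun s => f₁ s / D₁ s) (Metric.sphere 0 R) := by
        refine hf₁d.continuous.continuousOn.div hD₁d.continuous.continuousOn fun s hs h => ?_
        exact (hsphere s (by simpa using hs)).1 (by rw [hfac, h, mul_zero])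
      have hcircle₂ : ContinuousOn (fun s => μ * (s - c)⁻¹) (Metric.sphere 0 R) := by
        refine continuousOn_const.mul (ContinuousOn.inv₀ (by fun_prop) fun s hs => ?_)
        exact sub_ne_zero.2 (hsphere s (by simpa using hs)).2
      rw [hcongr, circleIntegral.integral_add (hcircle.circleIntegrable hR.le)
        (hcircle₂.circleIntegrable hR.le), key, circleIntegral.integral_const_mul,
        circleIntegral.integral_sub_inv_of_mem_ball (by simpa using hcR), Finset.sum_insert hc]
      have hsum : ∑ z ∈ Z, f₁ z / deriv D₁ z = ∑ z ∈ Z, f z / deriv D z := by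
        refine Finset.sum_congr rfl fun z hz => ?_
        obtain ⟨h1, h2, h3⟩ := hderiv z hz
        have h5 : f z = (z - c) * f₁ z := by rw [← hgfac]; simp [hg, h1]
        rw [h2, h5, mul_div_mul_left _ _ (sub_ne_zero.2 h3)]
      rw [hsum, hμ, hD₁c]
      ring
    · obtain ⟨h1, h2, h3⟩ := hderiv z hz
      obtain ⟨h4, -, h5⟩ := hZ z (Finset.mem_insert_of_mem hz)
      refine ⟨h4, h1, fun h => h5 (by rw [h2, h, mul_zero])⟩
    · have hs0 : D s = 0 := by rw [hfac, h, mul_zero]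
      rcases Finset.mem_insert.1 (hzero s hs hs0) with h1 | h1
      · rw [h1] at h; exact absurd (hD₁c ▸ h) hcd
      · exact h1

/-! ### Fubini on squares -/

theorem integrableOn_kernel_mul {k : ℝ × ℝ → ℂ} {W : ℝ → ℂ} {t M : ℝ} (ht : 0 ≤ t)
    (hk : Measurable k) (hb : ∀ τ ∈ Ioc 0 t, ∀ σ ∈ Ioc 0 t, ‖k (τ, σ)‖ ≤ M)
    (hW : IntervalIntegrable W volume 0 t) :
    IntegrableOn (Function.uncurry fun τ σ => k (τ, σ) * W σ) (Ι 0 t ×ˢ Ι 0 t) := by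
  rw [uIoc_of_le ht]
  have hW' : IntegrableOn W (Ioc 0 t) := (intervalIntegrable_iff_integrableOn_Ioc_of_le ht).1 hW
  rw [IntegrableOn, Measure.volume_eq_prod, ← Measure.prod_restrict]
  have h1 : Integrable (fun q : ℝ × ℝ => W q.2)
      ((volume.restrict (Ioc 0 t)).prod (volume.restrict (Ioc 0 t))) :=
    Integrable.comp_snd hW' _
  refine h1.bdd_mul (c := M) hk.aestronglyMeasurable ?_
  rw [Measure.prod_restrict]
  filter_upwards [ae_restrict_mem (measurableSet_Ioc.prod measurableSet_Ioc)] with q hq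
  exact hb q.1 hq.1 q.2 hq.2

/-- Fubini on the triangle `σ ≤ τ`, written as a square with an indicator kernel. -/
theorem integral_mul_primitive {g W : ℝ → ℂ} {t : ℝ} (ht : 0 ≤ t) (hg : Continuous g)
    (hW : IntervalIntegrable W volume 0 t) :
    ∫ τ in (0 : ℝ)..t, g τ * ∫ σ in (0 : ℝ)..τ, W σ =
      ∫ σ in (0 : ℝ)..t, (∫ τ in σ..t, g τ) * W σ := by
  obtain ⟨M, hM⟩ := (isCompact_Icc (a := (0 : ℝ)) (b := t)).exists_bound_of_continuousOn
    hg.continuousOn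
  set k : ℝ × ℝ → ℂ := indicator {q | q.2 ≤ q.1} fun q => g q.1 with hk
  have hkm : Measurable k :=
    (hg.measurable.comp measurable_fst).indicator (measurableSet_le measurable_snd measurable_fst)
  have hkb : ∀ τ ∈ Ioc 0 t, ∀ σ ∈ Ioc 0 t, ‖k (τ, σ)‖ ≤ M := fun τ hτ σ _ =>
    (norm_indicator_le_norm_self _ _).trans (hM τ (Ioc_subset_Icc_self hτ))
  have hswap := intervalIntegral_intervalIntegral_swap (integrableOn_kernel_mul ht hkm hkb hW)
  have h1 : ∀ τ ∈ uIcc 0 t, ∫ σ in (0 : ℝ)..t, k (τ, σ) * W σ = g τ * ∫ σ in (0 : ℝ)..τ, W σ := by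
    intro τ hτ
    rw [uIcc_of_le ht] at hτ
    rw [← intervalIntegral.integral_const_mul, ← intervalIntegral.integral_indicator hτ]
    refine intervalIntegral.integral_congr fun σ _ => ?_
    by_cases h : σ ≤ τ <;> simp [hk, indicator, h]
  have h2 : ∀ σ ∈ uIcc 0 t, ∫ τ in (0 : ℝ)..t, k (τ, σ) * W σ = (∫ τ in σ..t, g τ) * W σ := by
    intro σ hσ
    rw [uIcc_of_le ht] at hσ
    rw [intervalIntegral.integral_mul_const]
    congr 1
    have hz : ∫ τ in (0 : ℝ)..σ, k (τ, σ) = 0 := by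
      rw [intervalIntegral.integral_congr_ae (g := fun _ => 0)]
      · simp
      · filter_upwards [Measure.ae_ne volume σ] with τ hτ hmem
        rw [uIoc_of_le hσ.1] at hmem
        have : ¬ σ ≤ τ := fun h => hτ (le_antisymm hmem.2 h)
        simp [hk, this]
    have he : ∫ τ in σ..t, k (τ, σ) = ∫ τ in σ..t, g τ := by
      refine intervalIntegral.integral_congr fun τ hτ => ?_
      rw [uIcc_of_le hσ.2] at hτ
      simp [hk, hτ.1]
    have hint : ∀ A B : ℝ, IntervalIntegrable (fun τ => k (τ, σ)) volume A B := fun A B => by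
      have h3 : (fun τ => k (τ, σ)) = indicator (Ici σ) g := by
        funext τ; by_cases h : σ ≤ τ <;> simp [hk, indicator, h]
      rw [h3, intervalIntegrable_iff]
      exact (intervalIntegrable_iff.1 (hg.intervalIntegrable A B)).indicator measurableSet_Ici
    rw [← intervalIntegral.integral_add_adjacent_intervals (hint 0 σ) (hint σ t), hz, he, zero_add]
  rw [← intervalIntegral.integral_congr h1, hswap, intervalIntegral.integral_congr h2]

/-- Integration by parts against an exponential, for a primitive of an integrable function. -/
theorem integral_mul_exp_of_primitive {w W : ℝ → ℂ} {w₀ : ℂ} {t : ℝ} (ht : 0 ≤ t)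
    (hW : IntervalIntegrable W volume 0 t)
    (hw : ∀ τ ∈ Icc 0 t, w τ = w₀ + ∫ σ in (0 : ℝ)..τ, W σ) (s : ℂ) :
    ∫ τ in (0 : ℝ)..t, W τ * cexp (-(s * τ)) =
      w t * cexp (-(s * t)) - w₀ + s * ∫ τ in (0 : ℝ)..t, w τ * cexp (-(s * τ)) := by
  have hexp : ∀ α β : ℝ, ∫ τ in α..β, s * cexp (-(s * τ)) = cexp (-(s * α)) - cexp (-(s * β)) := by
    intro α β
    have hd : ∀ τ ∈ uIcc α β,
        HasDerivAt (fun τ : ℝ => -cexp (-(s * τ))) (s * cexp (-(s * τ))) τ := by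
      intro τ _
      have h1 : HasDerivAt (fun z : ℂ => -cexp (-(s * z))) (s * cexp (-(s * τ))) (τ : ℂ) := by
        have := (((hasDerivAt_id (τ : ℂ)).const_mul s).neg.cexp).neg
        refine this.congr_deriv ?_
        simp [mul_comm]
      exact h1.comp_ofReal
    rw [intervalIntegral.integral_eq_sub_of_hasDerivAt hd
      (Continuous.intervalIntegrable (by fun_prop) _ _)]
    ring
  have hg : Continuous fun τ : ℝ => s * cexp (-(s * τ)) := by fun_prop
  -- The inner integral of `s e^{-sτ}` over `[σ, t]` is `e^{-sσ} - e^{-st}`, so Fubini replaces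
  -- integration by parts and `w` need not be differentiated.
  have htri := integral_mul_primitive ht hg hW
  have hP : ContinuousOn (fun τ => ∫ σ in (0 : ℝ)..τ, W σ) (uIcc 0 t) :=
    intervalIntegral.continuousOn_primitive_interval' hW left_mem_uIcc
  have h1 : s * ∫ τ in (0 : ℝ)..t, w τ * cexp (-(s * τ)) =
      w₀ * (1 - cexp (-(s * t))) + ∫ τ in (0 : ℝ)..t, (s * cexp (-(s * τ))) *
        ∫ σ in (0 : ℝ)..τ, W σ := by
    have h2 := hexp 0 t
    rw [ofReal_zero, mul_zero, neg_zero, Complex.exp_zero] at h2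
    have hi₁ : IntervalIntegrable (fun τ : ℝ => w₀ * (s * cexp (-(s * τ)))) volume 0 t :=
      Continuous.intervalIntegrable (by fun_prop) _ _
    have hi₂ : IntervalIntegrable (fun τ : ℝ => (s * cexp (-(s * τ))) * ∫ σ in (0 : ℝ)..τ, W σ)
      volume 0 t := (hg.continuousOn.mul hP).intervalIntegrable
    rw [← h2, ← intervalIntegral.integral_const_mul, ← intervalIntegral.integral_const_mul,
      ← intervalIntegral.integral_add hi₁ hi₂]
    refine intervalIntegral.integral_congr fun τ hτ => ?_
    rw [uIcc_of_le ht] at hτ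
    simp only [hw τ hτ]
    ring
  have h3 : ∫ σ in (0 : ℝ)..t, (∫ τ in σ..t, s * cexp (-(s * τ))) * W σ =
      (∫ σ in (0 : ℝ)..t, W σ * cexp (-(s * σ))) - (∫ σ in (0 : ℝ)..t, W σ) * cexp (-(s * t)) := by
    rw [← intervalIntegral.integral_mul_const, ← intervalIntegral.integral_sub
      (hW.mul_continuousOn (Continuous.continuousOn (by fun_prop))) (hW.mul_const _)]
    refine intervalIntegral.integral_congr fun σ _ => ?_
    simp only [hexp]
    ring
  rw [h1, htri, h3, hw t (right_mem_Icc.2 ht)]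
  ring

/-! ### Mild solutions -/

/-- The right-hand side of the homogeneous delay equation. -/
noncomputable def delayRHS (N : ℕ) (a : ℝ) (ad : ℕ → ℝ) (h : ℝ) (y : ℝ → ℂ) (τ : ℝ) : ℂ :=
  a * y τ + ∑ j ∈ Finset.Icc 1 N, (ad j : ℂ) * y (τ - j * h)

/-- The integrated form of the homogeneous delay equation. -/
structure IsMildSolution (N : ℕ) (a : ℝ) (ad : ℕ → ℝ) (h : ℝ) (x₀ : ℂ) (φ y : ℝ → ℂ) : Prop where
  integrable : ∀ T, 0 ≤ T → IntervalIntegrable y volume (-(N * h)) T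
  eq : ∀ t, 0 ≤ t → y t = x₀ + ∫ τ in (0 : ℝ)..t, delayRHS N a ad h y τ
  preshape : ∀ τ, -(N * h) ≤ τ → τ < 0 → y τ = φ τ

/-- The transform `∑_j a_{jd} e^{-jsh} ∫_{-jh}^0 φ(τ) e^{-sτ} dτ` of the initial function. -/
noncomputable def initTransform (N : ℕ) (ad : ℕ → ℝ) (h : ℝ) (φ : ℝ → ℂ) (s : ℂ) : ℂ :=
  ∑ j ∈ Finset.Icc 1 N, (ad j : ℂ) * cexp (-((j : ℂ) * s * (h : ℂ))) *
    ∫ τ in (-(j * h : ℝ))..0, φ τ * cexp (-(s * τ))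

/-- The Laplace transform truncated at time `t`. -/
noncomputable def truncLaplace (y : ℝ → ℂ) (t : ℝ) (s : ℂ) : ℂ :=
  ∫ τ in (0 : ℝ)..t, y τ * cexp (-(s * τ))

/-- The contribution of the history of `y` on `[t - Nh, t]` to its future after time `t`. -/
noncomputable def historyTransform (N : ℕ) (ad : ℕ → ℝ) (h : ℝ) (y : ℝ → ℂ) (t : ℝ) (s : ℂ) : ℂ :=
  ∑ j ∈ Finset.Icc 1 N, (ad j : ℂ) *
    ∫ τ in (t - j * h)..t, y τ * cexp (-(s * (τ + j * h - t)))

theorem intervalIntegrable_delayRHS {N : ℕ} (a : ℝ) (ad : ℕ → ℝ) {h : ℝ} (hh : 0 < h) {y : ℝ → ℂ}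
    {T : ℝ} (hT : 0 ≤ T) (hy : IntervalIntegrable y volume (-(N * h)) T) :
    IntervalIntegrable (delayRHS N a ad h y) volume 0 T := by
  have hNh : 0 ≤ (N : ℝ) * h := by positivity
  have h1 : IntervalIntegrable y volume 0 T := hy.mono_set (by
    rw [uIcc_of_le hT, uIcc_of_le (by linarith)]
    exact Icc_subset_Icc_left (by linarith))
  refine (h1.const_mul _).add ?_
  have h2 : ∀ j ∈ Finset.Icc 1 N, IntervalIntegrable (fun τ => (ad j : ℂ) * y (τ - j * h))
      volume 0 T := by
    intro j hj
    have hjN : (j : ℝ) * h ≤ N * h :=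
      mul_le_mul_of_nonneg_right (by exact_mod_cast (Finset.mem_Icc.1 hj).2) hh.le
    have hj0 : 0 ≤ (j : ℝ) * h := by positivity
    have h3 : IntervalIntegrable y volume (-(j * h)) (T - j * h) := hy.mono_set (by
      rw [uIcc_of_le (by linarith), uIcc_of_le (by linarith)]
      exact Icc_subset_Icc (by linarith) (by linarith))
    have h4 := h3.comp_sub_right (j * h)
    simp only [neg_add_cancel, sub_add_cancel] at h4
    exact h4.const_mul _
  have h3 := IntervalIntegrable.sum (Finset.Icc 1 N) h2
  exact h3.congr (fun τ _ => by simp)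

theorem IsMildSolution.continuousOn {N : ℕ} {a : ℝ} {ad : ℕ → ℝ} {h : ℝ} (hh : 0 < h) {x₀ : ℂ}
    {φ y : ℝ → ℂ} (hy : IsMildSolution N a ad h x₀ φ y) (T : ℝ) : ContinuousOn y (Icc 0 T) := by
  rcases lt_or_ge T 0 with hT | hT
  · rw [Icc_eq_empty (not_le.2 hT)]; exact continuousOn_empty _
  have h1 := intervalIntegral.continuousOn_primitive_interval'
    (intervalIntegrable_delayRHS a ad hh hT (hy.integrable T hT)) left_mem_uIcc
  rw [uIcc_of_le hT] at h1
  exact (continuousOn_const.add h1).congr fun t ht => hy.eq t ht.1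

theorem IsMildSolution.exists_bound {N : ℕ} {a : ℝ} {ad : ℕ → ℝ} {h : ℝ} (hh : 0 < h) {x₀ : ℂ}
    {φ y : ℝ → ℂ} (hy : IsMildSolution N a ad h x₀ φ y) {B : ℝ}
    (hφ : ∀ τ, -(N * h) ≤ τ → τ < 0 → ‖φ τ‖ ≤ B) (T : ℝ) :
    ∃ M, 0 ≤ M ∧ ∀ τ ∈ Icc (-(N * h)) T, ‖y τ‖ ≤ M := by
  obtain ⟨M, hM⟩ := isCompact_Icc.exists_bound_of_continuousOn (hy.continuousOn hh T)
  refine ⟨max 0 (max B M), le_max_left _ _, fun τ hτ => ?_⟩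
  refine le_trans ?_ (le_max_right _ _)
  rcases lt_or_ge τ 0 with h0 | h0
  · rw [hy.preshape τ hτ.1 h0]
    exact (hφ τ hτ.1 h0).trans (le_max_left _ _)
  · exact (hM τ ⟨h0, hτ.2⟩).trans (le_max_right _ _)

/-- The truncated Laplace transform of a mild solution. -/
theorem IsMildSolution.charFun_mul_truncLaplace {N : ℕ} {a : ℝ} {ad : ℕ → ℝ} {h : ℝ} (hh : 0 < h)
    {x₀ : ℂ} {φ y : ℝ → ℂ} (hy : IsMildSolution N a ad h x₀ φ y) {t : ℝ} (ht : 0 ≤ t) (s : ℂ) :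
    charFun N a ad h s * truncLaplace y t s = x₀ + initTransform N ad h φ s -
      cexp (-(s * t)) * (y t + historyTransform N ad h y t s) := by
  have hD := intervalIntegrable_delayRHS a ad hh ht (hy.integrable t ht)
  have hparts := integral_mul_exp_of_primitive ht hD (fun τ hτ => hy.eq τ hτ.1) s
  have hint : ∀ A B : ℝ, -(N * h) ≤ A → A ≤ t → -(N * h) ≤ B → B ≤ t →
      IntervalIntegrable y volume A B := fun A B hA hA' hB hB' =>
    (hy.integrable t ht).mono_set (by
      rw [uIcc_of_le (a := -(N * h)) (b := t) (by linarith)]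
      exact uIcc_subset_Icc ⟨hA, hA'⟩ ⟨hB, hB'⟩)
  have hNh : 0 ≤ (N : ℝ) * h := by positivity
  have hj : ∀ j ∈ Finset.Icc 1 N, ∫ τ in (0 : ℝ)..t, y (τ - j * h) * cexp (-(s * τ)) =
      cexp (-((j : ℂ) * s * (h : ℂ))) * (∫ τ in (-(j * h : ℝ))..0, φ τ * cexp (-(s * τ))) +
        cexp (-((j : ℂ) * s * (h : ℂ))) * truncLaplace y t s -
        cexp (-(s * t)) * ∫ τ in (t - j * h)..t, y τ * cexp (-(s * (τ + j * h - t))) := by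
    intro j hj
    have hjN : (j : ℝ) * h ≤ N * h :=
      mul_le_mul_of_nonneg_right (by exact_mod_cast (Finset.mem_Icc.1 hj).2) hh.le
    have hj0 : 0 ≤ (j : ℝ) * h := by positivity
    have hc : ContinuousOn (fun τ : ℝ => cexp (-(s * τ))) univ :=
      Continuous.continuousOn (by fun_prop)
    have hI : ∀ A B : ℝ, -(N * h) ≤ A → A ≤ t → -(N * h) ≤ B → B ≤ t →
        IntervalIntegrable (fun τ => y τ * cexp (-(s * τ))) volume A B :=
      fun A B hA hA' hB hB' => (hint A B hA hA' hB hB').mul_continuousOn (hc.mono (subset_univ _))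
    have e1 : ∫ τ in (0 : ℝ)..t, y (τ - j * h) * cexp (-(s * τ)) =
        cexp (-((j : ℂ) * s * (h : ℂ))) *
          ∫ τ in (-(j * h : ℝ))..(t - j * h), y τ * cexp (-(s * τ)) := by
      rw [← zero_sub ((j : ℝ) * h), ← intervalIntegral.integral_comp_sub_right
        (fun τ => y τ * cexp (-(s * τ))) (j * h), ← intervalIntegral.integral_const_mul]
      refine intervalIntegral.integral_congr fun τ _ => ?_
      have : cexp (-(s * τ)) = cexp (-((j : ℂ) * s * (h : ℂ))) *
          cexp (-(s * ((τ - j * h : ℝ) : ℂ))) := by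
        rw [← Complex.exp_add]; congr 1; push_cast; ring
      rw [this]
      ring
    have e2 : ∫ τ in (-(j * h : ℝ))..0, y τ * cexp (-(s * τ)) =
        ∫ τ in (-(j * h : ℝ))..0, φ τ * cexp (-(s * τ)) := by
      refine intervalIntegral.integral_congr_ae ?_
      filter_upwards [Measure.ae_ne volume 0] with τ hτ hmem
      rw [uIoc_of_le (by linarith)] at hmem
      rw [hy.preshape τ (by linarith [hmem.1]) (lt_of_le_of_ne hmem.2 hτ)]
    have e3 : cexp (-(s * t)) * ∫ τ in (t - j * h)..t, y τ * cexp (-(s * (τ + j * h - t))) =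
        cexp (-((j : ℂ) * s * (h : ℂ))) * ∫ τ in (t - j * h)..t, y τ * cexp (-(s * τ)) := by
      rw [← intervalIntegral.integral_const_mul, ← intervalIntegral.integral_const_mul]
      refine intervalIntegral.integral_congr fun τ _ => ?_
      have : cexp (-(s * t)) * cexp (-(s * (τ + j * h - t))) =
          cexp (-((j : ℂ) * s * (h : ℂ))) * cexp (-(s * τ)) := by
        rw [← Complex.exp_add, ← Complex.exp_add]; congr 1; ring
      linear_combination (y τ) * this
    -- Both sides are the integral over `[-jh, t]`, split at `t - jh` and at `0`; either split point
    -- may be the larger.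
    have e4 : (∫ τ in (-(j * h : ℝ))..(t - j * h), y τ * cexp (-(s * τ))) +
        ∫ τ in (t - j * h)..t, y τ * cexp (-(s * τ)) =
        (∫ τ in (-(j * h : ℝ))..0, y τ * cexp (-(s * τ))) + truncLaplace y t s := by
      rw [truncLaplace, intervalIntegral.integral_add_adjacent_intervals
        (hI _ _ (by linarith) (by linarith) (by linarith) (by linarith))
        (hI _ _ (by linarith) (by linarith) (by linarith) le_rfl),
        intervalIntegral.integral_add_adjacent_intervals
        (hI _ _ (by linarith) (by linarith) (by linarith) ht)
        (hI _ _ (by linarith) ht (by linarith) le_rfl)]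
    rw [e1, e3, ← e2]
    linear_combination (cexp (-((j : ℂ) * s * (h : ℂ)))) * e4
  have hshift : ∀ j ∈ Finset.Icc 1 N, IntervalIntegrable
      (fun τ => (ad j : ℂ) * (y (τ - j * h) * cexp (-(s * τ)))) volume 0 t := by
    intro j hj
    have hjN : (j : ℝ) * h ≤ N * h :=
      mul_le_mul_of_nonneg_right (by exact_mod_cast (Finset.mem_Icc.1 hj).2) hh.le
    have hj0 : 0 ≤ (j : ℝ) * h := by positivity
    have h4 := (hint (-(j * h)) (t - j * h) (by linarith) (by linarith) (by linarith)
      (by linarith)).comp_sub_right (j * h)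
    simp only [neg_add_cancel, sub_add_cancel] at h4
    exact (h4.mul_continuousOn (Continuous.continuousOn (by fun_prop))).const_mul _
  have hleft : ∫ τ in (0 : ℝ)..t, delayRHS N a ad h y τ * cexp (-(s * τ)) =
      a * truncLaplace y t s + ∑ j ∈ Finset.Icc 1 N, (ad j : ℂ) *
        ∫ τ in (0 : ℝ)..t, y (τ - j * h) * cexp (-(s * τ)) := by
    have h0 : IntervalIntegrable (fun τ => (a : ℂ) * (y τ * cexp (-(s * τ)))) volume 0 t :=
      ((hint 0 t (by linarith) ht (by linarith) le_rfl).mul_continuousOn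
        (Continuous.continuousOn (by fun_prop))).const_mul _
    simp_rw [truncLaplace, ← intervalIntegral.integral_const_mul]
    rw [← intervalIntegral.integral_finsetSum hshift, ← intervalIntegral.integral_add h0
      ((IntervalIntegrable.sum _ hshift).congr (fun τ _ => by simp))]
    refine intervalIntegral.integral_congr fun τ _ => ?_
    simp only [delayRHS, add_mul, Finset.sum_mul, mul_assoc]
  rw [hleft, Finset.sum_congr rfl fun j hj' => congrArg _ (hj j hj')] at hparts
  have hsum : ∑ j ∈ Finset.Icc 1 N, (ad j : ℂ) *
      (cexp (-((j : ℂ) * s * (h : ℂ))) * (∫ τ in (-(j * h : ℝ))..0, φ τ * cexp (-(s * τ))) +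
        cexp (-((j : ℂ) * s * (h : ℂ))) * truncLaplace y t s -
        cexp (-(s * t)) * ∫ τ in (t - j * h)..t, y τ * cexp (-(s * (τ + j * h - t)))) =
      initTransform N ad h φ s + (∑ j ∈ Finset.Icc 1 N, (ad j : ℂ) *
        cexp (-((j : ℂ) * s * (h : ℂ)))) * truncLaplace y t s -
        cexp (-(s * t)) * historyTransform N ad h y t s := by
    rw [initTransform, historyTransform, Finset.sum_mul, Finset.mul_sum, ← Finset.sum_add_distrib,
      ← Finset.sum_sub_distrib]
    exact Finset.sum_congr rfl fun j _ => by ring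
  rw [hsum] at hparts
  rw [charFun]
  simp only [truncLaplace] at hparts ⊢
  linear_combination -hparts

/-! ### The fundamental solution -/

/-- The method of steps for the fundamental solution. -/
noncomputable def fundamentalIter (N : ℕ) (a : ℝ) (ad : ℕ → ℝ) (h : ℝ) : ℕ → ℝ → ℂ
  | 0 => fun _ => 0
  | n + 1 => fun t => if t < 0 then 0 else cexp (a * t) * (1 + ∫ τ in (0 : ℝ)..t,
      (∑ j ∈ Finset.Icc 1 N, (ad j : ℂ) * fundamentalIter N a ad h n (τ - j * h)) *
        cexp (-(a * τ)))

theorem fundamentalIter_succ (N : ℕ) (a : ℝ) (ad : ℕ → ℝ) (h : ℝ) (n : ℕ) (t : ℝ) :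
    fundamentalIter N a ad h (n + 1) t =
      if t < 0 then 0 else cexp (a * t) * (1 + ∫ τ in (0 : ℝ)..t,
        (∑ j ∈ Finset.Icc 1 N, (ad j : ℂ) * fundamentalIter N a ad h n (τ - j * h)) *
          cexp (-(a * τ))) := rfl

/-- The fundamental solution, complex valued. -/
noncomputable def fundamentalSol (N : ℕ) (a : ℝ) (ad : ℕ → ℝ) (h : ℝ) (t : ℝ) : ℂ :=
  fundamentalIter N a ad h (⌊t / h⌋₊ + 1) t

theorem intervalIntegrable_fundamentalIter (N : ℕ) (a : ℝ) (ad : ℕ → ℝ) (h : ℝ) (n : ℕ) :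
    ∀ A B : ℝ, IntervalIntegrable (fundamentalIter N a ad h n) volume A B := by
  induction n with
  | zero => exact fun A B => by simp [fundamentalIter]
  | succ n ih =>
    intro A B
    set W : ℝ → ℂ := fun τ => (∑ j ∈ Finset.Icc 1 N,
      (ad j : ℂ) * fundamentalIter N a ad h n (τ - j * h)) * cexp (-(a * τ)) with hW
    have hWi : ∀ A B : ℝ, IntervalIntegrable W volume A B := by
      intro A B
      refine IntervalIntegrable.mul_continuousOn ?_ (Continuous.continuousOn (by fun_prop))
      refine (IntervalIntegrable.sum (Finset.Icc 1 N) (f := fun j τ =>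
        (ad j : ℂ) * fundamentalIter N a ad h n (τ - j * h)) fun j _ => ?_).congr
          (fun τ _ => by simp)
      have := (ih (A - j * h) (B - j * h)).comp_sub_right (j * h)
      simp only [sub_add_cancel] at this
      exact this.const_mul _
    have hc : Continuous fun t : ℝ => cexp (a * t) * (1 + ∫ τ in (0 : ℝ)..t, W τ) := by
      have := intervalIntegral.continuous_primitive hWi 0
      fun_prop
    have he : fundamentalIter N a ad h (n + 1) =
        indicator (Ici 0) fun t : ℝ => cexp (a * t) * (1 + ∫ τ in (0 : ℝ)..t, W τ) := by
      funext t
      by_cases ht : t < 0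
      · simp [fundamentalIter, ht]
      · simp [fundamentalIter, ht, not_lt.1 ht, hW]
    rw [he, intervalIntegrable_iff]
    exact (intervalIntegrable_iff.1 (hc.intervalIntegrable A B)).indicator measurableSet_Ici

/-- Every delay is at least `h`, so an iterate correct before `nh` determines the next one before
`(n+1)h`. The start `0` is correct for negative times. -/
theorem fundamentalIter_succ_eq {N : ℕ} (a : ℝ) (ad : ℕ → ℝ) {h : ℝ} (hh : 0 < h) (n : ℕ) :
    ∀ t : ℝ, t < n * h → fundamentalIter N a ad h (n + 1) t = fundamentalIter N a ad h n t := by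
  induction n with
  | zero =>
    intro t ht
    have : t < 0 := by simpa using ht
    simp [fundamentalIter, this]
  | succ n ih =>
    intro t ht
    rw [fundamentalIter_succ, fundamentalIter_succ]
    split_ifs with h0
    · rfl
    · congr 2
      refine intervalIntegral.integral_congr fun τ hτ => ?_
      rw [uIcc_of_le (not_lt.1 h0)] at hτ
      congr 1
      refine Finset.sum_congr rfl fun j hj => ?_
      rw [ih]
      have hj1 : (1 : ℝ) ≤ j := by exact_mod_cast (Finset.mem_Icc.1 hj).1
      push_cast at ht
      nlinarith [hτ.2]

theorem fundamentalIter_eq {N : ℕ} (a : ℝ) (ad : ℕ → ℝ) {h : ℝ} (hh : 0 < h) {n : ℕ} {t : ℝ}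
    (ht : t < n * h) : fundamentalIter N a ad h n t = fundamentalSol N a ad h t := by
  have hmono : ∀ n k : ℕ, t < n * h →
      fundamentalIter N a ad h (n + k) t = fundamentalIter N a ad h n t := by
    intro n k ht
    induction k with
    | zero => rfl
    | succ k ih =>
      rw [← ih, ← add_assoc, fundamentalIter_succ_eq a ad hh]
      refine ht.trans_le (mul_le_mul_of_nonneg_right ?_ hh.le)
      push_cast
      linarith [(Nat.cast_nonneg k : (0 : ℝ) ≤ k)]
  have hfl : t < ((⌊t / h⌋₊ + 1 : ℕ) : ℝ) * h := by
    have := Nat.lt_floor_add_one (t / h)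
    rw [div_lt_iff₀ hh] at this
    exact_mod_cast this
  rw [fundamentalSol]
  rcases le_total n (⌊t / h⌋₊ + 1) with hle | hle
  · obtain ⟨k, hk⟩ := Nat.exists_eq_add_of_le hle
    rw [hk, hmono n k ht]
  · obtain ⟨k, hk⟩ := Nat.exists_eq_add_of_le hle
    rw [hk, hmono _ k hfl]

theorem fundamentalSol_of_neg (N : ℕ) (a : ℝ) (ad : ℕ → ℝ) (h : ℝ) {t : ℝ} (ht : t < 0) :
    fundamentalSol N a ad h t = 0 := by
  simp [fundamentalSol, fundamentalIter, ht]

theorem intervalIntegrable_fundamentalSol (N : ℕ) (a : ℝ) (ad : ℕ → ℝ) {h : ℝ} (hh : 0 < h)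
    (A B : ℝ) : IntervalIntegrable (fundamentalSol N a ad h) volume A B := by
  have hn := Nat.lt_floor_add_one (max A B / h)
  rw [div_lt_iff₀ hh] at hn
  refine (intervalIntegrable_fundamentalIter N a ad h (⌊max A B / h⌋₊ + 1) A B).congr
    fun τ hτ => fundamentalIter_eq a ad hh ?_
  refine lt_of_le_of_lt ?_ (by exact_mod_cast hn)
  rw [uIoc] at hτ
  exact hτ.2

/-- The method of steps yields a mild solution. -/
theorem isMildSolution_fundamentalSol (N : ℕ) (a : ℝ) (ad : ℕ → ℝ) {h : ℝ} (hh : 0 < h) :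
    IsMildSolution N a ad h 1 (fun _ => 0) (fundamentalSol N a ad h) where
  integrable T _ := intervalIntegrable_fundamentalSol N a ad hh _ T
  preshape τ _ hτ := fundamentalSol_of_neg N a ad h hτ
  eq t ht := by
    set Ψ := fundamentalSol N a ad h with hΨ
    set q : ℝ → ℂ := fun τ => ∑ j ∈ Finset.Icc 1 N, (ad j : ℂ) * Ψ (τ - j * h) with hq
    have hΨi := intervalIntegrable_fundamentalSol N a ad hh
    have hqi : IntervalIntegrable q volume 0 t := by
      refine (IntervalIntegrable.sum (Finset.Icc 1 N) (f := fun j τ =>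
        (ad j : ℂ) * Ψ (τ - j * h)) fun j _ => ?_).congr (fun τ _ => by simp [hq])
      have := (hΨi (0 - j * h) (t - j * h)).comp_sub_right (j * h)
      simp only [sub_add_cancel] at this
      exact this.const_mul _
    have hWi : IntervalIntegrable (fun τ => q τ * cexp (-(a * τ))) volume 0 t :=
      hqi.mul_continuousOn (Continuous.continuousOn (by fun_prop))
    have hstep : ∀ τ ∈ Icc 0 t, Ψ τ * cexp (-(a * τ)) =
        1 + ∫ σ in (0 : ℝ)..τ, q σ * cexp (-(a * σ)) := by
      intro τ hτ
      have hn := Nat.lt_floor_add_one (τ / h)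
      rw [div_lt_iff₀ hh] at hn
      have h1 : τ < ((⌊τ / h⌋₊ + 1 : ℕ) : ℝ) * h := by exact_mod_cast hn
      have h2 : τ < ((⌊τ / h⌋₊ + 1 + 1 : ℕ) : ℝ) * h := by
        refine h1.trans_le (mul_le_mul_of_nonneg_right ?_ hh.le)
        push_cast; linarith
      rw [hΨ, ← fundamentalIter_eq a ad hh h2, fundamentalIter_succ, if_neg (not_lt.2 hτ.1),
        mul_comm, ← mul_assoc, ← Complex.exp_add, neg_add_cancel, Complex.exp_zero, one_mul]
      congr 1
      refine intervalIntegral.integral_congr fun σ hσ => ?_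
      rw [uIcc_of_le hτ.1] at hσ
      simp only [hq]
      congr 1
      refine Finset.sum_congr rfl fun j _ => ?_
      rw [fundamentalIter_eq a ad hh]
      have : 0 ≤ (j : ℝ) * h := by positivity
      linarith [hσ.2]
    -- With exponent `-a` the formula undoes the integrating factor `e^{-at}` and returns the
    -- integrated equation.
    have hparts := integral_mul_exp_of_primitive ht hWi hstep (-a)
    have hcancel : ∀ (z : ℂ) (τ : ℝ), z * cexp (-(a * τ)) * cexp (-(-(a : ℂ) * τ)) = z := by
      intro z τ
      rw [mul_assoc, ← Complex.exp_add]
      simp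
    simp only [hcancel] at hparts
    have hsplit : ∫ τ in (0 : ℝ)..t, delayRHS N a ad h Ψ τ =
        a * (∫ τ in (0 : ℝ)..t, Ψ τ) + ∫ τ in (0 : ℝ)..t, q τ := by
      rw [← intervalIntegral.integral_const_mul,
        ← intervalIntegral.integral_add ((hΨi 0 t).const_mul _) hqi]
      rfl
    rw [hsplit]
    linear_combination -hparts

theorem measurable_fundamentalSol (N : ℕ) (a : ℝ) (ad : ℕ → ℝ) {h : ℝ} (hh : 0 < h) :
    Measurable (fundamentalSol N a ad h) := by
  classical
  have hc : ContinuousOn (fundamentalSol N a ad h) (Ici 0) := by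
    intro t ht
    have h1 := (isMildSolution_fundamentalSol N a ad hh).continuousOn hh (t + 1) t
      ⟨ht, by linarith⟩
    refine h1.mono_of_mem_nhdsWithin ?_
    rw [← Ici_inter_Iic]
    exact inter_mem_nhdsWithin _ (Iic_mem_nhds (by linarith))
  have h1 := ContinuousOn.measurable_piecewise (s := Ici (0 : ℝ)) hc
    (continuousOn_const (c := (0 : ℂ))) measurableSet_Ici
  convert h1 using 1
  funext t
  by_cases ht : 0 ≤ t
  · simp [Set.piecewise, ht]
  · simp [Set.piecewise, ht, fundamentalSol_of_neg N a ad h (not_le.1 ht)]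

theorem exists_bound_fundamentalSol (N : ℕ) (a : ℝ) (ad : ℕ → ℝ) {h : ℝ} (hh : 0 < h) (T : ℝ) :
    ∃ M, 0 ≤ M ∧ ∀ τ ≤ T, ‖fundamentalSol N a ad h τ‖ ≤ M := by
  obtain ⟨M, hM0, hM⟩ := (isMildSolution_fundamentalSol N a ad hh).exists_bound hh (B := 0)
    (fun τ _ _ => by simp) T
  refine ⟨M, hM0, fun τ hτ => ?_⟩
  rcases lt_or_ge τ 0 with h0 | h0
  · rw [fundamentalSol_of_neg N a ad h h0, norm_zero]; exact hM0
  · have : 0 ≤ (N : ℝ) * h := by positivity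
    exact hM τ ⟨by linarith, hτ⟩

/-! ### Variation of constants -/

/-- The response to the input `f` with zero initial data. -/
noncomputable def forcedResponse (N : ℕ) (a : ℝ) (ad : ℕ → ℝ) (h : ℝ) (f : ℝ → ℂ) (t : ℝ) : ℂ :=
  if t < 0 then 0 else ∫ σ in (0 : ℝ)..t, fundamentalSol N a ad h (t - σ) * f σ

theorem integrableOn_bounded_kernel {k : ℝ → ℂ} (hk : Measurable k)
    (hb : ∀ T, ∃ M, ∀ τ ≤ T, ‖k τ‖ ≤ M) {f : ℝ → ℂ} {t : ℝ} (ht : 0 ≤ t)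
    (hf : IntervalIntegrable f volume 0 t) :
    IntegrableOn (Function.uncurry fun τ σ => k (τ - σ) * f σ) (Ι 0 t ×ˢ Ι 0 t) := by
  obtain ⟨M, hM⟩ := hb t
  exact integrableOn_kernel_mul (k := fun q => k (q.1 - q.2)) (M := M) ht
    (hk.comp (measurable_fst.sub measurable_snd))
    (fun τ hτ σ hσ => hM _ (by linarith [hτ.2, hσ.1])) hf

theorem intervalIntegrable_bounded_kernel {k : ℝ → ℂ} (hk : Measurable k)
    (hb : ∀ T, ∃ M, ∀ τ ≤ T, ‖k τ‖ ≤ M) {f : ℝ → ℂ} {t : ℝ} (ht : 0 ≤ t)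
    (hf : IntervalIntegrable f volume 0 t) (τ : ℝ) :
    IntervalIntegrable (fun σ => k (τ - σ) * f σ) volume 0 t := by
  obtain ⟨M, hM⟩ := hb τ
  rw [intervalIntegrable_iff_integrableOn_Ioc_of_le ht] at hf ⊢
  refine Integrable.bdd_mul (c := M) hf
    (hk.comp (measurable_const.sub measurable_id)).aestronglyMeasurable ?_
  filter_upwards [ae_restrict_mem measurableSet_Ioc] with σ hσ
  exact hM _ (by linarith [hσ.1])

theorem exists_bound_fundamentalSol' (N : ℕ) (a : ℝ) (ad : ℕ → ℝ) {h : ℝ} (hh : 0 < h) (T : ℝ) :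
    ∃ M, ∀ τ ≤ T, ‖fundamentalSol N a ad h τ‖ ≤ M :=
  let ⟨M, _, hM⟩ := exists_bound_fundamentalSol N a ad hh T
  ⟨M, hM⟩

/-- `Ψ` vanishes at negative times, so the upper limit may be frozen at `t`. The convolution then
lives on a fixed square, where Fubini applies. -/
theorem forcedResponse_eq (N : ℕ) (a : ℝ) (ad : ℕ → ℝ) {h : ℝ} (hh : 0 < h) {f : ℝ → ℂ} {t : ℝ}
    (ht : 0 ≤ t) (hf : IntervalIntegrable f volume 0 t) {τ : ℝ} (hτ : τ ≤ t) :
    forcedResponse N a ad h f τ = ∫ σ in (0 : ℝ)..t, fundamentalSol N a ad h (τ - σ) * f σ := by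
  have hi := intervalIntegrable_bounded_kernel (measurable_fundamentalSol N a ad hh)
    (exists_bound_fundamentalSol' N a ad hh) ht hf τ
  have hzero : ∀ σ, τ < σ → fundamentalSol N a ad h (τ - σ) * f σ = 0 := fun σ hσ => by
    rw [fundamentalSol_of_neg N a ad h (by linarith), zero_mul]
  rw [forcedResponse]
  split_ifs with h0
  · symm
    rw [intervalIntegral.integral_of_le ht]
    refine setIntegral_eq_zero_of_forall_eq_zero fun σ hσ => hzero σ (by linarith [hσ.1])
  · have h0' := not_lt.1 h0
    have h1 := hi.mono_set (c := 0) (d := τ) (by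
      rw [uIcc_of_le h0', uIcc_of_le ht]; exact Icc_subset_Icc_right hτ)
    have h2 := hi.mono_set (c := τ) (d := t) (by
      rw [uIcc_of_le hτ, uIcc_of_le ht]; exact Icc_subset_Icc_left h0')
    rw [← intervalIntegral.integral_add_adjacent_intervals h1 h2]
    have : ∫ σ in τ..t, fundamentalSol N a ad h (τ - σ) * f σ = 0 := by
      rw [intervalIntegral.integral_of_le hτ]
      exact setIntegral_eq_zero_of_forall_eq_zero fun σ hσ => hzero σ hσ.1
    rw [this, add_zero]

theorem intervalIntegrable_forcedResponse {N : ℕ} (a : ℝ) (ad : ℕ → ℝ) {h : ℝ} (hh : 0 < h)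
    {f : ℝ → ℂ} {t : ℝ} (ht : 0 ≤ t) (hf : IntervalIntegrable f volume 0 t) :
    IntervalIntegrable (forcedResponse N a ad h f) volume (-(N * h)) t := by
  have hNh : 0 ≤ (N : ℝ) * h := by positivity
  have h1 : IntervalIntegrable (forcedResponse N a ad h f) volume 0 t := by
    have h2 := integrableOn_bounded_kernel (measurable_fundamentalSol N a ad hh)
      (exists_bound_fundamentalSol' N a ad hh) ht hf
    rw [uIoc_of_le ht, IntegrableOn, Measure.volume_eq_prod, ← Measure.prod_restrict] at h2
    have h3 := h2.integral_prod_left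
    rw [intervalIntegrable_iff_integrableOn_Ioc_of_le ht]
    refine h3.congr ?_
    filter_upwards [ae_restrict_mem measurableSet_Ioc] with τ hτ
    rw [forcedResponse_eq N a ad hh ht hf hτ.2, intervalIntegral.integral_of_le ht]
    rfl
  have h4 : IntervalIntegrable (forcedResponse N a ad h f) volume (-(N * h)) 0 := by
    refine (intervalIntegrable_const (c := (0 : ℂ))).congr_ae ?_
    rw [uIoc_of_le (by linarith)]
    filter_upwards [ae_restrict_mem measurableSet_Ioc,
      ae_restrict_of_ae (Measure.ae_ne volume (0 : ℝ))] with τ hτ hne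
    rw [forcedResponse, if_pos (lt_of_le_of_ne hτ.2 hne)]
  exact h4.trans h1

/-- The forced response solves the integrated equation with zero initial data. -/
theorem forcedResponse_integral_eq {N : ℕ} (a : ℝ) (ad : ℕ → ℝ) {h : ℝ} (hh : 0 < h)
    {f : ℝ → ℂ} {t : ℝ} (ht : 0 ≤ t) (hf : IntervalIntegrable f volume 0 t) :
    forcedResponse N a ad h f t = (∫ σ in (0 : ℝ)..t, f σ) +
      ∫ τ in (0 : ℝ)..t, delayRHS N a ad h (forcedResponse N a ad h f) τ := by
  set Ψ := fundamentalSol N a ad h with hΨ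
  set D := delayRHS N a ad h Ψ with hD
  have hΨm : Measurable Ψ := measurable_fundamentalSol N a ad hh
  have hDm : Measurable D := by
    have h1 : Measurable fun τ => ∑ j ∈ Finset.Icc 1 N, (ad j : ℂ) * Ψ (τ - j * h) :=
      Finset.measurable_fun_sum _ fun j _ =>
        (hΨm.comp (measurable_id.sub_const _)).const_mul _
    exact (hΨm.const_mul _).add h1
  have hDneg : ∀ τ < 0, D τ = 0 := by
    intro τ hτ
    simp only [hD, delayRHS]
    rw [hΨ, fundamentalSol_of_neg N a ad h hτ, mul_zero, zero_add]
    refine Finset.sum_eq_zero fun j _ => ?_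
    have : 0 ≤ (j : ℝ) * h := by positivity
    rw [fundamentalSol_of_neg N a ad h (by linarith), mul_zero]
  have hDb : ∀ T, ∃ M, ∀ τ ≤ T, ‖D τ‖ ≤ M := by
    intro T
    obtain ⟨M, hM0, hM⟩ := exists_bound_fundamentalSol N a ad hh T
    refine ⟨|a| * M + ∑ j ∈ Finset.Icc 1 N, |ad j| * M, fun τ hτ => ?_⟩
    refine (norm_add_le _ _).trans (add_le_add ?_ ((norm_sum_le _ _).trans
      (Finset.sum_le_sum fun j _ => ?_)))
    · rw [norm_mul, Complex.norm_real, Real.norm_eq_abs]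
      exact mul_le_mul_of_nonneg_left (hM τ hτ) (abs_nonneg _)
    · rw [norm_mul, Complex.norm_real, Real.norm_eq_abs]
      have : 0 ≤ (j : ℝ) * h := by positivity
      exact mul_le_mul_of_nonneg_left (hM _ (by linarith)) (abs_nonneg _)
  have hDi : ∀ A B : ℝ, IntervalIntegrable D volume A B := by
    intro A B
    have hΨi := intervalIntegrable_fundamentalSol N a ad hh
    refine ((hΨi A B).const_mul _).add ((IntervalIntegrable.sum (Finset.Icc 1 N) (f := fun j τ =>
        (ad j : ℂ) * Ψ (τ - j * h)) fun j _ => ?_).congr (fun τ _ => by simp))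
    have := (hΨi (A - j * h) (B - j * h)).comp_sub_right (j * h)
    simp only [sub_add_cancel] at this
    exact this.const_mul _
  have hker : ∀ τ, IntervalIntegrable (fun σ => Ψ (τ - σ) * f σ) volume 0 t :=
    intervalIntegrable_bounded_kernel hΨm (exists_bound_fundamentalSol' N a ad hh) ht hf
  have h1 : ∀ τ ∈ uIcc 0 t, delayRHS N a ad h (forcedResponse N a ad h f) τ =
      ∫ σ in (0 : ℝ)..t, D (τ - σ) * f σ := by
    intro τ hτ
    rw [uIcc_of_le ht] at hτ
    rw [delayRHS, forcedResponse_eq N a ad hh ht hf hτ.2]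
    have h2 : ∀ j ∈ Finset.Icc 1 N, (ad j : ℂ) * forcedResponse N a ad h f (τ - j * h) =
        ∫ σ in (0 : ℝ)..t, (ad j : ℂ) * (Ψ (τ - j * h - σ) * f σ) := by
      intro j _
      have : 0 ≤ (j : ℝ) * h := by positivity
      rw [forcedResponse_eq N a ad hh ht hf (by linarith [hτ.2]),
        intervalIntegral.integral_const_mul]
    rw [Finset.sum_congr rfl h2, ← intervalIntegral.integral_finsetSum
      (fun j _ => (hker _).const_mul _), ← intervalIntegral.integral_const_mul,
      ← intervalIntegral.integral_add ((hker τ).const_mul _) ((IntervalIntegrable.sum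
        (Finset.Icc 1 N) (f := fun j σ => (ad j : ℂ) * (Ψ (τ - j * h - σ) * f σ))
        fun j _ => (hker _).const_mul _).congr (fun τ _ => by simp))]
    refine intervalIntegral.integral_congr fun σ _ => ?_
    simp only [hD, delayRHS, add_mul, Finset.sum_mul, mul_assoc, sub_right_comm]
  -- The integrated equation for `Ψ` evaluates the inner integral; its initial value `1` produces
  -- the term `∫ f`.
  have h2 : ∀ σ ∈ uIcc 0 t, ∫ τ in (0 : ℝ)..t, D (τ - σ) * f σ = (Ψ (t - σ) - 1) * f σ := by
    intro σ hσ
    rw [uIcc_of_le ht] at hσ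
    rw [intervalIntegral.integral_mul_const, intervalIntegral.integral_comp_sub_right, zero_sub,
      ← intervalIntegral.integral_add_adjacent_intervals (hDi (-σ) 0) (hDi 0 (t - σ))]
    have h3 : ∫ τ in (-σ)..0, D τ = 0 := by
      rw [intervalIntegral.integral_congr_ae (g := fun _ => 0)]
      · simp
      · filter_upwards [Measure.ae_ne volume (0 : ℝ)] with τ hτ hmem
        rw [uIoc_of_le (by linarith [hσ.1])] at hmem
        exact hDneg τ (lt_of_le_of_ne hmem.2 hτ)
    have h4 := (isMildSolution_fundamentalSol N a ad hh).eq (t - σ) (by linarith [hσ.2])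
    rw [h3, zero_add, hΨ, h4]
    ring
  rw [intervalIntegral.integral_congr h1, intervalIntegral_intervalIntegral_swap
    (integrableOn_bounded_kernel hDm hDb ht hf), intervalIntegral.integral_congr h2,
    ← intervalIntegral.integral_add hf (((hker t).sub hf).congr fun σ _ => by ring),
    forcedResponse_eq N a ad hh ht hf le_rfl]
  refine intervalIntegral.integral_congr fun σ _ => ?_
  ring

/-! ### From solutions almost everywhere to mild solutions -/

theorem intervalIntegrable_ofReal {u : ℝ → ℝ} {A B : ℝ} (hu : IntervalIntegrable u volume A B) :
    IntervalIntegrable (fun t => (u t : ℂ)) volume A B :=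
  ⟨hu.1.ofReal, hu.2.ofReal⟩

theorem integral_eq_of_absCont {x F : ℝ → ℝ}
    (hx : ∀ T : ℝ, 0 < T → AbsolutelyContinuousOnInterval x 0 T)
    (hd : ∀ᵐ t : ℝ, 0 < t → HasDerivAt x (F t) t) {t : ℝ} (ht : 0 < t) :
    IntervalIntegrable F volume 0 t ∧ x t = x 0 + ∫ τ in (0 : ℝ)..t, F τ := by
  have hae : ∀ᵐ τ : ℝ, τ ∈ Ι 0 t → deriv x τ = F τ := by
    filter_upwards [hd] with τ hτ hmem
    rw [uIoc_of_le ht.le] at hmem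
    exact (hτ hmem.1).deriv
  refine ⟨(hx t ht).intervalIntegrable_deriv.congr_ae
    ((ae_restrict_iff' measurableSet_uIoc).2 hae), ?_⟩
  rw [← intervalIntegral.integral_congr_ae hae, (hx t ht).integral_deriv_eq_sub]
  ring

/-- Subtracting the forced response from a solution leaves a homogeneous mild solution. -/
theorem IsSolution.isMildSolution_sub {N : ℕ} {a : ℝ} {ad : ℕ → ℝ} {b h x₀ : ℝ} {φ u x : ℝ → ℝ}
    (hx : IsSolution N a ad b h x₀ φ u x) (hh : 0 < h)
    (hφ : ContinuousOn φ (Icc (-((N : ℝ) * h)) 0))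
    (hu : ∀ T : ℝ, 0 < T → IntervalIntegrable u volume 0 T) :
    IsMildSolution N a ad h x₀ (fun τ => (φ τ : ℂ))
      (fun t => (x t : ℂ) - forcedResponse N a ad h (fun τ => (b : ℂ) * u τ) t) := by
  have hNh : 0 ≤ (N : ℝ) * h := by positivity
  have hf : ∀ T : ℝ, 0 ≤ T → IntervalIntegrable (fun τ => (b : ℂ) * u τ) volume 0 T := by
    intro T hT
    have hT' := (hu (T + 1) (by linarith)).mono_set (c := 0) (d := T) (by
      rw [uIcc_of_le hT, uIcc_of_le (by linarith)]; exact Icc_subset_Icc_right (by linarith))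
    exact (intervalIntegrable_ofReal hT').const_mul _
  have hxi : ∀ T : ℝ, 0 ≤ T → IntervalIntegrable (fun t => (x t : ℂ)) volume (-(N * h)) T := by
    intro T hT
    have h1 : IntervalIntegrable x volume 0 T := by
      have := (hx.absCont (T + 1) (by linarith)).continuousOn
      refine (this.mono ?_).intervalIntegrable
      rw [uIcc_of_le hT, uIcc_of_le (by linarith)]
      exact Icc_subset_Icc_right (by linarith)
    have h2 : IntervalIntegrable x volume (-(N * h)) 0 := by
      have h3 : IntervalIntegrable φ volume (-(N * h)) 0 :=
        ContinuousOn.intervalIntegrable (by rwa [uIcc_of_le (by linarith)])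
      refine h3.congr_ae ?_
      rw [uIoc_of_le (by linarith)]
      filter_upwards [ae_restrict_mem measurableSet_Ioc,
        ae_restrict_of_ae (Measure.ae_ne volume (0 : ℝ))] with τ hτ hne
      exact (hx.preshape τ hτ.1.le (lt_of_le_of_ne hτ.2 hne)).symm
    exact intervalIntegrable_ofReal (h2.trans h1)
  refine ⟨fun T hT => (hxi T hT).sub (intervalIntegrable_forcedResponse a ad hh hT (hf T hT)),
    fun t ht => ?_, fun τ hτ hτ0 => ?_⟩
  · have hxt : (x t : ℂ) = x₀ + ∫ τ in (0 : ℝ)..t,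
        (delayRHS N a ad h (fun t => (x t : ℂ)) τ + (b : ℂ) * u τ) := by
      rcases ht.eq_or_lt with h0 | h0
      · simp [← h0, hx.init]
      · obtain ⟨-, h2⟩ := integral_eq_of_absCont hx.absCont hx.hasDeriv h0
        rw [h2, hx.init]
        push_cast
        rw [← intervalIntegral.integral_ofReal]
        congr 1
        refine intervalIntegral.integral_congr fun τ _ => ?_
        simp [delayRHS]
    have hxr := intervalIntegrable_delayRHS a ad hh ht (hxi t ht)
    have hzr := intervalIntegrable_delayRHS a ad hh ht
      (intervalIntegrable_forcedResponse (N := N) a ad hh ht (hf t ht))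
    have hsub : ∫ τ in (0 : ℝ)..t, delayRHS N a ad h (fun t => (x t : ℂ) -
        forcedResponse N a ad h (fun τ => (b : ℂ) * u τ) t) τ =
        (∫ τ in (0 : ℝ)..t, delayRHS N a ad h (fun t => (x t : ℂ)) τ) -
        ∫ τ in (0 : ℝ)..t, delayRHS N a ad h
          (forcedResponse N a ad h (fun τ => (b : ℂ) * u τ)) τ := by
      rw [← intervalIntegral.integral_sub hxr hzr]
      refine intervalIntegral.integral_congr fun τ _ => ?_
      simp only [delayRHS, mul_sub, Finset.sum_sub_distrib]
      ring
    rw [hsub, hxt, intervalIntegral.integral_add hxr (hf t ht),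
      forcedResponse_integral_eq a ad hh ht (hf t ht)]
    ring
  · simp [forcedResponse, hτ0, hx.preshape τ hτ hτ0]

theorem IsFundamentalSolution.isSolution {N : ℕ} {a : ℝ} {ad : ℕ → ℝ} {h : ℝ} {Ψ : ℝ → ℝ}
    (hΨ : IsFundamentalSolution N a ad h Ψ) :
    IsSolution N a ad 0 h 1 (fun _ => 0) (fun _ => 0) Ψ where
  absCont := hΨ.absCont
  hasDeriv := by simpa using hΨ.hasDeriv
  init := hΨ.init
  preshape τ _ hτ := hΨ.zero_of_neg τ hτ

theorem IsFundamentalSolution.isMildSolution {N : ℕ} {a : ℝ} {ad : ℕ → ℝ} {h : ℝ} {Ψ : ℝ → ℝ}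
    (hΨ : IsFundamentalSolution N a ad h Ψ) (hh : 0 < h) :
    IsMildSolution N a ad h 1 (fun _ => 0) (fun t => (Ψ t : ℂ)) := by
  have := hΨ.isSolution.isMildSolution_sub hh continuousOn_const (fun T _ => by simp)
  simpa [forcedResponse] using this

/-! ### Truncated transforms -/

/-- Transforms over a bounded interval are entire; this is why the truncated Laplace transform drops
out of the contour integrals. -/
theorem differentiable_integral_mul_exp {q : ℝ → ℂ} {A B : ℝ}
    (hq : IntervalIntegrable q volume A B) :
    Differentiable ℂ fun s : ℂ => ∫ τ in A..B, q τ * cexp (-(s * τ)) := by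
  intro s₀
  set M := |A| + |B| with hM
  have hτM : ∀ τ ∈ Ι A B, |τ| ≤ M := by
    intro τ hτ
    obtain ⟨h1, h2⟩ := hτ
    have h3 := neg_abs_le A
    have h4 := neg_abs_le B
    have h5 := le_abs_self A
    have h6 := le_abs_self B
    have h7 := abs_nonneg A
    have h8 := abs_nonneg B
    rw [abs_le]
    constructor
    · rcases min_choice A B with h | h <;> rw [h] at h1 <;> linarith
    · rcases max_choice A B with h | h <;> rw [h] at h2 <;> linarith
  have hm : ∀ s : ℂ, IntervalIntegrable (fun τ => q τ * cexp (-(s * τ))) volume A B := fun s =>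
    hq.mul_continuousOn (Continuous.continuousOn (by fun_prop))
  have hm' : IntervalIntegrable (fun τ : ℝ => q τ * (cexp (-(s₀ * τ)) * -(τ : ℂ))) volume A B :=
    hq.mul_continuousOn (Continuous.continuousOn (by fun_prop))
  refine (intervalIntegral.hasDerivAt_integral_of_dominated_loc_of_deriv_le
    (F := fun s τ => q τ * cexp (-(s * τ)))
    (F' := fun s τ => q τ * (cexp (-(s * τ)) * -(τ : ℂ)))
    (bound := fun τ => ‖q τ‖ * (Real.exp ((‖s₀‖ + 1) * M) * M))
    (Metric.ball_mem_nhds s₀ one_pos) ?_ (hm s₀) ?_ ?_ (hq.norm.mul_const _)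
    ?_).2.differentiableAt
  · exact Eventually.of_forall fun s => (intervalIntegrable_iff.1 (hm s)).aestronglyMeasurable
  · exact (intervalIntegrable_iff.1 hm').aestronglyMeasurable
  · refine Eventually.of_forall fun τ hτ s hs => ?_
    have h1 := hτM τ hτ
    have hs' : ‖s‖ ≤ ‖s₀‖ + 1 := by
      have h2 : ‖s - s₀‖ < 1 := by simpa [dist_eq_norm] using hs
      have h3 := norm_sub_norm_le s s₀
      linarith
    rw [norm_mul, norm_mul, norm_neg, Complex.norm_real, Real.norm_eq_abs]
    refine mul_le_mul_of_nonneg_left (mul_le_mul ?_ h1 (abs_nonneg _) (Real.exp_pos _).le)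
      (norm_nonneg _)
    refine (Complex.norm_exp_le_exp_norm _).trans (Real.exp_le_exp.2 ?_)
    rw [norm_neg, norm_mul, Complex.norm_real, Real.norm_eq_abs]
    exact mul_le_mul hs' h1 (abs_nonneg _) (by positivity)
  · refine Eventually.of_forall fun τ _ s _ => ?_
    have h1 := (((hasDerivAt_id s).mul_const (τ : ℂ)).neg.cexp).const_mul (q τ)
    refine h1.congr_deriv ?_
    simp

theorem IsMildSolution.intervalIntegrable_preshape {N : ℕ} {a : ℝ} {ad : ℕ → ℝ} {h : ℝ}
    (hh : 0 < h) {x₀ : ℂ} {φ y : ℝ → ℂ} (hy : IsMildSolution N a ad h x₀ φ y) :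
    IntervalIntegrable φ volume (-(N * h)) 0 := by
  have hNh : 0 ≤ (N : ℝ) * h := by positivity
  refine (hy.integrable 0 le_rfl).congr_ae ?_
  rw [uIoc_of_le (by linarith)]
  filter_upwards [ae_restrict_mem measurableSet_Ioc,
    ae_restrict_of_ae (Measure.ae_ne volume (0 : ℝ))] with τ hτ hne
  exact hy.preshape τ hτ.1.le (lt_of_le_of_ne hτ.2 hne)

theorem differentiable_initTransform {N : ℕ} (ad : ℕ → ℝ) {h : ℝ} (hh : 0 < h) {φ : ℝ → ℂ}
    (hφ : IntervalIntegrable φ volume (-(N * h)) 0) :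
    Differentiable ℂ (initTransform N ad h φ) := by
  refine Differentiable.fun_sum fun j hj => ?_
  have hjN : (j : ℝ) * h ≤ N * h :=
    mul_le_mul_of_nonneg_right (by exact_mod_cast (Finset.mem_Icc.1 hj).2) hh.le
  have hj0 : 0 ≤ (j : ℝ) * h := by positivity
  have h1 := differentiable_integral_mul_exp (q := φ) (A := -(j * h)) (B := 0) (hφ.mono_set (by
    rw [uIcc_of_le (by linarith), uIcc_of_le (by linarith)]
    exact Icc_subset_Icc_left (by linarith)))
  exact Differentiable.mul (by fun_prop) h1

/-- The exponent is `-s(jh + τ)` with `0 ≤ jh + τ ≤ mh`: the modulus is at most `1` in the right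
half plane and at most `e^{-mh Re s}` in the left one. Terms beyond `m` vanish. -/
theorem norm_initTransform_le {N : ℕ} {ad : ℕ → ℝ} {m : ℕ} (hm : IsLeading N ad m) {h : ℝ}
    (hh : 0 < h) {φ : ℝ → ℂ} {B : ℝ} (hφ : ∀ τ, -(N * h) ≤ τ → τ < 0 → ‖φ τ‖ ≤ B) :
    ∃ K, 0 ≤ K ∧ ∀ s : ℂ,
      ‖initTransform N ad h φ s‖ ≤ K * (1 + Real.exp (-(m * h * s.re))) := by
  have hB : 0 ≤ max B 0 := le_max_right _ _
  refine ⟨∑ j ∈ Finset.Icc 1 N, |ad j| * (max B 0 * (j * h)), Finset.sum_nonneg fun j _ => by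
    positivity, fun s => ?_⟩
  rw [initTransform, Finset.sum_mul]
  refine (norm_sum_le _ _).trans (Finset.sum_le_sum fun j hj => ?_)
  rcases lt_or_ge m j with hlt | hle
  · simp [hm.eq_zero j hj hlt]
  have hjN : (j : ℝ) * h ≤ N * h :=
    mul_le_mul_of_nonneg_right (by exact_mod_cast (Finset.mem_Icc.1 hj).2) hh.le
  have hjm : (j : ℝ) * h ≤ m * h := mul_le_mul_of_nonneg_right (by exact_mod_cast hle) hh.le
  have hj0 : 0 ≤ (j : ℝ) * h := by positivity
  rw [mul_assoc (ad j : ℂ), norm_mul, Complex.norm_real, Real.norm_eq_abs, mul_assoc |ad j|,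
    ← intervalIntegral.integral_const_mul]
  refine mul_le_mul_of_nonneg_left ?_ (abs_nonneg _)
  have h1 : ∀ᵐ τ : ℝ, τ ∈ Ι (-(j * h)) 0 →
      ‖cexp (-((j : ℂ) * s * (h : ℂ))) * (φ τ * cexp (-(s * τ)))‖ ≤
        max B 0 * (1 + Real.exp (-(m * h * s.re))) := by
    filter_upwards [Measure.ae_ne volume (0 : ℝ)] with τ hτ hmem
    rw [uIoc_of_le (by linarith)] at hmem
    have h2 : ‖φ τ‖ ≤ max B 0 :=
      (hφ τ (by linarith [hmem.1]) (lt_of_le_of_ne hmem.2 hτ)).trans (le_max_left _ _)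
    have h3 : ‖cexp (-((j : ℂ) * s * (h : ℂ))) * cexp (-(s * τ))‖ ≤
        1 + Real.exp (-(m * h * s.re)) := by
      rw [← Complex.exp_add, Complex.norm_exp]
      have e : (-((j : ℂ) * s * (h : ℂ)) + -(s * (τ : ℂ))).re = -(s.re * (j * h + τ)) := by
        simp; ring
      rw [e]
      have hpos := Real.exp_pos (-(m * h * s.re))
      rcases le_total 0 s.re with h0 | h0
      · have : Real.exp (-(s.re * (j * h + τ))) ≤ 1 := by
          rw [Real.exp_le_one_iff]
          have := mul_nonneg h0 (show 0 ≤ (j : ℝ) * h + τ by linarith [hmem.1])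
          linarith
        linarith
      · have : Real.exp (-(s.re * (j * h + τ))) ≤ Real.exp (-(m * h * s.re)) := by
          rw [Real.exp_le_exp]
          have := mul_le_mul_of_nonneg_left (show (j : ℝ) * h + τ ≤ m * h by linarith [hmem.2])
            (show 0 ≤ -s.re by linarith)
          linarith
        linarith
    calc _ = ‖φ τ‖ * ‖cexp (-((j : ℂ) * s * (h : ℂ))) * cexp (-(s * τ))‖ := by
          rw [← norm_mul]; congr 1; ring
      _ ≤ _ := mul_le_mul h2 h3 (norm_nonneg _) hB
  refine (intervalIntegral.norm_integral_le_of_norm_le_const_ae h1).trans (le_of_eq ?_)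
  rw [zero_sub, neg_neg, abs_of_nonneg hj0]
  ring

/-- The integrand is at most `1` on `[A, A + ε]` and at most `e^{-εx}` afterwards. Keeping `ε` free
avoids a bound `1/x`, which would fail near the imaginary axis. -/
theorem integral_exp_decay_le {A B x ε : ℝ} (hAB : A ≤ B) (hx : 0 ≤ x) (hε : 0 ≤ ε) :
    ∫ τ in A..B, Real.exp (-(x * (τ - A))) ≤ ε + (B - A) * Real.exp (-(ε * x)) := by
  have hc : Continuous fun τ : ℝ => Real.exp (-(x * (τ - A))) := by fun_prop
  have hpos : 0 ≤ (B - A) * Real.exp (-(ε * x)) :=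
    mul_nonneg (by linarith) (Real.exp_pos _).le
  have hone : ∀ C, A ≤ C → ∫ τ in A..C, Real.exp (-(x * (τ - A))) ≤ C - A := by
    intro C hC
    have h1 := intervalIntegral.integral_mono_on hC (hc.intervalIntegrable A C)
      (intervalIntegrable_const (μ := volume) (c := (1 : ℝ))) (fun τ hτ => by
        rw [Real.exp_le_one_iff]
        have := mul_nonneg hx (sub_nonneg.2 hτ.1)
        linarith)
    simpa using h1
  rcases le_total B (A + ε) with h | h
  · have := hone B hAB
    linarith
  · rw [← intervalIntegral.integral_add_adjacent_intervals (hc.intervalIntegrable A (A + ε))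
      (hc.intervalIntegrable (A + ε) B)]
    have h1 := hone (A + ε) (by linarith)
    have h2 := intervalIntegral.integral_mono_on h (hc.intervalIntegrable (A + ε) B)
      (intervalIntegrable_const (μ := volume) (c := Real.exp (-(ε * x)))) (fun τ hτ => by
        rw [Real.exp_le_exp]
        have := mul_le_mul_of_nonneg_left (show ε ≤ τ - A by linarith [hτ.1]) hx
        linarith)
    rw [intervalIntegral.integral_const, smul_eq_mul] at h2
    have h3 : (B - (A + ε)) * Real.exp (-(ε * x)) ≤ (B - A) * Real.exp (-(ε * x)) :=
      mul_le_mul_of_nonneg_right (by linarith) (Real.exp_pos _).le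
    linarith

theorem norm_integral_le_of_exp_decay {q : ℝ → ℂ} {A B M x ε : ℝ} (hAB : A ≤ B) (hM : 0 ≤ M)
    (hx : 0 ≤ x) (hε : 0 ≤ ε) (hq : ∀ τ ∈ Ioc A B, ‖q τ‖ ≤ M * Real.exp (-(x * (τ - A)))) :
    ‖∫ τ in A..B, q τ‖ ≤ M * (ε + (B - A) * Real.exp (-(ε * x))) := by
  refine (intervalIntegral.norm_integral_le_of_norm_le hAB (Eventually.of_forall hq)
    (Continuous.intervalIntegrable (by fun_prop) _ _)).trans ?_
  rw [intervalIntegral.integral_const_mul]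
  exact mul_le_mul_of_nonneg_left (integral_exp_decay_le hAB hx hε) hM

/-- In the right half plane the kernel decays like `e^{-x(τ - A)}` with `x = Re s` and `A = t - jh`,
the left end of the interval. -/
theorem norm_historyTransform_le {N : ℕ} (ad : ℕ → ℝ) {h : ℝ} (hh : 0 < h) {y : ℝ → ℂ} {t M : ℝ}
    (ht : 0 ≤ t) (hM : 0 ≤ M) (hy : ∀ τ ∈ Icc (-(N * h)) t, ‖y τ‖ ≤ M) :
    ∃ K, 0 ≤ K ∧ ∀ s : ℂ, 0 ≤ s.re → ∀ ε, 0 ≤ ε →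
      ‖historyTransform N ad h y t s‖ ≤ K * (ε + Real.exp (-(ε * s.re))) := by
  refine ⟨∑ j ∈ Finset.Icc 1 N, |ad j| * (M * (1 + j * h)),
    Finset.sum_nonneg fun j _ => by positivity, fun s hs ε hε => ?_⟩
  rw [historyTransform, Finset.sum_mul]
  refine (norm_sum_le _ _).trans (Finset.sum_le_sum fun j hj => ?_)
  have hjN : (j : ℝ) * h ≤ N * h :=
    mul_le_mul_of_nonneg_right (by exact_mod_cast (Finset.mem_Icc.1 hj).2) hh.le
  have hj0 : 0 ≤ (j : ℝ) * h := by positivity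
  rw [norm_mul, Complex.norm_real, Real.norm_eq_abs, mul_assoc, mul_assoc]
  refine mul_le_mul_of_nonneg_left ?_ (abs_nonneg _)
  refine (norm_integral_le_of_exp_decay (x := s.re) (ε := ε) (M := M) (by linarith) hM hs hε
    fun τ hτ => ?_).trans (mul_le_mul_of_nonneg_left ?_ hM)
  · rw [norm_mul, Complex.norm_exp]
    refine mul_le_mul (hy τ ⟨by linarith [hτ.1], hτ.2⟩) (le_of_eq ?_) (Real.exp_pos _).le hM
    congr 1
    simp
    ring_nf
    simp
  · have := Real.exp_pos (-(ε * s.re))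
    have := mul_nonneg hj0 hε
    nlinarith

/-- The part of the transform that is relevant in the left half plane. -/
theorem IsMildSolution.norm_mul_truncLaplace_add_le {N : ℕ} {a : ℝ} {ad : ℕ → ℝ} {h : ℝ}
    (hh : 0 < h) {x₀ : ℂ} {φ y : ℝ → ℂ} (hy : IsMildSolution N a ad h x₀ φ y) {t M : ℝ}
    (ht : 0 ≤ t) (hM : 0 ≤ M) (hb : ∀ τ ∈ Icc (-(N * h)) t, ‖y τ‖ ≤ M) :
    ∃ K, 0 ≤ K ∧ ∀ s : ℂ, s.re ≤ 0 → ∀ ε, 0 ≤ ε →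
      ‖s * (cexp (s * t) * truncLaplace y t s) + y t‖ ≤
        K * (ε + Real.exp (-(ε * |s.re|)) + Real.exp (-(t * |s.re|))) := by
  have hNh : 0 ≤ (N : ℝ) * h := by positivity
  set D := delayRHS N a ad h y with hD
  set M' := |a| * M + ∑ j ∈ Finset.Icc 1 N, |ad j| * M with hM'
  have hM'0 : 0 ≤ M' := by positivity
  have hDb : ∀ τ ∈ Icc 0 t, ‖D τ‖ ≤ M' := by
    intro τ hτ
    refine (norm_add_le _ _).trans (add_le_add ?_ ((norm_sum_le _ _).trans
      (Finset.sum_le_sum fun j hj => ?_)))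
    · rw [norm_mul, Complex.norm_real, Real.norm_eq_abs]
      exact mul_le_mul_of_nonneg_left (hb τ ⟨by linarith [hτ.1], hτ.2⟩) (abs_nonneg _)
    · have hjN : (j : ℝ) * h ≤ N * h :=
        mul_le_mul_of_nonneg_right (by exact_mod_cast (Finset.mem_Icc.1 hj).2) hh.le
      have hj0 : 0 ≤ (j : ℝ) * h := by positivity
      rw [norm_mul, Complex.norm_real, Real.norm_eq_abs]
      exact mul_le_mul_of_nonneg_left (hb _ ⟨by linarith [hτ.1], by linarith [hτ.2]⟩) (abs_nonneg _)
  refine ⟨M' * (1 + t) + ‖x₀‖, by positivity, fun s hs ε hε => ?_⟩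
  have hparts := integral_mul_exp_of_primitive ht
    (intervalIntegrable_delayRHS a ad hh ht (hy.integrable t ht)) (fun τ hτ => hy.eq τ hτ.1) s
  have hee : cexp (s * t) * cexp (-(s * t)) = 1 := by
    rw [← Complex.exp_add, add_neg_cancel, Complex.exp_zero]
  -- Integration by parts isolates the boundary value at `t`. What remains carries only `e^{st}` and
  -- `e^{sτ}`, which decay in the left half plane.
  have h1 : s * (cexp (s * t) * truncLaplace y t s) + y t =
      cexp (s * t) * x₀ + ∫ τ in (0 : ℝ)..t, D (t - τ) * cexp (s * τ) := by
    have h2 : ∫ τ in (0 : ℝ)..t, D (t - τ) * cexp (s * τ) =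
        cexp (s * t) * ∫ τ in (0 : ℝ)..t, D τ * cexp (-(s * τ)) := by
      rw [← intervalIntegral.integral_const_mul]
      have h3 := intervalIntegral.integral_comp_sub_left (a := (0 : ℝ)) (b := t)
        (fun τ => cexp (s * t) * (D τ * cexp (-(s * τ)))) t
      rw [sub_self, sub_zero] at h3
      rw [← h3]
      refine intervalIntegral.integral_congr fun τ _ => ?_
      have : cexp (s * τ) = cexp (s * t) * cexp (-(s * ((t - τ : ℝ) : ℂ))) := by
        rw [← Complex.exp_add]; congr 1; push_cast; ring
      rw [this]
      ring
    rw [h2, hparts, truncLaplace]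
    linear_combination (-y t) * hee
  rw [h1]
  have habs : |s.re| = -s.re := abs_of_nonpos hs
  have h4 : ‖cexp (s * t) * x₀‖ = ‖x₀‖ * Real.exp (-(t * |s.re|)) := by
    rw [norm_mul, Complex.norm_exp, habs, mul_comm]
    congr 2
    simp
    ring
  have h5 : ‖∫ τ in (0 : ℝ)..t, D (t - τ) * cexp (s * τ)‖ ≤
      M' * (ε + (t - 0) * Real.exp (-(ε * |s.re|))) := by
    refine norm_integral_le_of_exp_decay ht hM'0 (abs_nonneg _) hε fun τ hτ => ?_
    rw [norm_mul, Complex.norm_exp]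
    refine mul_le_mul (hDb _ ⟨by linarith [hτ.2], by linarith [hτ.1]⟩) (le_of_eq ?_)
      (Real.exp_pos _).le hM'0
    rw [habs]
    congr 1
    simp
  refine (norm_add_le _ _).trans ?_
  rw [h4]
  have e1 := Real.exp_pos (-(ε * |s.re|))
  have e2 := Real.exp_pos (-(t * |s.re|))
  have e3 := norm_nonneg x₀
  have e4 : M' * (ε + (t - 0) * Real.exp (-(ε * |s.re|))) ≤
      (M' * (1 + t)) * (ε + Real.exp (-(ε * |s.re|))) := by
    rw [mul_assoc]
    refine mul_le_mul_of_nonneg_left ?_ hM'0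
    nlinarith [mul_nonneg ht hε]
  have e5 : 0 ≤ M' * (1 + t) * Real.exp (-(t * |s.re|)) := by positivity
  have e6 : 0 ≤ ‖x₀‖ * (ε + Real.exp (-(ε * |s.re|))) := by positivity
  nlinarith

/-! ### Integrals over circles -/

theorem integral_exp_neg_abs_sub_le {c : ℝ} (hc : 0 < c) {A B β : ℝ} (hA : A ≤ β) (hB : β ≤ B) :
    ∫ θ in A..B, Real.exp (-(c * |θ - β|)) ≤ 2 / c := by
  have hcont : Continuous fun θ : ℝ => Real.exp (-(c * |θ - β|)) := by fun_prop
  rw [← intervalIntegral.integral_add_adjacent_intervals (hcont.intervalIntegrable A β)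
    (hcont.intervalIntegrable β B)]
  have h1 : ∫ θ in A..β, Real.exp (-(c * |θ - β|)) ≤ 1 / c := by
    have hd : ∀ θ ∈ uIcc A β, HasDerivAt (fun θ : ℝ => Real.exp (c * (θ - β)) / c)
        (Real.exp (c * (θ - β))) θ := by
      intro θ _
      have := ((((hasDerivAt_id θ).sub_const β).const_mul c).exp).div_const c
      refine this.congr_deriv ?_
      simp only [id]
      field_simp
    have he : ∫ θ in A..β, Real.exp (-(c * |θ - β|)) = ∫ θ in A..β, Real.exp (c * (θ - β)) := by
      refine intervalIntegral.integral_congr fun θ hθ => ?_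
      rw [uIcc_of_le hA] at hθ
      rw [abs_of_nonpos (by linarith [hθ.2])]
      congr 1; ring
    rw [he, intervalIntegral.integral_eq_sub_of_hasDerivAt hd
      (Continuous.intervalIntegrable (by fun_prop) _ _)]
    simp only [sub_self, mul_zero, Real.exp_zero]
    have := div_nonneg (Real.exp_pos (c * (A - β))).le hc.le
    linarith
  have h2 : ∫ θ in β..B, Real.exp (-(c * |θ - β|)) ≤ 1 / c := by
    have hd : ∀ θ ∈ uIcc β B, HasDerivAt (fun θ : ℝ => -(Real.exp (-(c * (θ - β))) / c))
        (Real.exp (-(c * (θ - β)))) θ := by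
      intro θ _
      have := (((((hasDerivAt_id θ).sub_const β).const_mul c).neg.exp).div_const c).neg
      refine this.congr_deriv ?_
      simp only [id, Pi.neg_apply]
      field_simp
    have he : ∫ θ in β..B, Real.exp (-(c * |θ - β|)) = ∫ θ in β..B, Real.exp (-(c * (θ - β))) := by
      refine intervalIntegral.integral_congr fun θ hθ => ?_
      rw [uIcc_of_le hB] at hθ
      rw [abs_of_nonneg (by linarith [hθ.1])]
    rw [he, intervalIntegral.integral_eq_sub_of_hasDerivAt hd
      (Continuous.intervalIntegrable (by fun_prop) _ _)]
    simp only [sub_self, mul_zero, neg_zero, Real.exp_zero]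
    have := div_nonneg (Real.exp_pos (-(c * (B - β)))).le hc.le
    linarith
  have : 2 / c = 1 / c + 1 / c := by ring
  linarith

/-- A form of Jordan's inequality. -/
theorem integral_exp_neg_abs_cos_le {κ : ℝ} (hκ : 0 < κ) :
    ∫ θ in (0 : ℝ)..2 * π, Real.exp (-(κ * |Real.cos θ|)) ≤ 2 * π / κ := by
  have hπ := Real.pi_pos
  set c := κ * (2 / π) with hc
  have hc0 : 0 < c := by positivity
  have hjordan : ∀ x : ℝ, |x| ≤ π / 2 → 2 / π * |x| ≤ |Real.sin x| := by
    intro x hx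
    rcases le_total 0 x with h | h
    · rw [abs_of_nonneg h] at hx ⊢
      exact (Real.mul_le_sin h hx).trans (le_abs_self _)
    · rw [abs_of_nonpos h] at hx ⊢
      have := Real.mul_le_sin (neg_nonneg.2 h) hx
      rw [Real.sin_neg] at this
      exact this.trans (neg_le_abs _)
  -- The cosine vanishes at `π/2` and `3π/2`; Jordan's inequality is applied around each zero on its
  -- half of the circle.
  have hpt : ∀ θ ∈ Icc 0 (2 * π), Real.exp (-(κ * |Real.cos θ|)) ≤
      Real.exp (-(c * |θ - π / 2|)) + Real.exp (-(c * |θ - 3 * π / 2|)) := by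
    intro θ hθ
    have p1 := Real.exp_pos (-(c * |θ - π / 2|))
    have p2 := Real.exp_pos (-(c * |θ - 3 * π / 2|))
    rcases le_total θ π with h | h
    · have h1 := hjordan (θ - π / 2) (by rw [abs_le]; constructor <;> linarith [hθ.1])
      rw [Real.sin_sub_pi_div_two, abs_neg] at h1
      have h2 : Real.exp (-(κ * |Real.cos θ|)) ≤ Real.exp (-(c * |θ - π / 2|)) := by
        rw [Real.exp_le_exp, hc, mul_assoc]
        have := mul_le_mul_of_nonneg_left h1 hκ.le
        linarith
      linarith
    · have h1 := hjordan (θ - 3 * π / 2) (by rw [abs_le]; constructor <;> linarith [hθ.2])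
      have e : Real.sin (θ - 3 * π / 2) = Real.cos θ := by
        rw [show θ - 3 * π / 2 = (θ + π / 2) - 2 * π by ring, Real.sin_sub_two_pi,
          Real.sin_add_pi_div_two]
      rw [e] at h1
      have h2 : Real.exp (-(κ * |Real.cos θ|)) ≤ Real.exp (-(c * |θ - 3 * π / 2|)) := by
        rw [Real.exp_le_exp, hc, mul_assoc]
        have := mul_le_mul_of_nonneg_left h1 hκ.le
        linarith
      linarith
  have i1 : IntervalIntegrable (fun θ : ℝ => Real.exp (-(c * |θ - π / 2|))) volume 0 (2 * π) :=
    Continuous.intervalIntegrable (by fun_prop) _ _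
  have i2 : IntervalIntegrable (fun θ : ℝ => Real.exp (-(c * |θ - 3 * π / 2|))) volume 0 (2 * π) :=
    Continuous.intervalIntegrable (by fun_prop) _ _
  refine (intervalIntegral.integral_mono_on (by positivity)
    (Continuous.intervalIntegrable (by fun_prop) _ _) (i1.add i2) hpt).trans ?_
  rw [intervalIntegral.integral_add i1 i2]
  have j1 := integral_exp_neg_abs_sub_le hc0 (A := 0) (B := 2 * π) (β := π / 2) (by positivity)
    (by linarith)
  have j2 := integral_exp_neg_abs_sub_le hc0 (A := 0) (B := 2 * π) (β := 3 * π / 2)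
    (by positivity) (by linarith)
  have e : 2 / c + 2 / c = 2 * π / κ := by rw [hc]; field_simp; ring
  linarith

/-! ### The expansion along circles -/

/-- The integrand `e^{st} (x₀ + G(s)) / Δ(s)` without an entire part and the pole at `0`. -/
noncomputable def contourRemainder (N : ℕ) (a : ℝ) (ad : ℕ → ℝ) (h : ℝ) (x₀ : ℂ) (φ y : ℝ → ℂ)
    (t : ℝ) (s : ℂ) : ℂ :=
  cexp (s * t) * (x₀ + initTransform N ad h φ s) / charFun N a ad h s -
    cexp (s * t) * truncLaplace y t s - y t / s

/-- The product `uR` is `(u^{1-α}R^α)(R^{1-α}u^α)`, and weighted AM-GM bounds the first factor. With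
`R = |s|` and `u` the growth of the initial transform, only the small power `u^α` has to be beaten
by `e^{-t|Re s|}`, which is possible for every `t > 0`. -/
theorem mul_le_add_mul_rpow {u R A α : ℝ} (hu : 0 < u) (hR : 0 < R) (hA : 0 < A) (hα0 : 0 ≤ α)
    (hα1 : α ≤ 1) : u * R ≤ (1 + 1 / A) * (R + A * u) * (R ^ (1 - α) * u ^ α) := by
  have h1 := Real.geom_mean_le_arith_mean2_weighted (sub_nonneg.2 hα1) hα0 hu.le hR.le (by ring)
  have h2 : (1 - α) * u + α * R ≤ u + R := by nlinarith
  have h3 : u + R ≤ (1 + 1 / A) * (R + A * u) := by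
    have : (1 + 1 / A) * (R + A * u) = R + A * u + R / A + u := by field_simp; ring
    rw [this]
    have := mul_pos hA hu
    have := div_pos hR hA
    linarith
  have h4 : u * R = (u ^ (1 - α) * R ^ α) * (R ^ (1 - α) * u ^ α) := by
    calc u * R = (u ^ (1 - α) * u ^ α) * (R ^ α * R ^ (1 - α)) := by
          rw [← Real.rpow_add hu, ← Real.rpow_add hR]; norm_num
      _ = _ := by ring
  rw [h4]
  exact mul_le_mul_of_nonneg_right ((h1.trans h2).trans h3) (by positivity)

theorem norm_sub_charFun_le (N : ℕ) (a : ℝ) (ad : ℕ → ℝ) {h : ℝ} (hh : 0 < h) {s : ℂ}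
    (hs : 0 ≤ s.re) : ‖s - charFun N a ad h s‖ ≤ |a| + ∑ j ∈ Finset.Icc 1 N, |ad j| := by
  have e : s - charFun N a ad h s = a + ∑ j ∈ Finset.Icc 1 N,
      (ad j : ℂ) * cexp (-((j : ℂ) * s * (h : ℂ))) := by rw [charFun]; ring
  rw [e]
  refine (norm_add_le _ _).trans (add_le_add (by simp) ((norm_sum_le _ _).trans
    (Finset.sum_le_sum fun j _ => ?_)))
  rw [norm_mul, norm_cexp_delay, Complex.norm_real, Real.norm_eq_abs]
  refine mul_le_of_le_one_right (abs_nonneg _) (pow_le_one₀ (Real.exp_pos _).le ?_)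
  rw [Real.exp_le_one_iff]
  have := mul_nonneg hs hh.le
  linarith

/-- In the right half plane the Laplace identity rewrites the remainder as `(y + H)/Δ - y/s`. In the
left one the quotient and `e^{st}L + y/s` are small separately. The factor `s` is the one that the
measure on the circle supplies. -/
theorem IsMildSolution.norm_mul_contourRemainder_le {N : ℕ} {a : ℝ} {ad : ℕ → ℝ} {m : ℕ}
    (hm : IsLeading N ad m) {h : ℝ} (hh : 0 < h) {x₀ : ℂ} {φ y : ℝ → ℂ}
    (hy : IsMildSolution N a ad h x₀ φ y) {B : ℝ} (hφ : ∀ τ, -(N * h) ≤ τ → τ < 0 → ‖φ τ‖ ≤ B)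
    {t : ℝ} (ht : 0 < t) : ∃ K α : ℝ, 0 ≤ K ∧ 0 < α ∧ ∀ᶠ n in atTop, ∀ s : ℂ,
      ‖s‖ = goodRadius ad h m n → ∀ ε, 0 ≤ ε →
      ‖s * contourRemainder N a ad h x₀ φ y t s‖ ≤ K * (ε + Real.exp (-(ε * |s.re|)) + 1 / ‖s‖ +
        Real.exp (-(t * |s.re|)) + ‖s‖ ^ (1 - α) * Real.exp (-(t / 2 * |s.re|))) := by
  have hp := hm.delay_pos hh
  set p := (m : ℝ) * h with hpdef
  have hA : 0 < |ad m| := abs_pos.2 hm.ne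
  obtain ⟨M, hM0, hM⟩ := hy.exists_bound hh hφ t
  obtain ⟨KG, hKG0, hKG⟩ := norm_initTransform_le hm hh hφ
  obtain ⟨KH, hKH0, hKH⟩ := norm_historyTransform_le ad hh ht.le hM0 hM
  obtain ⟨KL, hKL0, hKL⟩ := hy.norm_mul_truncLaplace_add_le hh ht.le hM0 hM
  set K₃ := |a| + ∑ j ∈ Finset.Icc 1 N, |ad j| with hK₃
  have hK₃0 : 0 ≤ K₃ := by positivity
  set α := min 1 (t / (2 * p)) with hα
  have hα0 : 0 < α := by positivity
  have hα1 : α ≤ 1 := min_le_left _ _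
  have hαp : α * p ≤ t / 2 := by
    calc α * p ≤ t / (2 * p) * p := mul_le_mul_of_nonneg_right (min_le_right _ _) hp.le
      _ = t / 2 := by field_simp
  set K₄ := 16 * ((‖x₀‖ + KG) * (1 + 1 / |ad m|)) with hK₄
  have hK₄0 : 0 ≤ K₄ := by positivity
  refine ⟨8 * KH + 8 * (‖y t‖ * K₃) + KL + K₄, α, by positivity, hα0, ?_⟩
  filter_upwards [charFun_ge_on_goodRadius a hm hh,
    (tendsto_goodRadius hm hh).eventually_gt_atTop 0] with n hn hn0 s hs ε hε
  have hs0 : 0 < ‖s‖ := by rw [hs]; exact hn0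
  have hsne : s ≠ 0 := norm_pos_iff.1 hs0
  have hΔ := hn s hs
  have hlead := norm_nonneg (lead ad h m s)
  have hΔ0 : 0 < ‖charFun N a ad h s‖ := by linarith
  have hΔne : charFun N a ad h s ≠ 0 := norm_pos_iff.1 hΔ0
  have p1 := Real.exp_pos (-(ε * |s.re|))
  have p2 := Real.exp_pos (-(t * |s.re|))
  have p3 : 0 < 1 / ‖s‖ := by positivity
  have p4 : 0 < ‖s‖ ^ (1 - α) * Real.exp (-(t / 2 * |s.re|)) := by positivity
  set E₁ := Real.exp (-(ε * |s.re|))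
  set E₂ := Real.exp (-(t * |s.re|))
  set E₃ := ‖s‖ ^ (1 - α) * Real.exp (-(t / 2 * |s.re|))
  rcases le_total 0 s.re with hre | hre
  · have hid := hy.charFun_mul_truncLaplace hh ht.le s
    have hee : cexp (s * t) * cexp (-(s * t)) = 1 := by
      rw [← Complex.exp_add, add_neg_cancel, Complex.exp_zero]
    have e : s * contourRemainder N a ad h x₀ φ y t s =
        historyTransform N ad h y t s * (s / charFun N a ad h s) +
          y t * ((s - charFun N a ad h s) / charFun N a ad h s) := by
      rw [contourRemainder]
      field_simp
      linear_combination (-(s * cexp (s * t))) * hid +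
        s * (y t + historyTransform N ad h y t s) * hee
    have b1 : ‖s / charFun N a ad h s‖ ≤ 8 := by
      rw [norm_div, div_le_iff₀ hΔ0]; linarith
    have b2 : ‖(s - charFun N a ad h s) / charFun N a ad h s‖ ≤ 8 * (K₃ * (1 / ‖s‖)) := by
      rw [norm_div, div_le_iff₀ hΔ0]
      have c1 := norm_sub_charFun_le N a ad hh hre
      have c2 : 1 ≤ 8 * (1 / ‖s‖) * ‖charFun N a ad h s‖ := by
        have : 8 * (1 / ‖s‖) * (‖s‖ / 8) = 1 := by field_simp
        calc (1 : ℝ) = 8 * (1 / ‖s‖) * (‖s‖ / 8) := this.symm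
          _ ≤ _ := mul_le_mul_of_nonneg_left (by linarith) (by positivity)
      calc _ ≤ K₃ * 1 := by rw [mul_one]; exact c1
        _ ≤ K₃ * (8 * (1 / ‖s‖) * ‖charFun N a ad h s‖) := mul_le_mul_of_nonneg_left c2 hK₃0
        _ = _ := by ring
    have b3 : ‖historyTransform N ad h y t s‖ ≤ KH * (ε + E₁) := by
      have := hKH s hre ε hε
      rwa [← abs_of_nonneg hre] at this
    rw [e]
    refine (norm_add_le _ _).trans ?_
    rw [norm_mul, norm_mul]
    have b4 : ‖historyTransform N ad h y t s‖ * ‖s / charFun N a ad h s‖ ≤ KH * (ε + E₁) * 8 :=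
      mul_le_mul b3 b1 (norm_nonneg _) (by positivity)
    have b5 := mul_le_mul_of_nonneg_left b2 (norm_nonneg (y t))
    have b6 : 8 * KH * (ε + E₁) ≤ 8 * KH * (ε + E₁ + 1 / ‖s‖ + E₂ + E₃) :=
      mul_le_mul_of_nonneg_left (by linarith) (by positivity)
    have b7 : 8 * (‖y t‖ * K₃) * (1 / ‖s‖) ≤
        8 * (‖y t‖ * K₃) * (ε + E₁ + 1 / ‖s‖ + E₂ + E₃) :=
      mul_le_mul_of_nonneg_left (by linarith) (by positivity)
    have b8 : 0 ≤ (KL + K₄) * (ε + E₁ + 1 / ‖s‖ + E₂ + E₃) := by positivity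
    linarith
  · have habs : |s.re| = -s.re := abs_of_nonpos hre
    have e : s * contourRemainder N a ad h x₀ φ y t s =
        cexp (s * t) * (x₀ + initTransform N ad h φ s) * (s / charFun N a ad h s) -
          (s * (cexp (s * t) * truncLaplace y t s) + y t) := by
      rw [contourRemainder]
      field_simp
      ring
    have b1 := hKL s hre ε hε
    set u := Real.exp (p * |s.re|) with hu
    have hu0 : 0 < u := Real.exp_pos _
    have hu1 : 1 ≤ u := Real.one_le_exp (mul_nonneg hp.le (abs_nonneg _))
    have hus : Real.exp (-(p * s.re)) = u := by rw [hu, habs]; congr 1; ring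
    have b2 : ‖x₀ + initTransform N ad h φ s‖ ≤ (‖x₀‖ + KG) * (2 * u) := by
      refine (norm_add_le _ _).trans ?_
      have c1 := hKG s
      rw [hus] at c1
      have c2 : KG * (1 + u) ≤ KG * (2 * u) := mul_le_mul_of_nonneg_left (by linarith) hKG0
      have c3 : ‖x₀‖ * 1 ≤ ‖x₀‖ * (2 * u) :=
        mul_le_mul_of_nonneg_left (by linarith) (norm_nonneg _)
      linarith
    have b3 : ‖cexp (s * t)‖ = E₂ := by
      rw [Complex.norm_exp]
      congr 1
      rw [habs]
      simp
      ring
    have b4 : u * ‖s‖ ≤ 8 * (1 + 1 / |ad m|) * ‖charFun N a ad h s‖ * (‖s‖ ^ (1 - α) * u ^ α) := by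
      refine (mul_le_add_mul_rpow hu0 hs0 hA hα0.le hα1).trans ?_
      refine mul_le_mul_of_nonneg_right ?_ (by positivity)
      have c1 : ‖s‖ + |ad m| * u ≤ 8 * ‖charFun N a ad h s‖ := by
        rw [norm_lead, hus] at hΔ
        linarith
      have := mul_le_mul_of_nonneg_left c1 (show 0 ≤ 1 + 1 / |ad m| by positivity)
      linarith
    have b5 : E₂ * (‖s‖ ^ (1 - α) * u ^ α) ≤ E₃ := by
      rw [mul_left_comm]
      refine mul_le_mul_of_nonneg_left ?_ (by positivity)
      rw [hu, ← Real.exp_mul, ← Real.exp_add, Real.exp_le_exp]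
      have := mul_le_mul_of_nonneg_right hαp (abs_nonneg s.re)
      linarith
    have b6 : ‖cexp (s * t) * (x₀ + initTransform N ad h φ s) * (s / charFun N a ad h s)‖ ≤
        K₄ * E₃ := by
      rw [norm_mul, norm_mul, b3, norm_div, mul_div_assoc', div_le_iff₀ hΔ0]
      calc E₂ * ‖x₀ + initTransform N ad h φ s‖ * ‖s‖
          ≤ E₂ * ((‖x₀‖ + KG) * (2 * u)) * ‖s‖ := by gcongr
        _ = 2 * (‖x₀‖ + KG) * E₂ * (u * ‖s‖) := by ring
        _ ≤ 2 * (‖x₀‖ + KG) * E₂ * (8 * (1 + 1 / |ad m|) * ‖charFun N a ad h s‖ *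
            (‖s‖ ^ (1 - α) * u ^ α)) := mul_le_mul_of_nonneg_left b4 (by positivity)
        _ = K₄ * ‖charFun N a ad h s‖ * (E₂ * (‖s‖ ^ (1 - α) * u ^ α)) := by rw [hK₄]; ring
        _ ≤ K₄ * ‖charFun N a ad h s‖ * E₃ := mul_le_mul_of_nonneg_left b5 (by positivity)
        _ = _ := by ring
    rw [e]
    refine (norm_sub_le _ _).trans ?_
    have b7 : KL * (ε + E₁ + E₂) ≤ KL * (ε + E₁ + 1 / ‖s‖ + E₂ + E₃) :=
      mul_le_mul_of_nonneg_left (by linarith) hKL0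
    have b8 : K₄ * E₃ ≤ K₄ * (ε + E₁ + 1 / ‖s‖ + E₂ + E₃) :=
      mul_le_mul_of_nonneg_left (by linarith) hK₄0
    have b9 : 0 ≤ (8 * KH + 8 * (‖y t‖ * K₃)) * (ε + E₁ + 1 / ‖s‖ + E₂ + E₃) := by positivity
    linarith

/-- On the circle `|Re s| = R|cos θ|`, so Jordan's inequality gains a factor `1/R` from each
exponential. This turns `R^{1-α}` into `R^{-α}`. -/
theorem IsMildSolution.tendsto_circleIntegral_contourRemainder {N : ℕ} {a : ℝ} {ad : ℕ → ℝ} {m : ℕ}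
    (hm : IsLeading N ad m) {h : ℝ} (hh : 0 < h) {x₀ : ℂ} {φ y : ℝ → ℂ}
    (hy : IsMildSolution N a ad h x₀ φ y) {B : ℝ} (hφ : ∀ τ, -(N * h) ≤ τ → τ < 0 → ‖φ τ‖ ≤ B)
    {t : ℝ} (ht : 0 < t) : Tendsto (fun n => ∮ s in C(0, goodRadius ad h m n),
      contourRemainder N a ad h x₀ φ y t s) atTop (𝓝 0) := by
  obtain ⟨K, α, hK0, hα0, hK⟩ := hy.norm_mul_contourRemainder_le hm hh hφ ht
  have hRtop := tendsto_goodRadius hm hh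
  have hπ := Real.pi_pos
  have hlim : Tendsto (fun R : ℝ => K * (2 * π * (√R)⁻¹ + 2 * π * (√R)⁻¹ + 2 * π * R⁻¹ +
      2 * π / t * R⁻¹ + 4 * π / t * R ^ (-α))) atTop (𝓝 0) := by
    have h1 : Tendsto (fun R : ℝ => (√R)⁻¹) atTop (𝓝 0) :=
      tendsto_inv_atTop_zero.comp Real.tendsto_sqrt_atTop
    have h2 : Tendsto (fun R : ℝ => R⁻¹) atTop (𝓝 0) := tendsto_inv_atTop_zero
    have h3 := tendsto_rpow_neg_atTop hα0
    have := (((((h1.const_mul (2 * π)).add (h1.const_mul (2 * π))).add (h2.const_mul (2 * π))).add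
      (h2.const_mul (2 * π / t))).add (h3.const_mul (4 * π / t))).const_mul K
    simpa using this
  refine squeeze_zero_norm' ?_ (hlim.comp hRtop)
  filter_upwards [hK, hRtop.eventually_gt_atTop 0] with n hn hR
  set R := goodRadius ad h m n with hRdef
  -- Balances the two terms with `ε`: `ε` itself and the integral of `e^{-εR|cos θ|}`, both of order
  -- `R^{-1/2}`.
  set ε := (√R)⁻¹ with hε
  have hsq : 0 < √R := Real.sqrt_pos.2 hR
  have hε0 : 0 < ε := inv_pos.2 hsq
  have hεR : ε * R = √R := by
    rw [hε, inv_mul_eq_div, div_eq_iff hsq.ne', Real.mul_self_sqrt hR.le]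
  have c1 : Continuous fun θ : ℝ => Real.exp (-(√R * |Real.cos θ|)) := by fun_prop
  have c2 : Continuous fun θ : ℝ => Real.exp (-(t * R * |Real.cos θ|)) := by fun_prop
  have c3 : Continuous fun θ : ℝ => Real.exp (-(t / 2 * R * |Real.cos θ|)) := by fun_prop
  have hbound : ∀ θ : ℝ, ‖deriv (circleMap 0 R) θ •
      contourRemainder N a ad h x₀ φ y t (circleMap 0 R θ)‖ ≤
      K * (ε + Real.exp (-(√R * |Real.cos θ|)) + 1 / R + Real.exp (-(t * R * |Real.cos θ|)) +
        R ^ (1 - α) * Real.exp (-(t / 2 * R * |Real.cos θ|))) := by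
    intro θ
    have hns : ‖circleMap 0 R θ‖ = R := by simp [abs_of_pos hR]
    have hre : |(circleMap 0 R θ).re| = R * |Real.cos θ| := by
      simp [circleMap, abs_mul, abs_of_pos hR, Complex.exp_ofReal_mul_I_re]
    have := hn _ hns ε hε0.le
    rw [hns, hre, ← mul_assoc, hεR, ← mul_assoc, ← mul_assoc] at this
    refine le_trans (le_of_eq ?_) this
    rw [deriv_circleMap, smul_eq_mul, norm_mul, norm_mul, norm_mul, Complex.norm_I, mul_one]
  refine (intervalIntegral.norm_integral_le_of_norm_le (by positivity)
    (Eventually.of_forall fun θ _ => hbound θ)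
    (Continuous.intervalIntegrable (by fun_prop) _ _)).trans ?_
  rw [intervalIntegral.integral_const_mul]
  refine mul_le_mul_of_nonneg_left ?_ hK0
  have i1 : ∀ c : ℝ, IntervalIntegrable (fun _ : ℝ => c) volume 0 (2 * π) :=
    fun c => intervalIntegrable_const
  have i2 := c1.intervalIntegrable (μ := volume) 0 (2 * π)
  have i3 := c2.intervalIntegrable (μ := volume) 0 (2 * π)
  have i4 := (c3.intervalIntegrable (μ := volume) 0 (2 * π)).const_mul (R ^ (1 - α))
  rw [intervalIntegral.integral_add ((((i1 ε).add i2).add (i1 (1 / R))).add i3) i4,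
    intervalIntegral.integral_add (((i1 ε).add i2).add (i1 (1 / R))) i3,
    intervalIntegral.integral_add ((i1 ε).add i2) (i1 (1 / R)),
    intervalIntegral.integral_add (i1 ε) i2, intervalIntegral.integral_const_mul,
    intervalIntegral.integral_const, intervalIntegral.integral_const, smul_eq_mul, smul_eq_mul,
    sub_zero]
  have j1 := integral_exp_neg_abs_cos_le hsq
  have j2 := integral_exp_neg_abs_cos_le (mul_pos ht hR)
  have j3 := mul_le_mul_of_nonneg_left
    (integral_exp_neg_abs_cos_le (mul_pos (half_pos ht) hR)) (Real.rpow_nonneg hR.le (1 - α))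
  have k1 : 2 * π / √R = 2 * π * (√R)⁻¹ := by rw [div_eq_mul_inv]
  have k2 : 2 * π / (t * R) = 2 * π / t * R⁻¹ := by field_simp
  have k3 : R ^ (1 - α) * (2 * π / (t / 2 * R)) = 4 * π / t * R ^ (-α) := by
    rw [sub_eq_add_neg, Real.rpow_add hR, Real.rpow_one]
    field_simp
    ring
  have k4 : 2 * π * (1 / R) = 2 * π * R⁻¹ := by rw [one_div]
  rw [k1] at j1
  rw [k2] at j2
  rw [k3] at j3
  rw [k4]
  linarith

/-- Modal expansion of a homogeneous solution, summed over growing circles. -/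
theorem IsMildSolution.tendsto_sum_roots {N : ℕ} {a : ℝ} {ad : ℕ → ℝ} {m : ℕ}
    (hm : IsLeading N ad m) {h : ℝ} (hh : 0 < h)
    (hsimple : ∀ s : ℂ, charFun N a ad h s = 0 → deriv (charFun N a ad h) s ≠ 0)
    {x₀ : ℂ} {φ y : ℝ → ℂ}
    (hy : IsMildSolution N a ad h x₀ φ y) {B : ℝ} (hφ : ∀ τ, -(N * h) ≤ τ → τ < 0 → ‖φ τ‖ ≤ B)
    {t : ℝ} (ht : 0 < t) : Tendsto (fun n =>
      ∑ z ∈ (finite_roots_norm_le hsimple (goodRadius ad h m n)).toFinset,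
        modeCoeff N ad h z * (x₀ + initTransform N ad h φ z) * cexp (z * t)) atTop (𝓝 (y t)) := by
  have hlim := hy.tendsto_circleIntegral_contourRemainder hm hh hφ ht
  have hNh : 0 ≤ (N : ℝ) * h := by positivity
  have hfd : Differentiable ℂ fun s : ℂ => cexp (s * t) * (x₀ + initTransform N ad h φ s) := by
    have := differentiable_initTransform ad hh (hy.intervalIntegrable_preshape hh)
    fun_prop
  have hLd : Differentiable ℂ (truncLaplace y t) :=
    differentiable_integral_mul_exp ((hy.integrable t ht.le).mono_set (by
      rw [uIcc_of_le ht.le, uIcc_of_le (by linarith)]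
      exact Icc_subset_Icc_left (by linarith)))
  have hLd' : Differentiable ℂ fun s : ℂ => cexp (s * t) * truncLaplace y t s := by fun_prop
  have h2πI : (2 * π * I : ℂ) ≠ 0 := by simp [Real.pi_ne_zero]
  have hfin : Tendsto (fun n => (2 * π * I : ℂ)⁻¹ * (∮ s in C(0, goodRadius ad h m n),
      contourRemainder N a ad h x₀ φ y t s) + y t) atTop (𝓝 (y t)) := by
    simpa using (hlim.const_mul (2 * π * I : ℂ)⁻¹).add_const (y t)
  refine hfin.congr' ?_
  filter_upwards [charFun_ge_on_goodRadius a hm hh,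
    (tendsto_goodRadius hm hh).eventually_gt_atTop 0] with n hn hR
  set R := goodRadius ad h m n with hRdef
  have hne : ∀ s : ℂ, ‖s‖ = R → charFun N a ad h s ≠ 0 := by
    intro s hs h0
    have h1 := hn s hs
    rw [h0, norm_zero] at h1
    have := norm_nonneg (lead ad h m s)
    linarith
  have hsphere : ∀ s ∈ Metric.sphere (0 : ℂ) R, ‖s‖ = R := fun s hs => by simpa using hs
  have hres := circleIntegral_div_eq_sum hR
    (finite_roots_norm_le hsimple R).toFinset _ _ hfd (differentiable_charFun N a ad h)
    (fun z hz => by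
      have hz' := (Finite.mem_toFinset _).1 hz
      exact ⟨lt_of_le_of_ne hz'.2 fun h => hne z h hz'.1, hz'.1, hsimple z hz'.1⟩)
    (fun s hs h0 => (Finite.mem_toFinset _).2 ⟨h0, hs⟩)
  -- The entire part contributes nothing, so besides the residues at the roots only the pole at `0`
  -- survives; it is the source of the limit `y t`.
  have hent : (∮ s in C(0, R), cexp (s * t) * truncLaplace y t s) = 0 :=
    Complex.circleIntegral_eq_zero_of_differentiable_on_off_countable hR.le countable_empty
      hLd'.continuous.continuousOn fun s _ => hLd' s
  have hpole : (∮ s in C(0, R), y t / s) = 2 * π * I * y t := by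
    have h1 := circleIntegral.integral_sub_inv_of_mem_ball (c := 0) (w := 0) (R := R) (by simpa)
    simp only [sub_zero] at h1
    simp_rw [div_eq_mul_inv]
    rw [circleIntegral.integral_const_mul, h1]
    ring
  have i1 : CircleIntegrable (fun s => cexp (s * t) * (x₀ + initTransform N ad h φ s) /
      charFun N a ad h s) 0 R := by
    refine ContinuousOn.circleIntegrable hR.le (hfd.continuous.continuousOn.div
      (differentiable_charFun N a ad h).continuous.continuousOn fun s hs => hne s (hsphere s hs))
  have i2 : CircleIntegrable (fun s => cexp (s * t) * truncLaplace y t s) 0 R :=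
    hLd'.continuous.continuousOn.circleIntegrable hR.le
  have i3 : CircleIntegrable (fun s => y t / s) 0 R := by
    refine ContinuousOn.circleIntegrable hR.le (continuousOn_const.div continuousOn_id
      fun s hs h0 => ?_)
    have := hsphere s hs
    rw [show s = 0 from h0, norm_zero] at this
    linarith
  have hsplit : (∮ s in C(0, R), contourRemainder N a ad h x₀ φ y t s) =
      (∮ s in C(0, R), cexp (s * t) * (x₀ + initTransform N ad h φ s) / charFun N a ad h s) -
        (∮ s in C(0, R), cexp (s * t) * truncLaplace y t s) - ∮ s in C(0, R), y t / s := by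
    have i12 : CircleIntegrable (fun s => cexp (s * t) * (x₀ + initTransform N ad h φ s) /
        charFun N a ad h s - cexp (s * t) * truncLaplace y t s) 0 R := i1.sub i2
    rw [← circleIntegral.integral_sub i1 i2, ← circleIntegral.integral_sub i12 i3]
    rfl
  rw [hsplit, hres, hent, hpole, sub_zero, ← mul_sub, inv_mul_cancel_left₀ h2πI, sub_add_cancel]
  refine Finset.sum_congr rfl fun z _ => ?_
  rw [(hasDerivAt_charFun N a ad h z).deriv, modeCoeff_eq_inv_charDeriv, div_eq_mul_inv]
  ring

/-! ### Numbering of the roots and the modal series -/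

/-- A set with finite sublevel sets of `g` can be enumerated with `g` increasing. -/
theorem exists_enumeration_monotone {α : Type*} {X : Set α} {g : α → ℝ} (hX : X.Infinite)
    (hfin : ∀ ρ, {x | x ∈ X ∧ g x ≤ ρ}.Finite) :
    ∃ z : ℕ → α, Function.Injective z ∧ Set.range z = X ∧ Monotone (g ∘ z) := by
  have hc : X.Countable := by
    have : X = ⋃ n : ℕ, {x | x ∈ X ∧ g x ≤ n} := by
      ext x
      simp only [mem_iUnion, mem_ofPred_eq]
      exact ⟨fun hx => (exists_nat_ge (g x)).imp fun n hn => ⟨hx, hn⟩, fun ⟨_, hx, _⟩ => hx⟩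
    rw [this]
    exact countable_iUnion fun n => (hfin n).countable
  obtain ⟨e, he⟩ := Set.countable_iff_exists_injOn.1 hc
  -- The predecessors of `x` in the lexicographic order of `(g, e)`, where `e` breaks ties. Their
  -- finite number ranks `X` injectively in `ℕ`, and the order isomorphism of an infinite subset of
  -- `ℕ` with `ℕ` turns ranks into an enumeration.
  let Y : α → Set α := fun x => {y | y ∈ X ∧ (g y < g x ∨ (g y = g x ∧ e y < e x))}
  have hY : ∀ x, (Y x).Finite := fun x => (hfin (g x)).subset fun y hy =>
    ⟨hy.1, hy.2.elim le_of_lt fun h => h.1.le⟩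
  have hlt : ∀ x ∈ X, ∀ y, (g x < g y ∨ (g x = g y ∧ e x < e y)) → (Y x).ncard < (Y y).ncard := by
    intro x hx y hxy
    refine Set.ncard_lt_ncard ⟨fun w hw => ⟨hw.1, ?_⟩, fun h => ?_⟩ (hY y)
    · rcases hw.2 with h1 | h1 <;> rcases hxy with h2 | h2
      · exact Or.inl (h1.trans h2)
      · exact Or.inl (h1.trans_eq h2.1)
      · exact Or.inl (h1.1.trans_lt h2)
      · exact Or.inr ⟨h1.1.trans h2.1, h1.2.trans h2.2⟩
    · have := (h ⟨hx, hxy⟩ : x ∈ Y x).2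
      simp at this
  have hmono : ∀ x ∈ X, ∀ y ∈ X, (Y x).ncard ≤ (Y y).ncard → g x ≤ g y := by
    intro x _ y hy hxy
    by_contra hcon
    exact absurd (hlt y hy x (Or.inl (not_le.1 hcon))) (not_lt.2 hxy)
  have hinj : InjOn (fun x => (Y x).ncard) X := by
    intro x hx y hy hxy
    simp only at hxy
    have hg := le_antisymm (hmono x hx y hy hxy.le) (hmono y hy x hx hxy.ge)
    refine he hx hy (le_antisymm ?_ ?_) <;> by_contra hcon
    · have := hlt y hy x (Or.inr ⟨hg.symm, not_le.1 hcon⟩); omega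
    · have := hlt x hx y (Or.inr ⟨hg, not_le.1 hcon⟩); omega
  let T : Set ℕ := (fun x => (Y x).ncard) '' X
  have hT : T.Infinite := hX.image hinj
  have : Infinite T := hT.to_subtype
  classical
  let o := Nat.Subtype.orderIsoOfNat T
  choose w hwX hw using fun n => (o n).2
  refine ⟨w, fun m n hmn => ?_, Subset.antisymm ?_ fun x hx => ?_, fun m n hmn => ?_⟩
  · refine o.injective (Subtype.ext ?_)
    rw [← hw, ← hw, hmn]
  · rintro _ ⟨n, rfl⟩
    exact hwX n
  · refine ⟨o.symm ⟨_, x, hx, rfl⟩, hinj (hwX _) hx ?_⟩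
    rw [hw, OrderIso.apply_symm_apply]
  · refine hmono _ (hwX m) _ (hwX n) ?_
    have h1 := hw m
    have h2 := hw n
    simp only at h1 h2
    rw [h1, h2]
    exact o.monotone hmn

/-- If `g` has no large gaps on `X`, then `X` can be numbered by the integers so that the order
agrees with the size of `g` up to a bounded error. -/
theorem exists_int_numbering {α : Type*} {X : Set α} {g : α → ℝ} {B : ℝ}
    (hfin : ∀ ρ, {x | x ∈ X ∧ g x ≤ ρ}.Finite) (hgap : ∀ ρ, ∃ x ∈ X, ρ < g x ∧ g x ≤ max ρ 0 + B)
    (hg : ∀ x, 0 ≤ g x) :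
    ∃ S : ℤ → α, Function.Injective S ∧ Set.range S = X ∧
      ∀ k l : ℤ, |k| ≤ |l| → g (S k) ≤ g (S l) + B := by
  have hX : X.Infinite := by
    intro hf
    obtain ⟨ρ, hρ⟩ := (hf.image g).bddAbove
    obtain ⟨x, hx, h1, -⟩ := hgap ρ
    exact absurd (hρ ⟨x, hx, rfl⟩) (not_le.2 h1)
  obtain ⟨z, hz, hzX, hmono⟩ := exists_enumeration_monotone hX hfin
  have hstep : ∀ n, g (z (n + 1)) ≤ g (z n) + B := by
    intro n
    obtain ⟨x, hx, h1, h2⟩ := hgap (g (z n))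
    rw [max_eq_left (hg _)] at h2
    rw [← hzX] at hx
    obtain ⟨k, rfl⟩ := hx
    have : n < k := by
      by_contra hk
      exact absurd (hmono (not_lt.1 hk)) (not_le.2 h1)
    exact (hmono this).trans h2
  -- The integers are taken in the order `0, -1, 1, -2, 2, ...`. Hence `|k| ≤ |l|` can put `k` at
  -- most one place after `l`, and one place costs at most `B`.
  have hσ : ∀ k : ℤ, (Equiv.intEquivNat k : ℤ) ≤ 2 * |k| ∧ 2 * |k| ≤ Equiv.intEquivNat k + 1 := by
    intro k
    cases k with
    | ofNat k =>
      have : Equiv.intEquivNat (Int.ofNat k) = 2 * k := rfl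
      rw [this, Int.ofNat_eq_natCast, abs_of_nonneg (by positivity)]
      push_cast
      omega
    | negSucc k =>
      have : Equiv.intEquivNat (Int.negSucc k) = 2 * k + 1 := rfl
      rw [this, Int.negSucc_eq, abs_neg, abs_of_nonneg (by positivity)]
      push_cast
      omega
  refine ⟨fun k => z (Equiv.intEquivNat k), hz.comp Equiv.intEquivNat.injective, ?_,
    fun k l hkl => ?_⟩
  · rw [← hzX]
    exact Equiv.intEquivNat.surjective.range_comp z
  · have h1 := (hσ k).1
    have h2 := (hσ l).2
    have : Equiv.intEquivNat k ≤ Equiv.intEquivNat l + 1 := by omega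
    exact (hmono this).trans (hstep _)

/-- Roots occur near equally spaced heights from some index on; `B` absorbs the spacing and the
finitely many initial heights. -/
theorem exists_root_im_gap {N : ℕ} (a : ℝ) {ad : ℕ → ℝ} {m : ℕ} (hm : IsLeading N ad m)
    {h : ℝ} (hh : 0 < h) : ∃ B, ∀ ρ : ℝ, ∃ s : ℂ, charFun N a ad h s = 0 ∧
      ρ < |s.im| ∧ |s.im| ≤ max ρ 0 + B := by
  have hp := hm.delay_pos hh
  set p := (m : ℝ) * h with hpdef
  have hπ := Real.pi_pos
  obtain ⟨n₀, hn₀⟩ := eventually_atTop.1 (exists_root_near a hm hh)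
  refine ⟨2 * π * (n₀ + 2) / p + (π + 3) / p, fun ρ => ?_⟩
  have hρ0 : 0 ≤ max ρ 0 := le_max_right _ _
  -- The summand `π` covers the quarter turn, and `2` covers the distance of the root from its
  -- predicted height, both scaled by `p`.
  set n := n₀ + ⌈(max ρ 0 * p + π + 2) / (2 * π)⌉₊ with hn
  have hc1 := Nat.le_ceil ((max ρ 0 * p + π + 2) / (2 * π))
  have hc2 := Nat.ceil_lt_add_one (a := (max ρ 0 * p + π + 2) / (2 * π)) (by positivity)
  rw [div_le_iff₀ (by positivity)] at hc1
  rw [← sub_lt_iff_lt_add, lt_div_iff₀ (by positivity)] at hc2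
  obtain ⟨s, hs, hsn⟩ := hn₀ n (by omega)
  obtain ⟨q1, q2⟩ := abs_le.1 (abs_quarterTurn_le (ad m))
  have hH : rootHeight ad h m n * p = 2 * π * n - quarterTurn (ad m) := by
    rw [rootHeight, ← hpdef]
    field_simp
  have hnc : (n : ℝ) = n₀ + ⌈(max ρ 0 * p + π + 2) / (2 * π)⌉₊ := by rw [hn]; push_cast; ring
  have hsn' : |s.im * p - rootHeight ad h m n * p| ≤ 1 := by
    rw [← sub_mul, abs_mul, abs_of_pos hp]
    calc _ ≤ 1 / p * p := mul_le_mul_of_nonneg_right hsn hp.le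
      _ = 1 := by field_simp
  obtain ⟨r1, r2⟩ := abs_le.1 hsn'
  have hn0' : 0 ≤ 2 * π * (n₀ : ℝ) := by positivity
  have hlow : max ρ 0 * p < s.im * p := by
    rw [hH, hnc] at r1
    nlinarith
  have hlow' : max ρ 0 < s.im := lt_of_mul_lt_mul_right hlow hp.le
  refine ⟨s, hs, ?_, ?_⟩
  · exact (le_max_left _ _).trans_lt (hlow'.trans_le (le_abs_self _))
  · rw [abs_of_pos (hρ0.trans_lt hlow')]
    refine le_of_mul_le_mul_right ?_ hp
    have : (max ρ 0 + (2 * π * (n₀ + 2) / p + (π + 3) / p)) * p =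
        max ρ 0 * p + 2 * π * (n₀ + 2) + (π + 3) := by field_simp; ring
    rw [this]
    rw [hH, hnc] at r2
    nlinarith

theorem exists_isRootNumbering {N : ℕ} (a : ℝ) {ad : ℕ → ℝ} {m : ℕ} (hm : IsLeading N ad m)
    {h : ℝ} (hh : 0 < h)
    (hsimple : ∀ s : ℂ, charFun N a ad h s = 0 → deriv (charFun N a ad h) s ≠ 0) :
    ∃ S : ℤ → ℂ, IsRootNumbering N a ad h S := by
  obtain ⟨B, hB⟩ := exists_root_im_gap a hm hh
  obtain ⟨S, h1, h2, h3⟩ := exists_int_numbering (X := {s : ℂ | charFun N a ad h s = 0})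
    (g := fun s => |s.im|) (finite_roots_abs_im_le hm hh hsimple) hB fun s => abs_nonneg _
  exact ⟨S, h1, h2, B, h3⟩

/-- Separation in the form of an injective integer label `⌊Im s / η⌋`, used for counting roots and
for comparison with a series over `ℤ`. -/
theorem root_eq_of_abs_im_large {N : ℕ} (a : ℝ) {ad : ℕ → ℝ} {m : ℕ} (hm : IsLeading N ad m)
    {h : ℝ} (hh : 0 < h) : ∃ ρ η : ℝ, 0 < ρ ∧ 0 < η ∧ ∀ s s' : ℂ, charFun N a ad h s = 0 →
      charFun N a ad h s' = 0 → ρ ≤ |s.im| → ρ ≤ |s'.im| → ⌊s.im / η⌋ = ⌊s'.im / η⌋ → s = s' := by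
  obtain ⟨R, η, hR, hη, hs⟩ := root_eq_of_im_close a hm hh
  refine ⟨R, η, hR, hη, fun s s' h1 h2 h3 h4 h5 => hs s s' h1 h2 (h3.trans (abs_im_le_norm s))
    (h4.trans (abs_im_le_norm s')) ?_⟩
  have := Int.abs_sub_lt_one_of_floor_eq_floor h5
  rw [← sub_div, abs_div, abs_of_pos hη, div_lt_one hη] at this
  exact this.le

/-- The roots with imaginary part of prescribed size have bounded multiplicity. -/
theorem card_roots_abs_im_near_le {N : ℕ} (a : ℝ) {ad : ℕ → ℝ} {m : ℕ} (hm : IsLeading N ad m)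
    {h : ℝ} (hh : 0 < h) (c : ℝ) : ∃ (ρ₀ : ℝ) (K : ℕ), ∀ ρ ≥ ρ₀, ∀ F : Finset ℂ,
      (∀ s ∈ F, charFun N a ad h s = 0 ∧ |(|s.im| - ρ)| ≤ c) → F.card ≤ K := by
  obtain ⟨ρ₁, η, hρ₁, hη, hs⟩ := root_eq_of_abs_im_large a hm hh
  refine ⟨ρ₁ + c, 2 * (⌈2 * c / η⌉₊ + 2), fun ρ hρ F hF => ?_⟩
  have hcard : ∀ r : ℝ, (Finset.Icc ⌊(r - c) / η⌋ ⌊(r + c) / η⌋).card ≤ ⌈2 * c / η⌉₊ + 2 := by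
    intro r
    rw [Int.card_Icc]
    have h1 := Int.floor_le ((r + c) / η)
    have h2 := Int.lt_floor_add_one ((r - c) / η)
    have h3 := Nat.le_ceil (2 * c / η)
    have h4 : (r + c) / η = (r - c) / η + 2 * c / η := by ring
    have h5 : ((⌊(r + c) / η⌋ : ℤ) : ℝ) < ⌊(r - c) / η⌋ + 1 + ⌈2 * c / η⌉₊ := by linarith
    have h6 : ⌊(r + c) / η⌋ < ⌊(r - c) / η⌋ + 1 + ⌈2 * c / η⌉₊ := by exact_mod_cast h5
    omega
  have hmem : ∀ (r : ℝ) (x : ℝ), |x - r| ≤ c →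
      ⌊x / η⌋ ∈ Finset.Icc ⌊(r - c) / η⌋ ⌊(r + c) / η⌋ := by
    intro r x hx
    obtain ⟨h1, h2⟩ := abs_le.1 hx
    rw [Finset.mem_Icc]
    constructor <;> apply Int.floor_le_floor <;> gcongr <;> linarith
  classical
  calc F.card ≤ (Finset.Icc ⌊(ρ - c) / η⌋ ⌊(ρ + c) / η⌋ ∪
        Finset.Icc ⌊(-ρ - c) / η⌋ ⌊(-ρ + c) / η⌋).card := by
        refine Finset.card_le_card_of_injOn (fun s : ℂ => ⌊s.im / η⌋) (fun s hsF => ?_)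
          fun s hsF s' hsF' heq => ?_
        · have := (hF s hsF).2
          rw [Finset.mem_coe, Finset.mem_union]
          rcases abs_cases s.im with ⟨h1, -⟩ | ⟨h1, -⟩
          · exact Or.inl (hmem _ _ (by rwa [h1] at this))
          · refine Or.inr (hmem _ _ ?_)
            rwa [h1, show -s.im - ρ = -(s.im - -ρ) by ring, abs_neg] at this
        · have h1 := hF s hsF
          have h2 := hF s' hsF'
          exact hs s s' h1.1 h2.1 (by have := (abs_le.1 h1.2).1; linarith)
            (by have := (abs_le.1 h2.2).1; linarith) heq
    _ ≤ _ := Finset.card_union_le _ _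
    _ ≤ _ := by have := hcard ρ; have := hcard (-ρ); omega

/-! ### Size of the modal terms and summation -/

theorem norm_exp_neg_delay_le_of_root {N : ℕ} (a : ℝ) {ad : ℕ → ℝ} {m : ℕ} (hm : IsLeading N ad m)
    (h : ℝ) : ∃ R, 0 < R ∧ ∀ s : ℂ, charFun N a ad h s = 0 → R ≤ ‖s‖ →
      Real.exp (-(m * h * s.re)) ≤ 2 / |ad m| * ‖s‖ := by
  have hA : 0 < |ad m| := abs_pos.2 hm.ne
  obtain ⟨R, hR, h1⟩ := lead_comparable_of_root a hm h one_pos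
  refine ⟨R, hR, fun s hs hsR => ?_⟩
  have h2 := (h1 s hs hsR).2
  rw [norm_lead] at h2
  rw [div_mul_eq_mul_div, le_div_iff₀ hA, mul_comm]
  refine le_trans (le_of_eq ?_) (h2.trans (le_of_eq (by ring)))
  ring_nf

theorem norm_modeCoeff_le_of_root {N : ℕ} (a : ℝ) {ad : ℕ → ℝ} {m : ℕ} (hm : IsLeading N ad m)
    {h : ℝ} (hh : 0 < h) : ∃ R, 0 < R ∧ ∀ s : ℂ, charFun N a ad h s = 0 → R ≤ ‖s‖ →
      ‖modeCoeff N ad h s‖ ≤ 4 / (m * h) * ‖s‖⁻¹ := by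
  have hp := hm.delay_pos hh
  obtain ⟨R, hR, h1⟩ := charDeriv_ge_of_root a hm hh
  refine ⟨R, hR, fun s hs hsR => ?_⟩
  have hs0 := hR.trans_le hsR
  rw [modeCoeff_eq_inv_charDeriv, norm_inv]
  calc _ ≤ (m * h / 4 * ‖s‖)⁻¹ := inv_anti₀ (by positivity) (h1 s hs hsR)
    _ = _ := by field_simp

/-- The terms of the modal series of the fundamental solution. -/
theorem norm_mode_le_of_root {N : ℕ} (a : ℝ) {ad : ℕ → ℝ} {m : ℕ} (hm : IsLeading N ad m)
    {h : ℝ} (hh : 0 < h) {t : ℝ} (ht : 0 < t) : ∃ R K, 0 < R ∧ 0 ≤ K ∧ ∀ s : ℂ,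
      charFun N a ad h s = 0 → R ≤ ‖s‖ →
      ‖modeCoeff N ad h s * cexp (s * t)‖ ≤ K * ‖s‖ ^ (-(1 + t / (m * h))) := by
  have hp := hm.delay_pos hh
  obtain ⟨R₁, hR₁, h1⟩ := norm_modeCoeff_le_of_root a hm hh
  obtain ⟨R₂, K, hR₂, hK, h2⟩ := norm_exp_le_of_root a hm hh ht
  refine ⟨max R₁ R₂, 4 / (m * h) * K, lt_max_of_lt_left hR₁, by positivity, fun s hs hsR => ?_⟩
  have hs0 : 0 < ‖s‖ := (lt_max_of_lt_left hR₁).trans_le hsR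
  rw [norm_mul]
  calc _ ≤ 4 / (m * h) * ‖s‖⁻¹ * (K * ‖s‖ ^ (-(t / (m * h)))) :=
        mul_le_mul (h1 s hs ((le_max_left _ _).trans hsR)) (h2 s hs ((le_max_right _ _).trans hsR))
          (norm_nonneg _) (by positivity)
    _ = _ := by
        rw [neg_add, Real.rpow_add hs0, Real.rpow_neg_one]
        ring

/-- The terms of the modal series of a homogeneous solution. -/
theorem norm_mode_init_le_of_root {N : ℕ} (a : ℝ) {ad : ℕ → ℝ} {m : ℕ} (hm : IsLeading N ad m)
    {h : ℝ} (hh : 0 < h) {φ : ℝ → ℂ} {B : ℝ} (hφ : ∀ τ, -(N * h) ≤ τ → τ < 0 → ‖φ τ‖ ≤ B)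
    (x₀ : ℂ) {t : ℝ} (ht : 0 < t) : ∃ R K, 0 < R ∧ 0 ≤ K ∧ ∀ s : ℂ,
      charFun N a ad h s = 0 → R ≤ ‖s‖ →
      ‖modeCoeff N ad h s * (x₀ + initTransform N ad h φ s) * cexp (s * t)‖ ≤
        K * ‖s‖ ^ (-(t / (m * h))) := by
  have hA : 0 < |ad m| := abs_pos.2 hm.ne
  obtain ⟨R₁, K₁, hR₁, hK₁, h1⟩ := norm_mode_le_of_root a hm hh ht
  obtain ⟨R₂, hR₂, h2⟩ := norm_exp_neg_delay_le_of_root a hm h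
  obtain ⟨K, hK, h3⟩ := norm_initTransform_le hm hh hφ
  refine ⟨max (max R₁ R₂) 1, K₁ * (‖x₀‖ + K * (1 + 2 / |ad m|)), by positivity, by positivity,
    fun s hs hsR => ?_⟩
  have hs1 : 1 ≤ ‖s‖ := (le_max_right _ _).trans hsR
  have hs0 : 0 < ‖s‖ := one_pos.trans_le hs1
  have h4 := h1 s hs ((le_max_left _ _).trans ((le_max_left _ _).trans hsR))
  have h5 := h2 s hs ((le_max_right _ _).trans ((le_max_left _ _).trans hsR))
  have h6 : ‖x₀ + initTransform N ad h φ s‖ ≤ (‖x₀‖ + K * (1 + 2 / |ad m|)) * ‖s‖ := by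
    calc _ ≤ ‖x₀‖ + K * (1 + 2 / |ad m| * ‖s‖) :=
          (norm_add_le _ _).trans (add_le_add le_rfl
            ((h3 s).trans (mul_le_mul_of_nonneg_left (by linarith) hK)))
      _ ≤ ‖x₀‖ * ‖s‖ + K * (1 * ‖s‖ + 2 / |ad m| * ‖s‖) := by
          gcongr
          · exact le_mul_of_one_le_right (norm_nonneg _) hs1
          · rwa [one_mul]
      _ = _ := by ring
  rw [mul_right_comm, norm_mul]
  calc _ ≤ K₁ * ‖s‖ ^ (-(1 + t / (m * h))) * ((‖x₀‖ + K * (1 + 2 / |ad m|)) * ‖s‖) :=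
        mul_le_mul h4 h6 (norm_nonneg _) (by positivity)
    _ = _ := by
        rw [neg_add, Real.rpow_add hs0, Real.rpow_neg_one]
        field_simp

theorem IsRootNumbering.charFun_eq_zero {N : ℕ} {a : ℝ} {ad : ℕ → ℝ} {h : ℝ} {S : ℤ → ℂ}
    (hS : IsRootNumbering N a ad h S) (k : ℤ) : charFun N a ad h (S k) = 0 := by
  have : S k ∈ Set.range S := ⟨k, rfl⟩
  rwa [hS.range_eq] at this

theorem IsRootNumbering.tendsto_abs_im {N : ℕ} {a : ℝ} {ad : ℕ → ℝ} {m : ℕ}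
    (hm : IsLeading N ad m) {h : ℝ} (hh : 0 < h)
    (hsimple : ∀ s : ℂ, charFun N a ad h s = 0 → deriv (charFun N a ad h) s ≠ 0)
    {S : ℤ → ℂ} (hS : IsRootNumbering N a ad h S) :
    Tendsto (fun k => |(S k).im|) cofinite atTop := by
  refine tendsto_atTop.2 fun ρ => ?_
  have : {k | |(S k).im| ≤ ρ}.Finite :=
    ((finite_roots_abs_im_le hm hh hsimple ρ).preimage hS.injective.injOn).subset
      fun k hk => ⟨hS.charFun_eq_zero k, hk⟩
  refine (this.subset fun k hk => ?_ : {k | ¬ ρ ≤ |(S k).im|}.Finite)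
  exact (not_le.1 hk).le

/-- Absolute convergence of the modal series of the fundamental solution. -/
theorem IsRootNumbering.summable_mode {N : ℕ} {a : ℝ} {ad : ℕ → ℝ} {m : ℕ}
    (hm : IsLeading N ad m) {h : ℝ} (hh : 0 < h)
    (hsimple : ∀ s : ℂ, charFun N a ad h s = 0 → deriv (charFun N a ad h) s ≠ 0)
    {S : ℤ → ℂ} (hS : IsRootNumbering N a ad h S) {t : ℝ} (ht : 0 < t) :
    Summable fun k : ℤ => modeCoeff N ad h (S k) * cexp (S k * t) := by
  have hp := hm.delay_pos hh
  obtain ⟨ρ₁, η, hρ₁, hη, hsep⟩ := root_eq_of_abs_im_large a hm hh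
  obtain ⟨R, K, hR, hK, hb⟩ := norm_mode_le_of_root a hm hh ht
  set α := 1 + t / (m * h) with hα
  have hα1 : 1 < α := by rw [hα]; linarith [div_pos ht hp]
  -- The bound `2η` keeps `|Im s / η| ≥ 2`, so the integer label is nonzero and at most twice that
  -- size.
  set ρ := max (max ρ₁ R) (2 * η) with hρ
  have hρ1 : ρ₁ ≤ ρ := (le_max_left _ _).trans (le_max_left _ _)
  have hρ2 : R ≤ ρ := (le_max_right _ _).trans (le_max_left _ _)
  have hρ3 : 2 * η ≤ ρ := le_max_right _ _
  let T : Set ℤ := {k | ρ ≤ |(S k).im|}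
  let n : ℤ → ℤ := fun k => ⌊(S k).im / η⌋
  have hn : Function.Injective fun k : T => n k := fun k l hkl => Subtype.ext (hS.injective
    (hsep _ _ (hS.charFun_eq_zero _) (hS.charFun_eq_zero _) (hρ1.trans k.2) (hρ1.trans l.2) hkl))
  -- Distinct large roots have distinct labels, so the terms are dominated by those of `∑ |n|^{-α}`
  -- with `α > 1`.
  have hsum : Summable (T.indicator fun k => K * (η / 2) ^ (-α) * |(n k : ℝ)| ^ (-α)) := by
    refine summable_subtype_iff_indicator.1 ?_
    exact ((Real.summable_abs_int_rpow hα1).comp_injective hn).mul_left (K * (η / 2) ^ (-α))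
  refine Summable.of_norm_bounded_eventually hsum ?_
  filter_upwards [(hS.tendsto_abs_im hm hh hsimple).eventually_ge_atTop ρ] with k hk
  rw [indicator_of_mem (show k ∈ T from hk)]
  have him := abs_im_le_norm (S k)
  refine (hb _ (hS.charFun_eq_zero k) (hρ2.trans (hk.trans him))).trans ?_
  rw [mul_assoc, ← Real.mul_rpow (by positivity) (abs_nonneg _)]
  have hf : |(n k : ℝ) - (S k).im / η| ≤ 1 := by
    have h1 := Int.floor_le ((S k).im / η)
    have h2 := Int.lt_floor_add_one ((S k).im / η)
    exact abs_le.2 ⟨by simp only [n]; linarith, by simp only [n]; linarith⟩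
  have hq : 2 ≤ |(S k).im / η| := by
    rw [abs_div, abs_of_pos hη, le_div_iff₀ hη]
    exact hρ3.trans hk
  have hab := abs_le.1 ((abs_abs_sub_abs_le _ _).trans hf)
  refine mul_le_mul_of_nonneg_left (Real.rpow_le_rpow_of_nonpos ?_ ?_ (by linarith)) hK
  · have : 0 < |(n k : ℝ)| := by linarith
    positivity
  · calc η / 2 * |(n k : ℝ)| ≤ η / 2 * (2 * |(S k).im / η|) :=
          mul_le_mul_of_nonneg_left (by linarith) (by positivity)
      _ = |(S k).im| := by rw [abs_div, abs_of_pos hη]; field_simp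
      _ ≤ _ := him

/-- Sums over circles and symmetric partial sums have the same limit. -/
theorem IsRootNumbering.hasSum_symmetricIcc {N : ℕ} {a : ℝ} {ad : ℕ → ℝ} {m : ℕ}
    (hm : IsLeading N ad m) {h : ℝ} (hh : 0 < h)
    (hsimple : ∀ s : ℂ, charFun N a ad h s = 0 → deriv (charFun N a ad h) s ≠ 0)
    {S : ℤ → ℂ} (hS : IsRootNumbering N a ad h S) {f : ℂ → ℂ} {R K α : ℝ} (hα : 0 < α)
    (hf : ∀ s, charFun N a ad h s = 0 → R ≤ ‖s‖ → ‖f s‖ ≤ K * ‖s‖ ^ (-α)) {y : ℂ}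
    (hy : Tendsto (fun n => ∑ z ∈ (finite_roots_norm_le hsimple (goodRadius ad h m n)).toFinset,
      f z) atTop (𝓝 y)) :
    HasSum (fun k => f (S k)) y (SummationFilter.symmetricIcc ℤ) := by
  classical
  rw [SummationFilter.hasSum_symmetricIcc_iff]
  have hp := hm.delay_pos hh
  have hπ := Real.pi_pos
  obtain ⟨B, hB⟩ := hS.ordered
  have hB0 : 0 ≤ B := by have := hB 0 0 le_rfl; linarith
  obtain ⟨R₁, hR₁, him⟩ := norm_root_le_abs_im_add a hm hh one_pos
  have hnorm : ∀ s, charFun N a ad h s = 0 → ‖s‖ ≤ |s.im| + (1 + R₁) := by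
    intro s hs
    rcases le_or_gt R₁ ‖s‖ with h1 | h1
    · linarith [him s hs h1]
    · linarith [abs_nonneg s.im]
  set ρ : ℕ → ℝ := fun M => |(S M).im| with hρdef
  have hρ : Tendsto ρ atTop atTop := by
    have := (hS.tendsto_abs_im hm hh hsimple).comp
      (Nat.cast_injective (R := ℤ)).tendsto_cofinite
    rwa [Nat.cofinite_eq_atTop] at this
  -- The good circle whose radius is within `c₁` of `|Im S_M|`.
  let n : ℕ → ℕ := fun M => ⌊ρ M * (m * h) / (2 * π)⌋₊
  have hn : Tendsto n atTop atTop :=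
    tendsto_nat_floor_atTop.comp ((hρ.atTop_mul_const hp).atTop_div_const (by positivity))
  set c₁ := 3 * π / (m * h) with hc₁
  have hrad : ∀ M, |goodRadius ad h m (n M) - ρ M| ≤ c₁ := by
    intro M
    have h0 : 0 ≤ ρ M := abs_nonneg _
    have h1 := Nat.floor_le (a := ρ M * (m * h) / (2 * π)) (by positivity)
    have h2 := Nat.lt_floor_add_one (ρ M * (m * h) / (2 * π))
    rw [le_div_iff₀ (by positivity)] at h1
    rw [div_lt_iff₀ (by positivity)] at h2
    obtain ⟨q1, q2⟩ := abs_le.1 (abs_quarterTurn_le (ad m))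
    have : goodRadius ad h m (n M) - ρ M =
        (2 * π * n M + quarterTurn (ad m) - ρ M * (m * h)) / (m * h) := by
      rw [goodRadius, sub_div, mul_div_cancel_right₀ _ hp.ne']
    rw [this, abs_div, abs_of_pos hp, hc₁]
    refine div_le_div_of_nonneg_right (abs_le.2 ⟨?_, ?_⟩) hp.le <;> simp only [n] <;> nlinarith
  -- The ordering error, the mismatch of the radius, and the gap between `|s|` and `|Im s|` at
  -- roots. Every root counted by only one of the two sums has its height within `c` of `ρ M`.
  set c := B + c₁ + (1 + R₁) with hcdef
  have hc₁0 : 0 ≤ c₁ := by positivity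
  obtain ⟨ρ₀, L, hL⟩ := card_roots_abs_im_near_le a hm hh c
  set D : ℕ → Finset ℂ := fun M =>
    (finite_roots_norm_le hsimple (goodRadius ad h m (n M))).toFinset with hD
  set E : ℕ → Finset ℂ := fun M => (Finset.Icc (-(M : ℤ)) M).image S with hE
  have hsumE : ∀ M : ℕ, ∑ k ∈ Finset.Icc (-(M : ℤ)) M, f (S k) = ∑ z ∈ E M, f z := fun M =>
    (Finset.sum_image hS.injective.injOn).symm
  simp_rw [hsumE]
  have hDlim : Tendsto (fun M => ∑ z ∈ D M, f z) atTop (𝓝 y) := hy.comp hn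
  have hMabs : ∀ M : ℕ, |(M : ℤ)| = M := fun M => abs_of_nonneg (by positivity)
  have hED : ∀ M, ∀ z ∈ E M \ D M, charFun N a ad h z = 0 ∧ |(|z.im| - ρ M)| ≤ c := by
    intro M z hz
    rw [Finset.mem_sdiff] at hz
    obtain ⟨k, hk, rfl⟩ := Finset.mem_image.1 hz.1
    have h0 := hS.charFun_eq_zero k
    rw [Finset.mem_Icc] at hk
    have h1 := hB k M (by rw [hMabs]; exact abs_le.2 hk)
    have h2 : goodRadius ad h m (n M) < ‖S k‖ := by
      by_contra hcon
      exact hz.2 ((Finite.mem_toFinset _).2 ⟨h0, not_lt.1 hcon⟩)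
    have h3 := hnorm _ h0
    have h4 := (abs_le.1 (hrad M)).1
    refine ⟨h0, abs_le.2 ⟨by linarith, ?_⟩⟩
    simp only [hρdef]
    linarith
  have hDE : ∀ M, ∀ z ∈ D M \ E M, charFun N a ad h z = 0 ∧ |(|z.im| - ρ M)| ≤ c := by
    intro M z hz
    rw [Finset.mem_sdiff] at hz
    obtain ⟨h0, h1⟩ := (Finite.mem_toFinset _).1 hz.1
    have h2 : z ∈ Set.range S := by rw [hS.range_eq]; exact h0
    obtain ⟨k, rfl⟩ := h2
    have h3 : ¬ |k| ≤ |(M : ℤ)| := fun hcon => hz.2 (Finset.mem_image.2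
      ⟨k, Finset.mem_Icc.2 (abs_le.1 (by rwa [hMabs] at hcon)), rfl⟩)
    have h4 := hB M k (not_le.1 h3).le
    have h5 := (abs_le.1 (hrad M)).2
    have h6 := abs_im_le_norm (S k)
    refine ⟨h0, abs_le.2 ⟨?_, by linarith⟩⟩
    simp only [hρdef]
    linarith
  -- The two sums differ by at most `2L` terms, each `O(ρ^{-α})`.
  have hdiff : Tendsto (fun M => ∑ z ∈ E M, f z - ∑ z ∈ D M, f z) atTop (𝓝 0) := by
    have hlim : Tendsto (fun M => 2 * L * (max K 0 * (ρ M - c) ^ (-α))) atTop (𝓝 0) := by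
      have h1 := (tendsto_rpow_neg_atTop hα).comp (tendsto_atTop_add_const_right _ (-c) hρ)
      simpa [← sub_eq_add_neg, Function.comp_def] using
        (h1.const_mul (max K 0)).const_mul (2 * L : ℝ)
    refine squeeze_zero_norm' ?_ hlim
    filter_upwards [hρ.eventually_ge_atTop ρ₀, hρ.eventually_gt_atTop (c + max R 0)] with M hM hM'
    have hpos : 0 < ρ M - c := by linarith [le_max_right R 0]
    have hR' : R ≤ ρ M - c := by linarith [le_max_left R 0]
    have hterm : ∀ z, charFun N a ad h z = 0 ∧ |(|z.im| - ρ M)| ≤ c →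
        ‖f z‖ ≤ max K 0 * (ρ M - c) ^ (-α) := by
      intro z hz
      have h1 : ρ M - c ≤ ‖z‖ := by linarith [(abs_le.1 hz.2).1, abs_im_le_norm z]
      calc ‖f z‖ ≤ K * ‖z‖ ^ (-α) := hf z hz.1 (hR'.trans h1)
        _ ≤ max K 0 * ‖z‖ ^ (-α) :=
            mul_le_mul_of_nonneg_right (le_max_left _ _) (by positivity)
        _ ≤ _ := mul_le_mul_of_nonneg_left
            (Real.rpow_le_rpow_of_nonpos hpos h1 (by linarith)) (le_max_right _ _)
    have hbd : ∀ F : Finset ℂ, (∀ z ∈ F, charFun N a ad h z = 0 ∧ |(|z.im| - ρ M)| ≤ c) →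
        ‖∑ z ∈ F, f z‖ ≤ L * (max K 0 * (ρ M - c) ^ (-α)) := by
      intro F hF
      calc _ ≤ ∑ z ∈ F, max K 0 * (ρ M - c) ^ (-α) :=
            norm_sum_le_of_le _ fun z hz => hterm z (hF z hz)
        _ = F.card * (max K 0 * (ρ M - c) ^ (-α)) := by rw [Finset.sum_const, nsmul_eq_mul]
        _ ≤ _ := mul_le_mul_of_nonneg_right (by exact_mod_cast hL _ hM F hF) (by positivity)
    rw [← Finset.sum_sdiff_sub_sum_sdiff]
    refine (norm_sub_le _ _).trans ?_
    have h1 := hbd _ (hED M)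
    have h2 := hbd _ (hDE M)
    linarith
  simpa using hdiff.add hDlim

/-- Modal expansion of a homogeneous solution along a numbering of the characteristic roots. -/
theorem IsMildSolution.hasSum_symmetricIcc {N : ℕ} {a : ℝ} {ad : ℕ → ℝ} {m : ℕ}
    (hm : IsLeading N ad m) {h : ℝ} (hh : 0 < h)
    (hsimple : ∀ s : ℂ, charFun N a ad h s = 0 → deriv (charFun N a ad h) s ≠ 0)
    {S : ℤ → ℂ} (hS : IsRootNumbering N a ad h S) {x₀ : ℂ} {φ y : ℝ → ℂ}
    (hy : IsMildSolution N a ad h x₀ φ y) {B : ℝ}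
    (hφ : ∀ τ, -(N * h) ≤ τ → τ < 0 → ‖φ τ‖ ≤ B) {t : ℝ} (ht : 0 < t) :
    HasSum (fun k : ℤ => modeCoeff N ad h (S k) * (x₀ + initTransform N ad h φ (S k)) *
      cexp (S k * t)) (y t) (SummationFilter.symmetricIcc ℤ) := by
  obtain ⟨R, K, -, -, hb⟩ := norm_mode_init_le_of_root a hm hh hφ x₀ ht
  exact hS.hasSum_symmetricIcc hm hh hsimple (div_pos ht (hm.delay_pos hh)) hb
    (hy.tendsto_sum_roots hm hh hsimple hφ ht)

/-- Modal expansion of the fundamental solution. -/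
theorem IsRootNumbering.hasSum_of_isMildSolution {N : ℕ} {a : ℝ} {ad : ℕ → ℝ} {m : ℕ}
    (hm : IsLeading N ad m) {h : ℝ} (hh : 0 < h)
    (hsimple : ∀ s : ℂ, charFun N a ad h s = 0 → deriv (charFun N a ad h) s ≠ 0)
    {S : ℤ → ℂ} (hS : IsRootNumbering N a ad h S) {y : ℝ → ℂ}
    (hy : IsMildSolution N a ad h 1 (fun _ => 0) y) {t : ℝ} (ht : 0 < t) :
    HasSum (fun k : ℤ => modeCoeff N ad h (S k) * cexp (S k * t)) (y t) := by
  have h1 := hy.hasSum_symmetricIcc hm hh hsimple hS (B := 0) (by simp) ht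
  have h2 := hS.summable_mode hm hh hsimple ht
  -- An unconditional sum is also the limit of the symmetric partial sums, so uniqueness of limits
  -- identifies its value.
  have h3 : HasSum _ _ (SummationFilter.symmetricIcc ℤ) :=
    h2.hasSum.mono_left SummationFilter.LeAtTop.le_atTop
  have h4 : ∀ s, initTransform N ad h (fun _ => 0) s = 0 := fun s => by simp [initTransform]
  simp only [h4, add_zero, mul_one] at h1
  rw [h1.unique h3]
  exact h2.hasSum

end DelaySystem

/-! ### Assembly of the theorem -/

theorem mainTheorem2 (N : ℕ) (a b h x₀ : ℝ) (ad : ℕ → ℝ) (φ u : ℝ → ℝ)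
    (hh : 0 < h)
    (had : ∃ j ∈ Finset.Icc 1 N, ad j ≠ 0)
    (hφ : ContinuousOn φ (Set.Icc (-((N : ℝ) * h)) 0))
    (hu : ∀ T : ℝ, 0 < T → IntervalIntegrable u volume 0 T)
    -- every characteristic root is simple
    (hsimple : ∀ s : ℂ, DelaySystem.charFun N a ad h s = 0 →
      deriv (DelaySystem.charFun N a ad h) s ≠ 0) :
    -- the roots are given branch-wise by the Lambert W functions
    (∀ s : ℂ, DelaySystem.charFun N a ad h s = 0 ↔
      ∃ k : ℤ, (k = 0 ∨ DelaySystem.lambertArg N a ad h s ≠ 0) ∧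
        s = 1 / (h : ℂ) * DelaySystem.lambertW k (DelaySystem.lambertArg N a ad h s) + (a : ℂ)) ∧
    -- they can be numbered by the integers
    (∃ S : ℤ → ℂ, DelaySystem.IsRootNumbering N a ad h S) ∧
    ∀ S : ℤ → ℂ, DelaySystem.IsRootNumbering N a ad h S →
      -- the series of the state transition function, absolutely convergent
      (∀ Ψ : ℝ → ℝ, DelaySystem.IsFundamentalSolution N a ad h Ψ → ∀ t : ℝ, 0 < t →
        HasSum (fun k : ℤ => DelaySystem.modeCoeff N ad h (S k) * cexp (S k * (t : ℂ)))
          (Ψ t : ℂ)) ∧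
      -- the series of the time response; the middle one is the limit of its symmetric partial sums
      (∀ x : ℝ → ℝ, DelaySystem.IsSolution N a ad b h x₀ φ u x → ∀ t : ℝ, 0 < t →
        Summable (fun k : ℤ => DelaySystem.modeCoeff N ad h (S k) * cexp (S k * (t : ℂ))) ∧
        Summable (fun k : ℤ => DelaySystem.modeCoeffInit N ad h φ (S k) * cexp (S k * (t : ℂ)))
          (SummationFilter.symmetricIcc ℤ) ∧
        IntervalIntegrable (fun τ : ℝ =>
          (∑' k : ℤ, DelaySystem.modeCoeff N ad h (S k) * cexp (S k * ((t : ℂ) - (τ : ℂ)))) *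
            (b : ℂ) * (u τ : ℂ)) volume 0 t ∧
        (x t : ℂ) =
          (∑' k : ℤ, DelaySystem.modeCoeff N ad h (S k) * cexp (S k * (t : ℂ)) * (x₀ : ℂ)) +
          (∑'[SummationFilter.symmetricIcc ℤ] k : ℤ,
            DelaySystem.modeCoeffInit N ad h φ (S k) * cexp (S k * (t : ℂ))) +
          ∫ τ in (0 : ℝ)..t,
            (∑' k : ℤ, DelaySystem.modeCoeff N ad h (S k) * cexp (S k * ((t : ℂ) - (τ : ℂ)))) *
              (b : ℂ) * (u τ : ℂ)) := by
  obtain ⟨m, hm⟩ := DelaySystem.exists_isLeading had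
  refine ⟨fun s => DelaySystem.charFun_eq_zero_iff_lambertW N a ad hh s,
    DelaySystem.exists_isRootNumbering a hm hh hsimple, fun S hS => ⟨fun Ψ hΨ t ht =>
      hS.hasSum_of_isMildSolution hm hh hsimple (hΨ.isMildSolution hh) ht, fun x hx t ht => ?_⟩⟩
  -- The time response comes without a given `Ψ`; the constructed fundamental solution supplies the
  -- kernel.
  have hmode : ∀ r : ℝ, 0 < r → HasSum
      (fun k : ℤ => DelaySystem.modeCoeff N ad h (S k) * cexp (S k * (r : ℂ)))
      (DelaySystem.fundamentalSol N a ad h r) := fun r hr =>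
    hS.hasSum_of_isMildSolution hm hh hsimple (DelaySystem.isMildSolution_fundamentalSol N a ad hh)
      hr
  obtain ⟨B, hB⟩ := isCompact_Icc.exists_bound_of_continuousOn hφ
  have hx' := (hx.isMildSolution_sub hh hφ hu).hasSum_symmetricIcc hm hh hsimple hS (B := B)
    (fun τ h1 h2 => by
      rw [norm_real]
      exact hB τ ⟨h1, h2.le⟩) ht
  have hx₀ := (hmode t ht).mul_right (x₀ : ℂ)
  have hx₀' : HasSum _ _ (SummationFilter.symmetricIcc ℤ) :=
    hx₀.mono_left SummationFilter.LeAtTop.le_atTop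
  -- The homogeneous part expands with coefficients `C_k x₀ + C^I_k`. Subtracting the absolutely
  -- convergent series of `C_k x₀` isolates the other one.
  have hinit : HasSum
      (fun k : ℤ => DelaySystem.modeCoeffInit N ad h φ (S k) * cexp (S k * (t : ℂ)))
      (x t - DelaySystem.forcedResponse N a ad h (fun τ => (b : ℂ) * u τ) t -
        DelaySystem.fundamentalSol N a ad h t * x₀) (SummationFilter.symmetricIcc ℤ) := by
    refine (hx'.sub hx₀').congr_fun fun k => ?_
    have : DelaySystem.modeCoeffInit N ad h φ (S k) = DelaySystem.modeCoeff N ad h (S k) *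
      DelaySystem.initTransform N ad h (fun τ => (φ τ : ℂ)) (S k) := rfl
    rw [this]
    ring
  have hkernel : ∀ᵐ τ : ℝ, τ ∈ Ι 0 t →
      DelaySystem.fundamentalSol N a ad h (t - τ) * ((b : ℂ) * u τ) =
      (∑' k : ℤ, DelaySystem.modeCoeff N ad h (S k) * cexp (S k * ((t : ℂ) - (τ : ℂ)))) *
        (b : ℂ) * (u τ : ℂ) := by
    -- The endpoint `τ = t` is discarded, as the series represents the kernel only at positive
    -- times.
    filter_upwards [compl_mem_ae_iff.2 (measure_singleton t)] with τ hτ hτt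
    rw [uIoc_of_le ht.le] at hτt
    have := (hmode (t - τ) (sub_pos.2 (lt_of_le_of_ne hτt.2 hτ))).tsum_eq
    rw [ofReal_sub] at this
    rw [this, mul_assoc]
  refine ⟨(hmode t ht).summable, hinit.summable, ?_, ?_⟩
  · refine (DelaySystem.intervalIntegrable_bounded_kernel
      (DelaySystem.measurable_fundamentalSol N a ad hh)
      (DelaySystem.exists_bound_fundamentalSol' N a ad hh) ht.le
      ((DelaySystem.intervalIntegrable_ofReal (hu t ht)).const_mul (b : ℂ)) t).congr_ae ?_
    exact (ae_restrict_iff' measurableSet_uIoc).2 hkernel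
  · rw [hx₀.tsum_eq, hinit.tsum_eq, ← intervalIntegral.integral_congr_ae hkernel,
      DelaySystem.forcedResponse, if_neg (not_lt.2 ht.le)]
    ring
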